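/- Let $k\in\mathbb N$. A *$k$-graph* $(\Lambda,d)$ is a countable category $\Lambda$ with range and source maps $r,s$ (its morphisms are called paths, and $\mu\nu$ is defined when $s(\mu)=r(\nu)$), together with a functor $d:\Lambda\to\mathbb N^k$ such that whenever $d(\lambda)=m+n$ there are unique paths $\mu,\nu$ with $\lambda=\mu\nu$, $d(\mu)=m$, $d(\nu)=n$. Write $\Lambda^0$ for the set of objects (identified with the paths of degree $0$), $e_1,\dots,e_k$ for the standard generators of $\mathbb N^k$, $\Lambda^m(v)=\{\lambda: d(\lambda)=m,\ r(\lambda)=v\}$, and $$\Lambda^{\le q}(v)=\{\lambda: r(\lambda)=v,\ d(\lambda)\le q,\ \text{and } \Lambda^{e_i}(s(\lambda))=\emptyset \text{ whenever } d(\lambda)+e_i\le q\}.$$ $\Lambda$ is *row-finite* if all $\Lambda^m(v)$ are finite, and *locally convex* if for all $v\in\Lambda^0$, $i\ne j$, $\lambda\in\Lambda^{e_i}(v)$ and $\mu\in\Lambda^{e_j}(v)$, the sets $\Lambda^{e_j}(s(\lambda))$ and $\Lambda^{e_i}(s(\mu))$ are nonempty. For row-finite $\Lambda$, $C^*(\Lambda)$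 is the universal $C^*$-algebra generated by a Cuntz–Krieger $\Lambda$-family, that is, by partial isometries $\{s_\lambda:\lambda\in\Lambda\}$ such that the $s_v$ ($v\in\Lambda^0$) are mutually orthogonal projections, $s_{\lambda\mu}=s_\lambda s_\mu$ when $s(\lambda)=r(\mu)$, $s_\lambda^*s_\lambda=s_{s(\lambda)}$, and $s_v=\sum_{\lambda\in\Lambda^{\le m}(v)}s_\lambda s_\lambda^*$ for all $v\in\Lambda^0$ and $m\in\mathbb N^k$. A set $H\subset\Lambda^0$ is *hereditary* if $r(\lambda)\in H$ implies $s(\lambda)\in H$ for every path $\lambda$, and *saturated* if $v\in H$ whenever $\{s(\lambda):\lambda\in\Lambda^{\le e_i}(v)\}\subset H$ for some $i\in\{1,\dots,k\}$. For $H\subset\Lambda^0$, let $I_H$ be the closed (two-sided) ideal of $C^*(\Lambda)$ generated by $\{s_v:v\in H\}$. For $H$ saturated and hereditary, $\Gamma(\Lambda\setminus H)$ is the $k$-graph with objects $\Lambda^0\setminus H$ and paths $\{\lambda\in\Lambda: s(\lambda)\notin H\}$. For $m\in(\mathbb N\cup\{\infty\})^k$, let $\Omega_{k,m}$ be the $k$-graph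 with objects $\{p\in\mathbb N^k:p\le m\}$ and paths the pairs $(p,q)$ of objects with $p\le q$, where $r(p,q)=p$, $s(p,q)=q$, $d(p,q)=q-p$. A *boundary path* of a $k$-graph $\Gamma$ is a degree-preserving functor $x:\Omega_{k,m}\to\Gamma$, for some $m$, such that $(\Omega_{k,m})^{\le e_i}(p)=\{p\}$ implies $\Gamma^{\le e_i}(x(p))=\{x(p)\}$; put $r(x)=x(0)$. If $s(\alpha)=r(x)$, then $\alpha x:\Omega_{k,d(\alpha)+m}\to\Gamma$ denotes the unique degree-preserving functor with $(\alpha x)(0,d(\alpha))=\alpha$ and $(\alpha x)(d(\alpha)+p,d(\alpha)+q)=x(p,q)$ for all $p\le q\le m$. *Condition (B)* for $\Gamma$ is: for each $v\in\Gamma^0$ there is a boundary path $x$ with $r(x)=v$ such that $\alpha x\ne\beta x$ for all distinct paths $\alpha,\beta$ of $\Gamma$ with $s(\alpha)=s(\beta)=v$. **Theorem.** Let $(\Lambda,d)$ be a locally convex row-finite $k$-graph such that for every saturated hereditary subset $H$ of $\Lambda^0$, the $k$-graph $\Gamma(\Lambda\setminus H)$ satisfies condition (B). Then $H\mapsto I_H$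 is an isomorphism of the lattice of saturated hereditary subsets of $\Lambda^0$ onto the lattice of closed ideals of $C^*(\Lambda)$ (both ordered by inclusion). -/

import Mathlib

open scoped ENNReal

universe u v w

/-! ### Graphs of rank `k` -/

/-- A graph of rank `k`: a countable category, presented by its set of objects (`Vertex`), its set
of morphisms (`Path`), range and source maps, identities and composition
(`comp μ ν h` is the composite `μν`, defined when `s(μ) = r(ν)`), together with a degree functor
`d` to `ℕ^k` having the factorisation property. -/
structure KGraph (k : ℕ) where
  Vertex : Type u
  Path : Type u
  countable_path : Countable Path
  r : Path → Vertex
  s : Path → Vertex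
  id : Vertex → Path
  comp : (μ ν : Path) → s μ = r ν → Path
  r_id : ∀ v, r (id v) = v
  s_id : ∀ v, s (id v) = v
  r_comp : ∀ μ ν h, r (comp μ ν h) = r μ
  s_comp : ∀ μ ν h, s (comp μ ν h) = s ν
  id_comp : ∀ μ, comp (id (r μ)) μ (s_id _) = μ
  comp_id : ∀ μ, comp μ (id (s μ)) (r_id _).symm = μ
  assoc : ∀ (μ ν ρ : Path) (h : s μ = r ν) (h' : s ν = r ρ),
    comp (comp μ ν h) ρ ((s_comp μ ν h).trans h') = comp μ (comp ν ρ h') (h.trans (r_comp ν ρ h').symm)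
  d : Path → (Fin k → ℕ)
  d_id : ∀ v, d (id v) = 0
  d_comp : ∀ μ ν h, d (comp μ ν h) = d μ + d ν
  factorisation : ∀ (ρ : Path) (m n : Fin k → ℕ), d ρ = m + n →
    ∃! p : Path × Path, (∃ h : s p.1 = r p.2, comp p.1 p.2 h = ρ) ∧ d p.1 = m ∧ d p.2 = n

/-- A morphism of `k`-graphs: a functor which respects the degree maps. -/
structure KGraph.Morphism {k : ℕ} (Λ₁ : KGraph.{u} k) (Λ₂ : KGraph.{v} k) where
  obj : Λ₁.Vertex → Λ₂.Vertex
  map : Λ₁.Path → Λ₂.Path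
  r_map : ∀ μ, Λ₂.r (map μ) = obj (Λ₁.r μ)
  s_map : ∀ μ, Λ₂.s (map μ) = obj (Λ₁.s μ)
  map_id : ∀ v, map (Λ₁.id v) = Λ₂.id (obj v)
  map_comp : ∀ (μ ν : Λ₁.Path) (h : Λ₁.s μ = Λ₁.r ν),
    map (Λ₁.comp μ ν h) = Λ₂.comp (map μ) (map ν) (by rw [s_map, r_map, h])
  d_map : ∀ μ, Λ₂.d (map μ) = Λ₁.d μ

/-- The `k`-graph `Ω_{k,m}`, for `m ∈ (ℕ ∪ {∞})^k`: objects are the `p ∈ ℕ^k` with `p ≤ m`,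
morphisms are the pairs `(p, q)` with `p ≤ q`, where `r(p, q) = p`, `s(p, q) = q` and
`d(p, q) = q - p`. -/
def KGraph.Omega (k : ℕ) (m : Fin k → ℕ∞) : KGraph.{0} k where
  Vertex := {p : Fin k → ℕ // ∀ i, (p i : ℕ∞) ≤ m i}
  Path := {x : {p : Fin k → ℕ // ∀ i, (p i : ℕ∞) ≤ m i} × {p : Fin k → ℕ // ∀ i, (p i : ℕ∞) ≤ m i} //
    x.1.1 ≤ x.2.1}
  countable_path := inferInstance
  r x := x.1.1
  s x := x.1.2
  id p := ⟨(p, p), le_rfl⟩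
  comp x y h := ⟨(x.1.1, y.1.2), x.2.trans ((congrArg Subtype.val h).le.trans y.2)⟩
  r_id _ := rfl
  s_id _ := rfl
  r_comp _ _ _ := rfl
  s_comp _ _ _ := rfl
  id_comp _ := rfl
  comp_id _ := rfl
  assoc _ _ _ _ _ := rfl
  d x := x.1.2.1 - x.1.1.1
  d_id _ := by simp
  d_comp := by
    rintro ⟨⟨⟨p, hp⟩, ⟨q, hq⟩⟩, hpq⟩ ⟨⟨⟨q', hq'⟩, ⟨t, ht⟩⟩, hqt⟩ h
    obtain rfl : q = q' := congrArg Subtype.val h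
    funext i
    have h1 : p i ≤ q i := hpq i
    have h2 : q i ≤ t i := hqt i
    simp only [Pi.sub_apply, Pi.add_apply]
    omega
  factorisation := by
    rintro ⟨⟨⟨p, hp⟩, ⟨q, hq⟩⟩, hpq⟩ m' n' hd
    have hpq' : ∀ i, p i ≤ q i := hpq
    have hd' : ∀ i, q i - p i = m' i + n' i := fun i => congrFun hd i
    refine ⟨(⟨(⟨p, hp⟩, ⟨p + m', fun i => ?_⟩), fun i => ?_⟩,
      ⟨(⟨p + m', fun i => ?_⟩, ⟨q, hq⟩), fun i => ?_⟩), ⟨⟨rfl, rfl⟩, ?_, ?_⟩, ?_⟩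
    · refine le_trans ?_ (hq i)
      have h1 := hd' i
      have h2 := hpq' i
      have : (p + m') i ≤ q i := by simp only [Pi.add_apply]; omega
      exact_mod_cast this
    · simp
    · refine le_trans ?_ (hq i)
      have h1 := hd' i
      have h2 := hpq' i
      have : (p + m') i ≤ q i := by simp only [Pi.add_apply]; omega
      exact_mod_cast this
    · have h1 := hd' i
      have h2 := hpq' i
      simp only [Pi.add_apply]
      omega
    · funext i
      simp
    · funext i
      have h1 := hd' i
      have h2 := hpq' i
      simp only [Pi.sub_apply, Pi.add_apply]
      omega
    · rintro ⟨⟨⟨⟨a, ha⟩, ⟨b, hb⟩⟩, hab⟩, ⟨⟨⟨b', hb'⟩, ⟨c, hc⟩⟩, hbc⟩⟩ ⟨⟨h, hcomp⟩, h1, h2⟩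
      obtain rfl : b = b' := congrArg Subtype.val h
      simp only [Subtype.mk.injEq, Prod.mk.injEq] at hcomp
      obtain ⟨rfl, rfl⟩ := hcomp
      have hb2 : b = a + m' := by
        funext i
        have h3 : b i - a i = m' i := congrFun h1 i
        have h4 : a i ≤ b i := hab i
        simp only [Pi.add_apply]
        omega
      subst hb2
      rfl

namespace KGraph

variable {k : ℕ}

/-- `Λ^m(v)`: the paths of degree `m` with range `v`. -/
def pathsAt (Λ : KGraph.{u} k) (m : Fin k → ℕ) (v : Λ.Vertex) : Set Λ.Path :=
  {μ | Λ.d μ = m ∧ Λ.r μ = v}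

/-- `Λ` is row-finite if every `Λ^m(v)` is finite. -/
def RowFinite (Λ : KGraph.{u} k) : Prop :=
  ∀ (v : Λ.Vertex) (m : Fin k → ℕ), (Λ.pathsAt m v).Finite

/-- The `i`-th standard generator `e_i` of `ℕ^k`. -/
def e (i : Fin k) : Fin k → ℕ := Pi.single i 1

/-- `Λ` is locally convex if, for all `v`, all `i ≠ j`, all `μ ∈ Λ^{e_i}(v)` and
`ν ∈ Λ^{e_j}(v)`, the sets `Λ^{e_j}(s(μ))` and `Λ^{e_i}(s(ν))` are nonempty. -/
def LocallyConvex (Λ : KGraph.{u} k) : Prop :=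
  ∀ (v : Λ.Vertex) (i j : Fin k), i ≠ j → ∀ μ ∈ Λ.pathsAt (e i) v, ∀ ν ∈ Λ.pathsAt (e j) v,
    (Λ.pathsAt (e j) (Λ.s μ)).Nonempty ∧ (Λ.pathsAt (e i) (Λ.s ν)).Nonempty

/-- `Λ^{≤q}(v)`: the paths `μ` with range `v` and `d(μ) ≤ q` such that `Λ^{e_i}(s(μ))` is empty
whenever `d(μ) + e_i ≤ q`. -/
def upTo (Λ : KGraph.{u} k) (q : Fin k → ℕ) (v : Λ.Vertex) : Set Λ.Path :=
  {μ | (Λ.d μ ≤ q ∧ ∀ i, Λ.d μ + e i ≤ q → Λ.pathsAt (e i) (Λ.s μ) = ∅) ∧ Λ.r μ = v}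

/-! ### Boundary paths and condition (B) -/

/-- A graph morphism `x : Ω_{k,m} → Λ` for some `m ∈ (ℕ ∪ {∞})^k`. -/
structure GPath (Λ : KGraph.{u} k) where
  deg : Fin k → ℕ∞
  hom : Morphism (Omega k deg) Λ

/-- The path `x(p, q)`, for `p ≤ q ≤ d(x)`. -/
def GPath.seg {Λ : KGraph.{u} k} (x : Λ.GPath) (p q : Fin k → ℕ) (hpq : p ≤ q)
    (hq : ∀ i, (q i : ℕ∞) ≤ x.deg i) : Λ.Path :=
  x.hom.map ⟨(⟨p, fun i => (Nat.cast_le.mpr (hpq i)).trans (hq i)⟩, ⟨q, hq⟩), hpq⟩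

/-- The range `r(x) = x(0)`. -/
def GPath.range {Λ : KGraph.{u} k} (x : Λ.GPath) : Λ.Vertex :=
  x.hom.obj ⟨0, fun i => by simp⟩

/-- `x : Ω_{k,m} → Λ` is a boundary path if, whenever an object `p` of `Ω_{k,m}` satisfies
`(Ω_{k,m})^{≤e_i}(p) = {p}`, also `Λ^{≤e_i}(x(p)) = {x(p)}`. -/
def GPath.IsBoundary {Λ : KGraph.{u} k} (x : Λ.GPath) : Prop :=
  ∀ (i : Fin k) (p : (Omega k x.deg).Vertex),
    (Omega k x.deg).upTo (e i) p = {(Omega k x.deg).id p} →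
      Λ.upTo (e i) (x.hom.obj p) = {Λ.id (x.hom.obj p)}

/-- `y = αx`: the graph morphism `y` has degree `d(α) + d(x)`, begins with `α`, i.e.
`y(0, d(α)) = α`, and continues with `x`, i.e. `y(d(α) + p, d(α) + q) = x(p, q)` for all
`p ≤ q ≤ d(x)`. When `s(α) = r(x)` there is exactly one such `y`. -/
def IsConcat {Λ : KGraph.{u} k} (α : Λ.Path) (x y : Λ.GPath) : Prop :=
  ∃ hdeg : ∀ i, y.deg i = (Λ.d α i : ℕ∞) + x.deg i,
    y.seg 0 (Λ.d α) (fun _ => Nat.zero_le _) (fun i => by rw [hdeg i]; exact le_self_add) = α ∧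
    ∀ (p q : Fin k → ℕ) (hpq : p ≤ q) (hq : ∀ i, (q i : ℕ∞) ≤ x.deg i),
      y.seg (Λ.d α + p) (Λ.d α + q) (add_le_add_right hpq _)
        (fun i => by
          rw [hdeg i, Pi.add_apply, Nat.cast_add]; exact add_le_add_right (hq i) _) =
      x.seg p q hpq hq

/-- Condition (B): for every vertex `v` there is a boundary path `x` with `r(x) = v` such that
`α ≠ β` implies `αx ≠ βx`, for all paths `α`, `β` with source `v`. -/
def ConditionB (Λ : KGraph.{u} k) : Prop :=
  ∀ v : Λ.Vertex, ∃ x : Λ.GPath, x.IsBoundary ∧ x.range = v ∧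
    ∀ α β : Λ.Path, Λ.s α = v → Λ.s β = v → α ≠ β →
      ∀ y z : Λ.GPath, IsConcat α x y → IsConcat β x z → y ≠ z

/-! ### Saturated hereditary sets of vertices -/

/-- `H` is hereditary: if `v ≥ w`, i.e. some path has range `v` and source `w`, and `v ∈ H`, then
`w ∈ H`. -/
def Hereditary (Λ : KGraph.{u} k) (H : Set Λ.Vertex) : Prop :=
  ∀ v w : Λ.Vertex, (∃ μ : Λ.Path, Λ.r μ = v ∧ Λ.s μ = w) → v ∈ H → w ∈ H

/-- `H` is saturated: if, for some `i`, all sources of paths in `Λ^{≤e_i}(v)` lie in `H`, then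
`v ∈ H`. -/
def Saturated (Λ : KGraph.{u} k) (H : Set Λ.Vertex) : Prop :=
  ∀ v : Λ.Vertex, (∃ i : Fin k, ∀ μ ∈ Λ.upTo (e i) v, Λ.s μ ∈ H) → v ∈ H

/-- The saturated hereditary subsets of `Λ^0`, ordered by inclusion. -/
abbrev SatHered (Λ : KGraph.{u} k) : Type u :=
  {H : Set Λ.Vertex // Λ.Saturated H ∧ Λ.Hereditary H}

/-- The saturated hereditary subsets form a (complete) lattice under inclusion, because
they are stable under intersections. -/
noncomputable instance (Λ : KGraph.{u} k) : CompleteLattice Λ.SatHered :=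
  letI : InfSet Λ.SatHered := ⟨fun S => ⟨⋂ H ∈ S, (H : Set Λ.Vertex),
    fun v ⟨i, hi⟩ => Set.mem_iInter₂.mpr fun H hH =>
      H.2.1 v ⟨i, fun μ hμ => Set.mem_iInter₂.mp (hi μ hμ) H hH⟩,
    fun v w hvw hv => Set.mem_iInter₂.mpr fun H hH =>
      H.2.2 v w hvw (Set.mem_iInter₂.mp hv H hH)⟩⟩
  completeLatticeOfInf Λ.SatHered fun _ =>
    ⟨fun _ hH => Set.biInter_subset_of_mem hH, fun _ hK => Set.subset_iInter₂ fun _ hH => hK hH⟩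

/-- The `k`-graph `Γ(Λ ∖ H)`, with vertex set `Λ^0 ∖ H`, and with paths the `μ ∈ Λ` such that
`s(μ) ∉ H`. -/
def quotientGraph (Λ : KGraph.{u} k) (H : Set Λ.Vertex) (hH : Λ.Hereditary H) : KGraph.{u} k where
  Vertex := {v : Λ.Vertex // v ∉ H}
  Path := {μ : Λ.Path // Λ.s μ ∉ H}
  countable_path := by
    have := Λ.countable_path
    infer_instance
  r μ := ⟨Λ.r μ.1, fun h => μ.2 (hH _ _ ⟨μ.1, rfl, rfl⟩ h)⟩
  s μ := ⟨Λ.s μ.1, μ.2⟩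
  id v := ⟨Λ.id v.1, by rw [Λ.s_id]; exact v.2⟩
  comp μ ν h := ⟨Λ.comp μ.1 ν.1 (congrArg Subtype.val h), by rw [Λ.s_comp]; exact ν.2⟩
  r_id v := Subtype.ext (Λ.r_id _)
  s_id v := Subtype.ext (Λ.s_id _)
  r_comp _ _ _ := Subtype.ext (Λ.r_comp _ _ _)
  s_comp _ _ _ := Subtype.ext (Λ.s_comp _ _ _)
  id_comp _ := Subtype.ext (Λ.id_comp _)
  comp_id _ := Subtype.ext (Λ.comp_id _)
  assoc _ _ _ _ _ := Subtype.ext (Λ.assoc _ _ _ _ _)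
  d μ := Λ.d μ.1
  d_id _ := Λ.d_id _
  d_comp _ _ _ := Λ.d_comp _ _ _
  factorisation := by
    rintro ⟨ρ, hρ⟩ m n hd
    obtain ⟨⟨μ, ν⟩, ⟨⟨h, hc⟩, hm, hn⟩, huniq⟩ := Λ.factorisation ρ m n hd
    have hν : Λ.s ν ∉ H := by
      rw [← hc, Λ.s_comp] at hρ
      exact hρ
    have hμ : Λ.s μ ∉ H := fun hs => hν (hH _ _ ⟨ν, h.symm, rfl⟩ hs)
    refine ⟨(⟨μ, hμ⟩, ⟨ν, hν⟩), ⟨⟨Subtype.ext h, Subtype.ext hc⟩, hm, hn⟩, ?_⟩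
    rintro ⟨⟨μ', hμ'⟩, ⟨ν', hν'⟩⟩ ⟨⟨h', hc'⟩, hm', hn'⟩
    have := huniq (μ', ν') ⟨⟨congrArg Subtype.val h', congrArg Subtype.val hc'⟩, hm', hn'⟩
    simp only [Prod.mk.injEq] at this
    obtain ⟨rfl, rfl⟩ := this
    rfl

/-! ### Cuntz-Krieger families and the algebra `C*(Λ)` -/

/-- A Cuntz-Krieger `Λ`-family in a (not necessarily unital) C⋆-algebra. The sum in the last
relation is finite when `Λ` is row-finite. -/
structure IsCuntzKrieger (Λ : KGraph.{u} k) {B : Type v} [NonUnitalCStarAlgebra B]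
    (t : Λ.Path → B) : Prop where
  partialIsometry : ∀ μ, t μ * star (t μ) * t μ = t μ
  projection : ∀ v, IsStarProjection (t (Λ.id v))
  orthogonal : ∀ v w, v ≠ w → t (Λ.id v) * t (Λ.id w) = 0
  map_comp : ∀ (μ ν : Λ.Path) (h : Λ.s μ = Λ.r ν), t (Λ.comp μ ν h) = t μ * t ν
  star_mul_self : ∀ μ, star (t μ) * t μ = t (Λ.id (Λ.s μ))
  sum_upTo : ∀ (v : Λ.Vertex) (m : Fin k → ℕ),
    t (Λ.id v) = ∑ᶠ μ ∈ Λ.upTo m v, t μ * star (t μ)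

theorem IsCuntzKrieger.norm_le_one {Λ : KGraph.{u} k} {B : Type v} [NonUnitalCStarAlgebra B]
    {t : Λ.Path → B} (ht : Λ.IsCuntzKrieger t) (μ : Λ.Path) : ‖t μ‖ ≤ 1 := by
  have h1 : ‖t μ‖ * ‖t μ‖ ≤ 1 := by
    rw [← CStarRing.norm_star_mul_self, ht.star_mul_self]
    exact IsStarProjection.norm_le _ (ht.projection _)
  nlinarith [norm_nonneg (t μ)]

/-- A Cuntz-Krieger `Λ`-family in some C⋆-algebra whose underlying set is a set of real numbers.
Since `Λ` is countable, a C⋆-algebra generated by a Cuntz-Krieger `Λ`-family has at most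
continuum many elements, so up to isomorphism all of them occur here. -/
structure CKRep (Λ : KGraph.{u} k) where
  carrier : Set ℝ
  alg : NonUnitalCStarAlgebra carrier
  fam : Λ.Path → carrier
  isCuntzKrieger : Λ.IsCuntzKrieger fam

/-- The C⋆-algebra in which the family lives; this is a type synonym of `ρ.carrier`, so that it does
not inherit any structure from `ℝ`. -/
def CKRep.Alg {Λ : KGraph.{u} k} (ρ : Λ.CKRep) : Type := ρ.carrier

noncomputable instance {Λ : KGraph.{u} k} (ρ : Λ.CKRep) : NonUnitalCStarAlgebra ρ.Alg := ρ.alg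

/-- The Cuntz-Krieger family of `ρ`, with values in `ρ.Alg`. -/
def CKRep.t {Λ : KGraph.{u} k} (ρ : Λ.CKRep) : Λ.Path → ρ.Alg := ρ.fam

theorem CKRep.isCuntzKrieger_t {Λ : KGraph.{u} k} (ρ : Λ.CKRep) : Λ.IsCuntzKrieger ρ.t :=
  ρ.isCuntzKrieger

/-- The direct sum of all Cuntz-Krieger `Λ`-families, in the C⋆-algebra of bounded elements of the
product. -/
noncomputable def bigFam (Λ : KGraph.{u} k) (μ : Λ.Path) :
    lp (fun ρ : Λ.CKRep => ρ.Alg) ∞ :=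
  ⟨fun ρ => ρ.t μ, memℓp_infty ⟨1, by
    rintro _ ⟨ρ, rfl⟩
    exact ρ.isCuntzKrieger_t.norm_le_one μ⟩⟩

/-- The closed star-subalgebra generated by the direct sum of all Cuntz-Krieger families. -/
noncomputable def cstarSubalgebra (Λ : KGraph.{u} k) :
    NonUnitalStarSubalgebra ℂ (lp (fun ρ : Λ.CKRep => ρ.Alg) ∞) :=
  (NonUnitalStarAlgebra.adjoin ℂ (Set.range Λ.bigFam)).topologicalClosure

/-- `C*(Λ)`, the universal C⋆-algebra generated by a Cuntz-Krieger `Λ`-family; the universal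
property is `KGraph.CStar.existsUnique_lift` below. -/
def CStar (Λ : KGraph.{u} k) : Type u := Λ.cstarSubalgebra

noncomputable instance (Λ : KGraph.{u} k) : NonUnitalCStarAlgebra Λ.CStar :=
  NonUnitalStarSubalgebra.nonUnitalCStarAlgebra Λ.cstarSubalgebra
    (h_closed := NonUnitalStarSubalgebra.isClosed_topologicalClosure _)

/-- The generators `s_μ` of `C*(Λ)`. -/
noncomputable def CStar.gen (Λ : KGraph.{u} k) (μ : Λ.Path) : Λ.CStar :=
  ⟨Λ.bigFam μ, NonUnitalStarSubalgebra.le_topologicalClosure _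
    (NonUnitalStarAlgebra.subset_adjoin ℂ _ ⟨μ, rfl⟩)⟩

/-! ### The universal property of `C*(Λ)` -/

/-- C⋆-algebra structures can be transferred along bijections. -/
theorem exists_transfer {A : Type v} [NonUnitalCStarAlgebra A] {S : Type w}
    (e : S ≃ A) : ∃ _ : NonUnitalCStarAlgebra S, ∃ φ : S →⋆ₙₐ[ℂ] A, ∀ x, φ x = e x := by
  let : NonUnitalRing S := e.nonUnitalRing
  let : Module ℂ S := e.module ℂ
  let : StarRing S := e.starRing
  let φ : S →⋆ₙₐ[ℂ] A :=
    { toFun := e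
      map_smul' := fun c x => e.apply_symm_apply _
      map_zero' := e.apply_symm_apply _
      map_add' := fun x y => e.apply_symm_apply _
      map_mul' := fun x y => e.apply_symm_apply _
      map_star' := fun x => e.apply_symm_apply _ }
  have hinj : Function.Injective φ := e.injective
  let : NonUnitalNormedRing S := NonUnitalNormedRing.induced S A φ hinj
  let : NormedSpace ℂ S := NormedSpace.induced ℂ S A φ
  have hnorm : ∀ x : S, ‖x‖ = ‖φ x‖ := fun _ => rfl
  have hiso : Isometry φ := AddMonoidHomClass.isometry_of_norm φ fun x => rfl
  have : CompleteSpace S := by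
    have := (hiso.isUniformInducing.completeSpace_congr e.surjective).mpr inferInstance
    exact this
  have : CStarRing S := ⟨fun x => by
    rw [hnorm, hnorm, map_mul, map_star]
    exact CStarRing.norm_mul_self_le _⟩
  have : IsScalarTower ℂ S S := ⟨fun c x y => hinj (by
    simp only [smul_eq_mul, map_mul, map_smul, smul_mul_assoc])⟩
  have : SMulCommClass ℂ S S := ⟨fun c x y => hinj (by
    simp only [smul_eq_mul, map_mul, map_smul, mul_smul_comm])⟩
  have : StarModule ℂ S := ⟨fun c x => hinj (by
    simp only [map_smul, map_star, star_smul])⟩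
  exact ⟨{}, φ, fun _ => rfl⟩

theorem RowFinite.finite_upTo {Λ : KGraph.{u} k} (h : Λ.RowFinite) (m : Fin k → ℕ)
    (v : Λ.Vertex) : (Λ.upTo m v).Finite :=
  ((Set.finite_Iic m).biUnion fun n _ => h v n).subset fun μ hμ =>
    Set.mem_biUnion (show Λ.d μ ∈ Set.Iic m from hμ.1.1) ⟨rfl, hμ.2⟩

/-- Cuntz-Krieger families are preserved by star homomorphisms. -/
theorem IsCuntzKrieger.map {Λ : KGraph.{u} k} (hΛ : Λ.RowFinite) {B : Type v} {C : Type w}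
    [NonUnitalCStarAlgebra B] [NonUnitalCStarAlgebra C] {t : Λ.Path → B}
    (ht : Λ.IsCuntzKrieger t) (φ : B →⋆ₙₐ[ℂ] C) : Λ.IsCuntzKrieger fun μ => φ (t μ) where
  partialIsometry μ := by rw [← map_star, ← map_mul, ← map_mul, ht.partialIsometry]
  projection v := (ht.projection v).map φ
  orthogonal v w h := by rw [← map_mul, ht.orthogonal v w h, map_zero]
  map_comp μ ν h := by rw [ht.map_comp, map_mul]
  star_mul_self μ := by rw [← map_star, ← map_mul, ht.star_mul_self]
  sum_upTo v m := by
    have hfin := hΛ.finite_upTo m v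
    rw [ht.sum_upTo v m, finsum_mem_eq_finite_toFinset_sum _ hfin,
      finsum_mem_eq_finite_toFinset_sum _ hfin, map_sum]
    simp only [map_mul, map_star]

theorem IsCuntzKrieger.of_injective {Λ : KGraph.{u} k} (hΛ : Λ.RowFinite) {B : Type v} {C : Type w}
    [NonUnitalCStarAlgebra B] [NonUnitalCStarAlgebra C] {t : Λ.Path → B}
    (φ : B →⋆ₙₐ[ℂ] C) (hφ : Function.Injective φ) (ht : Λ.IsCuntzKrieger fun μ => φ (t μ)) :
    Λ.IsCuntzKrieger t where
  partialIsometry μ := hφ (by rw [map_mul, map_mul, map_star]; exact ht.partialIsometry μ)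
  projection v := ⟨hφ (by rw [map_mul]; exact (ht.projection v).isIdempotentElem),
    hφ (by rw [map_star]; exact (ht.projection v).isSelfAdjoint)⟩
  orthogonal v w h := hφ (by rw [map_mul, map_zero]; exact ht.orthogonal v w h)
  map_comp μ ν h := hφ (by rw [map_mul]; exact ht.map_comp μ ν h)
  star_mul_self μ := hφ (by rw [map_mul, map_star]; exact ht.star_mul_self μ)
  sum_upTo v m := hφ (by
    have hfin := hΛ.finite_upTo m v
    have h := ht.sum_upTo v m
    rw [finsum_mem_eq_finite_toFinset_sum _ hfin] at h ⊢
    rw [map_sum, h]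
    simp only [map_mul, map_star])

/-- The projection of the product onto one coordinate. -/
noncomputable def CKRep.eval {Λ : KGraph.{u} k} (ρ : Λ.CKRep) :
    lp (fun ρ : Λ.CKRep => ρ.Alg) ∞ →⋆ₙₐ[ℂ] ρ.Alg where
  toFun x := x ρ
  map_smul' _ _ := rfl
  map_zero' := rfl
  map_add' _ _ := rfl
  map_mul' _ _ := rfl
  map_star' _ := rfl

theorem isCuntzKrieger_bigFam {Λ : KGraph.{u} k} (hΛ : Λ.RowFinite) :
    Λ.IsCuntzKrieger Λ.bigFam where
  partialIsometry μ := lp.ext (funext fun ρ => ρ.isCuntzKrieger_t.partialIsometry μ)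
  projection v := ⟨lp.ext (funext fun ρ => (ρ.isCuntzKrieger_t.projection v).isIdempotentElem),
    lp.ext (funext fun ρ => (ρ.isCuntzKrieger_t.projection v).isSelfAdjoint)⟩
  orthogonal v w h := lp.ext (funext fun ρ => ρ.isCuntzKrieger_t.orthogonal v w h)
  map_comp μ ν h := lp.ext (funext fun ρ => ρ.isCuntzKrieger_t.map_comp μ ν h)
  star_mul_self μ := lp.ext (funext fun ρ => ρ.isCuntzKrieger_t.star_mul_self μ)
  sum_upTo v m := lp.ext (funext fun ρ => by
    have hfin := hΛ.finite_upTo m v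
    have h := ρ.isCuntzKrieger_t.sum_upTo v m
    rw [finsum_mem_eq_finite_toFinset_sum _ hfin] at h ⊢
    change _ = ρ.eval _
    rw [map_sum]
    exact h)

/-- The generators of `C*(Λ)` form a Cuntz-Krieger `Λ`-family. -/
theorem CStar.isCuntzKrieger_gen {Λ : KGraph.{u} k} (hΛ : Λ.RowFinite) :
    Λ.IsCuntzKrieger (CStar.gen Λ) :=
  IsCuntzKrieger.of_injective (C := lp (fun ρ : Λ.CKRep => ρ.Alg) ∞) hΛ
    (NonUnitalStarSubalgebraClass.subtype Λ.cstarSubalgebra) Subtype.val_injective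
    (isCuntzKrieger_bigFam hΛ)

theorem CKRep.exists_hom {Λ : KGraph.{u} k} (hΛ : Λ.RowFinite) {B : Type v}
    [NonUnitalCStarAlgebra B] {t : Λ.Path → B} (ht : Λ.IsCuntzKrieger t) :
    ∃ (ρ : Λ.CKRep) (φ : ρ.Alg →⋆ₙₐ[ℂ] B), ∀ μ, φ (ρ.t μ) = t μ := by
  let S : NonUnitalStarSubalgebra ℂ B :=
    (NonUnitalStarAlgebra.adjoin ℂ (Set.range t)).topologicalClosure
  have hSc : IsClosed (S : Set B) := NonUnitalStarSubalgebra.isClosed_topologicalClosure _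
  let : NonUnitalCStarAlgebra S :=
    NonUnitalStarSubalgebra.nonUnitalCStarAlgebra S (h_closed := hSc)
  have hcount : (Set.range t ∪ star (Set.range t)).Countable := by
    have := Λ.countable_path
    have h : (Set.range t).Countable := Set.countable_range t
    refine h.union ?_
    rw [← Set.image_star]
    exact h.image _
  have hsg : ((Subsemigroup.closure (Set.range t ∪ star (Set.range t)) : Subsemigroup B) :
      Set B).Countable := by
    have := hcount.to_subtype
    let P : FreeSemigroup (Set.range t ∪ star (Set.range t) : Set B) →ₙ* B :=
      FreeSemigroup.lift (Subtype.val)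
    have : Countable (FreeSemigroup (Set.range t ∪ star (Set.range t) : Set B)) := by
      refine Function.Injective.countable (f := fun x => (x.head, x.tail)) ?_
      rintro ⟨a, b⟩ ⟨c, d⟩ h
      simpa using h
    refine (Set.countable_range P).mono ?_
    have : Subsemigroup.closure (Set.range t ∪ star (Set.range t)) ≤ P.srange :=
      Subsemigroup.closure_le.mpr fun x hx => ⟨FreeSemigroup.of ⟨x, hx⟩, by simp [P]⟩
    exact this
  have hsep : TopologicalSpace.IsSeparable (S : Set B) := by
    change TopologicalSpace.IsSeparable (closure _)
    rw [TopologicalSpace.isSeparable_closure]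
    have h := NonUnitalStarAlgebra.adjoin_eq_span (R := ℂ) (Set.range t)
    have h2 := congrArg (fun p : Submodule ℂ B => (p : Set B)) h
    change ((NonUnitalStarAlgebra.adjoin ℂ (Set.range t) : NonUnitalStarSubalgebra ℂ B) : Set B) =
      _ at h2
    rw [h2]
    exact hsg.isSeparable.span
  have : TopologicalSpace.SeparableSpace S := hsep.separableSpace
  have : SecondCountableTopology S := UniformSpace.secondCountable_of_separable S
  have : CompleteSpace S := hSc.completeSpace_coe
  let : MeasurableSpace S := borel S
  have : BorelSpace S := ⟨rfl⟩
  have : PolishSpace S := inferInstance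
  obtain ⟨f, hf⟩ := MeasureTheory.exists_measurableEmbedding_real S
  obtain ⟨inst, φ, hφ⟩ :=
    exists_transfer (Equiv.ofInjective f hf.injective).symm
  let e := Equiv.ofInjective f hf.injective
  let ts : Λ.Path → S := fun μ => ⟨t μ, NonUnitalStarSubalgebra.le_topologicalClosure _
    (NonUnitalStarAlgebra.subset_adjoin ℂ _ ⟨μ, rfl⟩)⟩
  have hts : Λ.IsCuntzKrieger ts := IsCuntzKrieger.of_injective hΛ
    (NonUnitalStarSubalgebraClass.subtype S) Subtype.val_injective ht
  have hval : ∀ μ, φ (e (ts μ)) = ts μ := fun μ => by rw [hφ]; exact e.symm_apply_apply _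
  have hinj : Function.Injective φ := fun x y h => by
    rw [hφ, hφ] at h
    exact e.symm.injective h
  refine ⟨⟨Set.range f, inst, fun μ => e (ts μ), IsCuntzKrieger.of_injective hΛ φ hinj ?_⟩,
    (NonUnitalStarSubalgebraClass.subtype S).comp φ, fun μ => ?_⟩
  · simpa only [hval] using hts
  · exact congrArg Subtype.val (hval μ)

/-- The universal property of `C*(Λ)`. -/
theorem CStar.existsUnique_lift {Λ : KGraph.{u} k} (hΛ : Λ.RowFinite) {B : Type v}
    [NonUnitalCStarAlgebra B] {t : Λ.Path → B} (ht : Λ.IsCuntzKrieger t) :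
    ∃! π : Λ.CStar →⋆ₙₐ[ℂ] B, ∀ μ, π (CStar.gen Λ μ) = t μ := by
  obtain ⟨ρ, φ, hφ⟩ := CKRep.exists_hom hΛ ht
  let incl : Λ.CStar →⋆ₙₐ[ℂ] lp (fun ρ : Λ.CKRep => ρ.Alg) ∞ :=
    NonUnitalStarSubalgebraClass.subtype Λ.cstarSubalgebra
  refine ⟨(φ.comp ρ.eval).comp incl, hφ, ?_⟩
  intro π hπ
  generalize hψ : (φ.comp ρ.eval).comp incl = ψ
  have hψ' : ∀ μ, ψ (CStar.gen Λ μ) = t μ := by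
    rw [← hψ]
    exact hφ
  have hcl : IsClosed {x : Λ.CStar | π x = ψ x} :=
    isClosed_eq
      (AddMonoidHomClass.continuous_of_bound π 1 fun x => by
        rw [one_mul]; exact NonUnitalStarAlgHom.norm_apply_le π x)
      (AddMonoidHomClass.continuous_of_bound ψ 1 fun x => by
        rw [one_mul]; exact NonUnitalStarAlgHom.norm_apply_le ψ x)
  have hsub : ∀ y ∈ NonUnitalStarAlgebra.adjoin ℂ (Set.range Λ.bigFam),
      ∃ x : Λ.CStar, x ∈ {x : Λ.CStar | π x = ψ x} ∧ incl x = y := by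
    intro y hy
    induction hy using NonUnitalStarAlgebra.adjoin_induction with
    | mem y hy =>
      obtain ⟨μ, rfl⟩ := hy
      exact ⟨CStar.gen Λ μ, (hπ μ).trans (hψ' μ).symm, rfl⟩
    | add y z _ _ h1 h2 =>
      obtain ⟨a, ha, rfl⟩ := h1
      obtain ⟨b, hb, rfl⟩ := h2
      exact ⟨a + b, by
        simp only [Set.mem_ofPred_eq] at ha hb ⊢
        rw [map_add, map_add, ha, hb], map_add _ _ _⟩
    | zero => exact ⟨0, by simp, map_zero _⟩
    | mul y z _ _ h1 h2 =>
      obtain ⟨a, ha, rfl⟩ := h1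
      obtain ⟨b, hb, rfl⟩ := h2
      exact ⟨a * b, by
        simp only [Set.mem_ofPred_eq] at ha hb ⊢
        rw [map_mul, map_mul, ha, hb], map_mul _ _ _⟩
    | smul c y _ h1 =>
      obtain ⟨a, ha, rfl⟩ := h1
      exact ⟨c • a, by
        simp only [Set.mem_ofPred_eq] at ha ⊢
        rw [map_smul, map_smul, ha], map_smul _ _ _⟩
    | star y _ h1 =>
      obtain ⟨a, ha, rfl⟩ := h1
      exact ⟨star a, by
        simp only [Set.mem_ofPred_eq] at ha ⊢
        rw [map_star, map_star, ha], map_star _ _⟩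
  ext x
  have hx : x ∈ closure {x : Λ.CStar | π x = ψ x} := by
    have hind : Topology.IsInducing (fun x : Λ.CStar => incl x) :=
      Topology.IsInducing.subtypeVal (t := {y | y ∈ Λ.cstarSubalgebra})
    rw [hind.closure_eq_preimage_closure_image]
    refine closure_mono ?_ x.2
    intro y hy
    obtain ⟨a, ha, hay⟩ := hsub y hy
    exact ⟨a, ha, hay⟩
  exact hcl.closure_subset hx


end KGraph

/-! ### Closed ideals -/

/-- The closed (two-sided) ideals of a C⋆-algebra, ordered by inclusion. -/
abbrev ClosedIdeal (A : Type u) [NonUnitalCStarAlgebra A] : Type u :=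
  {I : Submodule ℂ A // IsClosed (I : Set A) ∧ ∀ a : A, ∀ x ∈ I, a * x ∈ I ∧ x * a ∈ I}

/-- The closed ideals form a (complete) lattice under inclusion, because they are stable
under intersections. -/
noncomputable instance (A : Type u) [NonUnitalCStarAlgebra A] : CompleteLattice (ClosedIdeal A) :=
  letI : InfSet (ClosedIdeal A) := ⟨fun S => ⟨⨅ I ∈ S, (I : Submodule ℂ A), by
    constructor
    · simp only [Submodule.coe_iInf]
      exact isClosed_biInter fun I _ => I.2.1
    · intro a x hx
      simp only [Submodule.mem_iInf] at hx ⊢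
      exact ⟨fun I hI => (I.2.2 a x (hx I hI)).1, fun I hI => (I.2.2 a x (hx I hI)).2⟩⟩⟩
  completeLatticeOfInf (ClosedIdeal A) fun S =>
    ⟨fun I hI => (iInf₂_le I hI : (⨅ I ∈ S, (I : Submodule ℂ A)) ≤ I),
      fun J hJ => (le_iInf₂ fun I hI => hJ hI : (J : Submodule ℂ A) ≤ ⨅ I ∈ S, (I : Submodule ℂ A))⟩

/-- `I_H`, the closed ideal of `C*(Λ)` generated by `{s_v : v ∈ H}`, i.e. the smallest closed ideal
containing this set. -/
noncomputable def KGraph.idealOf {k : ℕ} (Λ : KGraph.{u} k) (H : Set Λ.Vertex) :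
    ClosedIdeal Λ.CStar :=
  sInf {I : ClosedIdeal Λ.CStar | ∀ v ∈ H, KGraph.CStar.gen Λ (Λ.id v) ∈ I.1}

/-! The inverse of H ↦ I_H is I ↦ {v : s_v ∈ I}, called `vertexSet`. The Cuntz–Krieger relations
make this set hereditary and saturated, since s_{s(μ)} = s_μ^* s_{r(μ)} s_μ and s_v is the sum of
the s_μ s_{s(μ)} s_μ^* over Λ^{≤e_i}(v). Both maps preserve inclusions, so it remains to see that
they are mutually inverse.

`vertexSet_idealOf`: no s_v with v ∉ H lies in I_H. The graph Γ(Λ∖H) acts on ℓ² of its boundary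
paths by x ↦ αx. Extended by zero on paths with source in H, this is a Cuntz–Krieger Λ-family, so it
defines a representation of C*(Λ) whose kernel contains I_H. It does not kill s_v for v ∉ H, because
condition (B) supplies a boundary path starting at v.

`le_idealOf_vertexSet`: an ideal I is generated by its vertex projections. With H = `vertexSet I`,
the quotients of C*(Λ) by I and by I_H both factor through the same map Ψ from C*(Λ) to C*(Γ(Λ∖H)).
The induced map from C*(Γ(Λ∖H)) to the quotient by I kills no vertex projection, so it is injective
by Cuntz–Krieger uniqueness. Hence I is contained in ker Ψ, and ker Ψ in I_H. This requires
quotients by closed ideals to be C*-algebras.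

Cuntz–Krieger uniqueness (`CStar.injective_of_conditionB`) rests on the faithful expectation Φ
obtained by averaging over the gauge action, and on the estimate ‖Φ(x)‖ ≤ ‖π(x)‖. It suffices to
treat finite sums of s_μ s_ν^*. After the paths are lengthened, the part with d(μ) = d(ν) is an
orthogonal sum of matrix blocks indexed by source and degree. For each block, condition (B) yields a
path τ such that compression by the sum Q of the range projections of the t_{μτ} annihilates all
terms outside the block and preserves the norm of the block (`norm_block_le`). If π(x) = 0, the
estimate for x^*x gives Φ(x^*x) = 0, so x = 0. -/

namespace KGraph

section Combinatorics

variable {k : ℕ} (Λ : KGraph.{u} k)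

/-! ### Factorisation of paths -/

/-- Truncating m at d(ρ) makes initial and final segments total functions of m, so segments of
boundary paths of finite degree need no side conditions. -/
theorem factorisation_min (ρ : Λ.Path) (m : Fin k → ℕ) : Λ.d ρ = m ⊓ Λ.d ρ + (Λ.d ρ - m) := by
  funext i
  simp only [Pi.add_apply, Pi.inf_apply, Pi.sub_apply]
  omega

/-- The initial segment of `ρ` of degree `m ⊓ d(ρ)`. -/
noncomputable def head (ρ : Λ.Path) (m : Fin k → ℕ) : Λ.Path :=
  (Λ.factorisation ρ _ _ (Λ.factorisation_min ρ m)).choose.1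

/-- The final segment of `ρ` which remains after `head ρ m`. -/
noncomputable def tail (ρ : Λ.Path) (m : Fin k → ℕ) : Λ.Path :=
  (Λ.factorisation ρ _ _ (Λ.factorisation_min ρ m)).choose.2

variable (ρ : Λ.Path) (m : Fin k → ℕ)

theorem s_head : Λ.s (Λ.head ρ m) = Λ.r (Λ.tail ρ m) :=
  (Λ.factorisation ρ _ _ (Λ.factorisation_min ρ m)).choose_spec.1.1.choose

theorem head_tail : Λ.comp (Λ.head ρ m) (Λ.tail ρ m) (Λ.s_head ρ m) = ρ :=
  (Λ.factorisation ρ _ _ (Λ.factorisation_min ρ m)).choose_spec.1.1.choose_spec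

theorem d_head : Λ.d (Λ.head ρ m) = m ⊓ Λ.d ρ :=
  (Λ.factorisation ρ _ _ (Λ.factorisation_min ρ m)).choose_spec.1.2.1

theorem d_tail : Λ.d (Λ.tail ρ m) = Λ.d ρ - m :=
  (Λ.factorisation ρ _ _ (Λ.factorisation_min ρ m)).choose_spec.1.2.2

theorem r_head : Λ.r (Λ.head ρ m) = Λ.r ρ := by
  conv_rhs => rw [← Λ.head_tail ρ m, Λ.r_comp]

theorem s_tail : Λ.s (Λ.tail ρ m) = Λ.s ρ := by
  conv_rhs => rw [← Λ.head_tail ρ m, Λ.s_comp]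

variable {Λ} {ρ m}

theorem d_head_of_le (h : m ≤ Λ.d ρ) : Λ.d (Λ.head ρ m) = m := by
  rw [d_head, inf_eq_left.mpr h]

theorem comp_congr {μ μ' ν ν' : Λ.Path} {h : Λ.s μ = Λ.r ν} (hμ : μ = μ') (hν : ν = ν') :
    Λ.comp μ ν h = Λ.comp μ' ν' (hμ ▸ hν ▸ h) := by
  subst hμ hν
  rfl

theorem comp_inj {μ μ' ν ν' : Λ.Path} {h : Λ.s μ = Λ.r ν} {h' : Λ.s μ' = Λ.r ν'}
    (hc : Λ.comp μ ν h = Λ.comp μ' ν' h') (hd : Λ.d μ = Λ.d μ') : μ = μ' ∧ ν = ν' := by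
  have hd' : Λ.d ν = Λ.d ν' := by
    have := congrArg Λ.d hc
    rw [Λ.d_comp, Λ.d_comp, hd] at this
    exact add_left_cancel this
  have := (Λ.factorisation (Λ.comp μ ν h) _ _ (Λ.d_comp μ ν h)).unique
    (y₁ := (μ, ν)) (y₂ := (μ', ν')) ⟨⟨h, rfl⟩, rfl, rfl⟩ ⟨⟨h', hc.symm⟩, hd.symm, hd'.symm⟩
  exact ⟨congrArg Prod.fst this, congrArg Prod.snd this⟩

theorem comp_left_cancel {μ ν ν' : Λ.Path} {h : Λ.s μ = Λ.r ν} {h' : Λ.s μ = Λ.r ν'}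
    (hc : Λ.comp μ ν h = Λ.comp μ ν' h') : ν = ν' :=
  (comp_inj hc rfl).2

theorem head_eq {μ ν : Λ.Path} (h : Λ.s μ = Λ.r ν) (hc : Λ.comp μ ν h = ρ)
    (hm : Λ.d μ = m ⊓ Λ.d ρ) : Λ.head ρ m = μ :=
  (comp_inj ((Λ.head_tail ρ m).trans hc.symm) ((Λ.d_head ρ m).trans hm.symm)).1

theorem tail_eq {μ ν : Λ.Path} (h : Λ.s μ = Λ.r ν) (hc : Λ.comp μ ν h = ρ)
    (hm : Λ.d μ = m ⊓ Λ.d ρ) : Λ.tail ρ m = ν :=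
  (comp_inj ((Λ.head_tail ρ m).trans hc.symm) ((Λ.d_head ρ m).trans hm.symm)).2

theorem head_comp {μ ν : Λ.Path} (h : Λ.s μ = Λ.r ν) : Λ.head (Λ.comp μ ν h) (Λ.d μ) = μ :=
  head_eq h rfl (by rw [Λ.d_comp, inf_eq_left.mpr le_self_add])

theorem tail_comp {μ ν : Λ.Path} (h : Λ.s μ = Λ.r ν) : Λ.tail (Λ.comp μ ν h) (Λ.d μ) = ν :=
  tail_eq h rfl (by rw [Λ.d_comp, inf_eq_left.mpr le_self_add])

theorem head_head (ρ : Λ.Path) {m n : Fin k → ℕ} (h : n ≤ m) :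
    Λ.head (Λ.head ρ m) n = Λ.head ρ n := by
  symm
  refine head_eq (ν := Λ.comp (Λ.tail (Λ.head ρ m) n) (Λ.tail ρ m)
    ((Λ.s_tail _ _).trans (Λ.s_head _ _))) ((Λ.s_head _ _).trans (Λ.r_comp _ _ _).symm) ?_ ?_
  · rw [← Λ.assoc _ _ _ (Λ.s_head _ _)]
    exact (comp_congr (Λ.head_tail _ _) rfl).trans (Λ.head_tail _ _)
  · rw [d_head, d_head, ← inf_assoc, inf_eq_left.mpr h]

theorem eq_id_of_d_eq_zero (h : Λ.d ρ = 0) : ρ = Λ.id (Λ.r ρ) := by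
  have := (Λ.id_comp ρ).trans (Λ.comp_id ρ).symm
  exact ((comp_inj this (by rw [Λ.d_id, h])).1).symm

theorem head_of_le (h : Λ.d ρ ≤ m) : Λ.head ρ m = ρ :=
  head_eq (Λ.r_id _).symm (Λ.comp_id ρ) (inf_eq_right.mpr h).symm

/-- An initial segment of μν of degree at most d(μ) + n does not see ν beyond degree n. This makes
the segments of αx computable from finite segments of x. -/
theorem head_comp_head {μ ν : Λ.Path} (h : Λ.s μ = Λ.r ν) {n : Fin k → ℕ} (hm : m ≤ Λ.d μ + n) :
    Λ.head (Λ.comp μ (Λ.head ν n) (h.trans (Λ.r_head _ _).symm)) m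
      = Λ.head (Λ.comp μ ν h) m := by
  rw [← head_head (Λ.comp μ ν h) hm]
  congr 1
  symm
  refine head_eq (ν := Λ.tail ν n) ((Λ.s_comp _ _ _).trans (Λ.s_head _ _)) ?_ ?_
  · rw [Λ.assoc]
    exact comp_congr rfl (Λ.head_tail _ _)
  · rw [Λ.d_comp, Λ.d_comp, d_head]
    funext i
    simp only [Pi.add_apply, Pi.inf_apply]
    omega

theorem tail_tail (ρ : Λ.Path) (m n : Fin k → ℕ) :
    Λ.tail (Λ.tail ρ m) n = Λ.tail ρ (m + n) := by
  symm
  refine tail_eq (μ := Λ.comp (Λ.head ρ m) (Λ.head (Λ.tail ρ m) n)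
    ((Λ.s_head _ _).trans (Λ.r_head _ _).symm)) ((Λ.s_comp _ _ _).trans (Λ.s_head _ _)) ?_ ?_
  · rw [Λ.assoc _ _ _ _ (Λ.s_head _ _)]
    exact (comp_congr rfl (Λ.head_tail _ _)).trans (Λ.head_tail _ _)
  · rw [Λ.d_comp, d_head, d_head, d_tail]
    funext i
    simp only [Pi.add_apply, Pi.inf_apply, Pi.sub_apply]
    omega

theorem comp_head_tail_head (ρ : Λ.Path) {m n : Fin k → ℕ} (h : m ≤ n) :
    Λ.tail (Λ.head ρ n) m = Λ.head (Λ.tail ρ m) (n - m) := by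
  refine tail_eq (μ := Λ.head ρ m) ((Λ.s_head _ _).trans (Λ.r_head _ _).symm) ?_ ?_
  · symm
    refine head_eq (ν := Λ.tail (Λ.tail ρ m) (n - m))
      ((Λ.s_comp _ _ _).trans (Λ.s_head _ _)) ?_ ?_
    · rw [Λ.assoc _ _ _ _ (Λ.s_head _ _)]
      exact (comp_congr rfl (Λ.head_tail _ _)).trans (Λ.head_tail _ _)
    · rw [Λ.d_comp, d_head, d_head, d_tail]
      funext i
      have : m i ≤ n i := h i
      simp only [Pi.add_apply, Pi.inf_apply, Pi.sub_apply]
      omega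
  · rw [d_head, d_head, ← inf_assoc, inf_eq_left.mpr h]

/-! ### The sets `Λ^{≤m}(v)` -/

theorem e_same (i : Fin k) : e i i = 1 := by simp [e]

theorem e_of_ne {i j : Fin k} (h : j ≠ i) : e i j = 0 := by simp [e, h]

theorem add_e_le_iff {m n : Fin k → ℕ} (h : m ≤ n) (i : Fin k) : m + e i ≤ n ↔ m i < n i := by
  constructor
  · intro h'
    have := h' i
    simp only [Pi.add_apply, e_same] at this
    omega
  · intro h' j
    by_cases hj : j = i
    · subst hj
      simp only [Pi.add_apply, e_same]
      omega
    · simp only [Pi.add_apply, e_of_ne hj]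
      exact h j

theorem e_le_iff {n : Fin k → ℕ} (i : Fin k) : e i ≤ n ↔ 0 < n i := by
  have := add_e_le_iff (m := 0) (n := n) (fun _ => Nat.zero_le _) i
  rwa [zero_add] at this

theorem mem_upTo_iff {q : Fin k → ℕ} {v : Λ.Vertex} {μ : Λ.Path} :
    μ ∈ Λ.upTo q v ↔ Λ.r μ = v ∧ Λ.d μ ≤ q ∧
      ∀ i, Λ.d μ i < q i → Λ.pathsAt (e i) (Λ.s μ) = ∅ := by
  constructor
  · rintro ⟨⟨h1, h2⟩, h3⟩
    exact ⟨h3, h1, fun i hi => h2 i ((add_e_le_iff h1 i).mpr hi)⟩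
  · rintro ⟨h1, h2, h3⟩
    exact ⟨⟨h2, fun i hi => h3 i ((add_e_le_iff h2 i).mp hi)⟩, h1⟩

theorem self_mem_upTo (μ : Λ.Path) : μ ∈ Λ.upTo (Λ.d μ) (Λ.r μ) :=
  mem_upTo_iff.mpr ⟨rfl, le_rfl, fun _ hi => absurd hi (lt_irrefl _)⟩

theorem pathsAt_nonempty_of_pos {μ : Λ.Path} {i : Fin k} (h : 0 < Λ.d μ i) :
    (Λ.pathsAt (e i) (Λ.r μ)).Nonempty :=
  ⟨Λ.head μ (e i), d_head_of_le ((e_le_iff i).mpr h), Λ.r_head _ _⟩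

theorem pathsAt_range_nonempty {μ : Λ.Path} {i : Fin k}
    (h : (Λ.pathsAt (e i) (Λ.s μ)).Nonempty) : (Λ.pathsAt (e i) (Λ.r μ)).Nonempty := by
  obtain ⟨ν, h1, h2⟩ := h
  have := pathsAt_nonempty_of_pos (Λ := Λ) (μ := Λ.comp μ ν h2.symm) (i := i) (by
    rw [Λ.d_comp, h1, Pi.add_apply, e_same]
    omega)
  rwa [Λ.r_comp] at this

/-- In a direction where μν falls short, ν or μ falls short. In the second case s(μ) has no edge in
that direction, and then neither has s(ν), since such an edge could be moved to the front of ν by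
refactoring. -/
theorem comp_mem_upTo {m n : Fin k → ℕ} {v : Λ.Vertex} {μ ν : Λ.Path} (h : Λ.s μ = Λ.r ν)
    (hμ : μ ∈ Λ.upTo m v) (hν : ν ∈ Λ.upTo n (Λ.s μ)) : Λ.comp μ ν h ∈ Λ.upTo (m + n) v := by
  rw [mem_upTo_iff] at hμ hν ⊢
  obtain ⟨h1, h2, h3⟩ := hμ
  obtain ⟨h4, h5, h6⟩ := hν
  rw [Λ.r_comp, Λ.d_comp, Λ.s_comp]
  refine ⟨h1, add_le_add h2 h5, fun i hi => ?_⟩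
  simp only [Pi.add_apply] at hi
  by_cases hn : Λ.d ν i < n i
  · exact h6 i hn
  · have hm : Λ.d μ i < m i := by omega
    by_contra hne
    have := pathsAt_range_nonempty (Set.nonempty_iff_ne_empty.mpr hne)
    rw [← h, h3 i hm] at this
    exact Set.not_nonempty_empty this

/-- Induction on the length of μ: its first edge has a direction j ≠ i, and local convexity carries
the edge of degree e_i across it. -/
theorem LocallyConvex.pathsAt_source_nonempty (hlc : Λ.LocallyConvex) {μ : Λ.Path} {i : Fin k}
    (hi : Λ.d μ i = 0) (h : (Λ.pathsAt (e i) (Λ.r μ)).Nonempty) :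
    (Λ.pathsAt (e i) (Λ.s μ)).Nonempty := by
  induction hn : ∑ j, Λ.d μ j generalizing μ with
  | zero =>
    have h0 : Λ.d μ = 0 := funext fun j => by
      simpa using (Finset.sum_eq_zero_iff.mp hn) j (Finset.mem_univ j)
    rw [eq_id_of_d_eq_zero h0, Λ.s_id]
    exact h
  | succ n ih =>
    obtain ⟨j, hj⟩ : ∃ j, 0 < Λ.d μ j := by
      by_contra! hcon
      have : ∑ j, Λ.d μ j = 0 := Finset.sum_eq_zero fun j _ => Nat.le_zero.mp (hcon j)
      omega
    have hji : i ≠ j := by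
      rintro rfl
      omega
    have hd := d_head_of_le ((e_le_iff j).mpr hj)
    obtain ⟨ν, hν⟩ := h
    have h1 := (hlc (Λ.r μ) i j hji ν hν (Λ.head μ (e j)) ⟨hd, Λ.r_head _ _⟩).2
    rw [Λ.s_head] at h1
    have hsum : ∑ l, Λ.d μ l = ∑ l, Λ.d (Λ.tail μ (e j)) l + 1 := by
      have h2 : ∀ l, Λ.d μ l = Λ.d (Λ.tail μ (e j)) l + e j l := fun l => by
        rw [d_tail]
        exact (Nat.sub_add_cancel ((e_le_iff j).mpr hj l)).symm
      rw [Finset.sum_congr rfl fun l _ => h2 l, Finset.sum_add_distrib]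
      simp [e]
    have := ih (μ := Λ.tail μ (e j)) (by rw [d_tail, Pi.sub_apply, hi, Nat.zero_sub]) h1
      (by omega)
    rwa [Λ.s_tail] at this

/-- If the head is shorter than m in direction i, then μ has no further length in that direction, so
the tail has degree 0 there. An i-edge at the end of the head would therefore be carried along the
tail to s(μ), where none exists. -/
theorem LocallyConvex.head_mem_upTo (hlc : Λ.LocallyConvex) {m n : Fin k → ℕ} (hmn : m ≤ n)
    {v : Λ.Vertex} {μ : Λ.Path} (hμ : μ ∈ Λ.upTo n v) : Λ.head μ m ∈ Λ.upTo m v := by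
  rw [mem_upTo_iff] at hμ ⊢
  obtain ⟨h1, h2, h3⟩ := hμ
  refine ⟨(Λ.r_head _ _).trans h1, ?_, fun i hi => ?_⟩
  · rw [d_head]
    exact inf_le_left
  · rw [d_head] at hi
    have h4 : Λ.d μ i < m i := by
      simp only [Pi.inf_apply] at hi
      omega
    have h5 : m i ≤ n i := hmn i
    by_contra hne
    have h6 := Set.nonempty_iff_ne_empty.mpr hne
    rw [Λ.s_head] at h6
    have := hlc.pathsAt_source_nonempty (by
      rw [d_tail, Pi.sub_apply]
      omega) h6
    rw [Λ.s_tail, h3 i (by omega)] at this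
    exact Set.not_nonempty_empty this

/-- A path in `Λ^{≤m}(v)` is determined by any of its extensions in `Λ^{≤n}(v)` with `m ≤ n`. -/
theorem LocallyConvex.eq_head_of_mem_upTo (hlc : Λ.LocallyConvex) {m n : Fin k → ℕ} (hmn : m ≤ n)
    {v : Λ.Vertex} {μ ν : Λ.Path} (hμ : μ ∈ Λ.upTo m v) (hν : ν ∈ Λ.upTo n v)
    (h : Λ.head ν (Λ.d μ) = μ) : Λ.head ν m = μ := by
  have hm := hlc.head_mem_upTo hmn hν
  rw [mem_upTo_iff] at hμ hm
  have hle : Λ.d μ ≤ Λ.d (Λ.head ν m) := by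
    have := Λ.d_head ν (Λ.d μ)
    rw [h] at this
    rw [d_head]
    exact le_inf hμ.2.1 (inf_eq_left.mp this.symm)
  have h2 : Λ.head (Λ.head ν m) (Λ.d μ) = μ := by
    rw [head_head _ hμ.2.1, h]
  -- If ν went beyond μ in direction i within degree m, its remainder after μ would give an i-edge
  -- at s(μ), contrary to μ ∈ Λ^{≤m}(v).
  suffices Λ.d (Λ.head ν m) ≤ Λ.d μ by rw [head_of_le this] at h2; exact h2
  intro i
  by_contra hlt
  replace hlt : Λ.d μ i < Λ.d (Λ.head ν m) i := not_le.mp hlt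
  have h3 := hμ.2.2 i (lt_of_lt_of_le hlt (hm.2.1 i))
  have h4 : (Λ.pathsAt (e i) (Λ.r (Λ.tail (Λ.head ν m) (Λ.d μ)))).Nonempty :=
    pathsAt_nonempty_of_pos (by
      rw [d_tail, Pi.sub_apply]
      omega)
  rw [← Λ.s_head, h2, h3] at h4
  exact Set.not_nonempty_empty h4

end Combinatorics

end KGraph

/-! ### Algebra of Cuntz–Krieger families and density of the span of s_μ s_ν^* -/

namespace KGraph

section CuntzKrieger

variable {k : ℕ} {Λ : KGraph.{u} k}

open Classical in
/-- The composite `μν`, with a junk value if `μ` and `ν` are not composable. -/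
noncomputable def cat (Λ : KGraph.{u} k) (μ ν : Λ.Path) : Λ.Path :=
  if h : Λ.s μ = Λ.r ν then Λ.comp μ ν h else μ

theorem cat_eq {μ ν : Λ.Path} (h : Λ.s μ = Λ.r ν) : Λ.cat μ ν = Λ.comp μ ν h := dif_pos h

theorem r_cat {μ ν : Λ.Path} (h : Λ.s μ = Λ.r ν) : Λ.r (Λ.cat μ ν) = Λ.r μ := by
  rw [cat_eq h, Λ.r_comp]

theorem s_cat {μ ν : Λ.Path} (h : Λ.s μ = Λ.r ν) : Λ.s (Λ.cat μ ν) = Λ.s ν := by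
  rw [cat_eq h, Λ.s_comp]

theorem d_cat {μ ν : Λ.Path} (h : Λ.s μ = Λ.r ν) : Λ.d (Λ.cat μ ν) = Λ.d μ + Λ.d ν := by
  rw [cat_eq h, Λ.d_comp]

/-- `Λ^{≤m}(v)` as a finite set. -/
noncomputable def RowFinite.upToFinset (hrf : Λ.RowFinite) (m : Fin k → ℕ) (v : Λ.Vertex) :
    Finset Λ.Path :=
  (hrf.finite_upTo m v).toFinset

theorem RowFinite.mem_upToFinset (hrf : Λ.RowFinite) {m : Fin k → ℕ} {v : Λ.Vertex}
    {μ : Λ.Path} : μ ∈ hrf.upToFinset m v ↔ μ ∈ Λ.upTo m v :=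
  Set.Finite.mem_toFinset _

theorem cat_mem_upTo {m : Fin k → ℕ} {μ ν : Λ.Path} (hm : Λ.d μ ≤ m)
    (hν : ν ∈ Λ.upTo (m - Λ.d μ) (Λ.s μ)) : Λ.cat μ ν ∈ Λ.upTo m (Λ.r μ) := by
  rw [cat_eq (mem_upTo_iff.mp hν).1.symm]
  have := comp_mem_upTo (mem_upTo_iff.mp hν).1.symm (self_mem_upTo μ) hν
  rwa [add_tsub_cancel_of_le hm] at this

namespace IsCuntzKrieger

variable {B : Type v} [NonUnitalCStarAlgebra B] {t : Λ.Path → B}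

theorem mul_source (ht : Λ.IsCuntzKrieger t) (μ : Λ.Path) : t μ * t (Λ.id (Λ.s μ)) = t μ := by
  rw [← ht.map_comp _ _ (Λ.r_id _).symm, Λ.comp_id]

theorem range_mul (ht : Λ.IsCuntzKrieger t) (μ : Λ.Path) : t (Λ.id (Λ.r μ)) * t μ = t μ := by
  rw [← ht.map_comp _ _ (Λ.s_id _), Λ.id_comp]

theorem star_id (ht : Λ.IsCuntzKrieger t) (v : Λ.Vertex) : star (t (Λ.id v)) = t (Λ.id v) :=
  (ht.projection v).isSelfAdjoint

theorem source_mul_star (ht : Λ.IsCuntzKrieger t) (μ : Λ.Path) : t (Λ.id (Λ.s μ)) * star (t μ) = star (t μ) := by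
  conv_rhs => rw [← ht.mul_source μ, star_mul, ht.star_id]

theorem map_cat (ht : Λ.IsCuntzKrieger t) {μ ν : Λ.Path} (h : Λ.s μ = Λ.r ν) : t (Λ.cat μ ν) = t μ * t ν := by
  rw [cat_eq h, ht.map_comp]

theorem mul_eq_zero (ht : Λ.IsCuntzKrieger t) {μ ν : Λ.Path} (h : Λ.s μ ≠ Λ.r ν) : t μ * t ν = 0 := by
  rw [← ht.mul_source μ, ← ht.range_mul ν, mul_assoc, ← mul_assoc (t (Λ.id _)),
    ht.orthogonal _ _ h, zero_mul, mul_zero]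

theorem mul_star_eq_zero (ht : Λ.IsCuntzKrieger t) {μ ν : Λ.Path} (h : Λ.s μ ≠ Λ.s ν) : t μ * star (t ν) = 0 := by
  rw [← ht.mul_source μ, ← ht.source_mul_star ν, mul_assoc, ← mul_assoc (t (Λ.id _)),
    ht.orthogonal _ _ h, zero_mul, mul_zero]

theorem star_mul_eq_zero_of_range_ne (ht : Λ.IsCuntzKrieger t) {μ ν : Λ.Path} (h : Λ.r μ ≠ Λ.r ν) :
    star (t μ) * t ν = 0 := by
  rw [← ht.range_mul μ, ← ht.range_mul ν, star_mul, ht.star_id, mul_assoc,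
    ← mul_assoc (t (Λ.id _)), ht.orthogonal _ _ h, zero_mul, mul_zero]

theorem sum_upToFinset (ht : Λ.IsCuntzKrieger t) (hrf : Λ.RowFinite) (v : Λ.Vertex) (m : Fin k → ℕ) :
    ∑ μ ∈ hrf.upToFinset m v, t μ * star (t μ) = t (Λ.id v) := by
  rw [ht.sum_upTo v m, finsum_mem_eq_finite_toFinset_sum _ (hrf.finite_upTo m v)]
  rfl

/-- Compress s_{r(ν)} = Σ s_ρ s_ρ^* by s_ν. The term ρ = ν already equals s_ν^* s_ν, so the other
terms, which are positive, sum to zero and each of them vanishes. -/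
theorem star_mul_eq_zero (ht : Λ.IsCuntzKrieger t) (hrf : Λ.RowFinite) {m : Fin k → ℕ} {μ ν : Λ.Path}
    (hμ : μ ∈ Λ.upTo m (Λ.r μ)) (hν : ν ∈ Λ.upTo m (Λ.r ν)) (hne : μ ≠ ν) :
    star (t μ) * t ν = 0 := by
  classical
  by_cases hr : Λ.r μ = Λ.r ν
  swap
  · exact ht.star_mul_eq_zero_of_range_ne hr
  let : PartialOrder B := CStarAlgebra.spectralOrder B
  have : StarOrderedRing B := CStarAlgebra.spectralOrderedRing B
  have h1 : ∑ ρ ∈ hrf.upToFinset m (Λ.r ν), star (star (t ρ) * t ν) * (star (t ρ) * t ν)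
      = star (t ν) * t ν := by
    have h : star (t ν) * t ν = star (t ν) * (t (Λ.id (Λ.r ν)) * t ν) := by rw [ht.range_mul]
    rw [h, ← ht.sum_upToFinset hrf (Λ.r ν) m, Finset.sum_mul, Finset.mul_sum]
    refine Finset.sum_congr rfl fun ρ _ => ?_
    rw [star_mul, star_star]
    simp only [mul_assoc]
  have hν' := hrf.mem_upToFinset.mpr hν
  rw [← Finset.add_sum_erase _ _ hν'] at h1
  have h2 : star (star (t ν) * t ν) * (star (t ν) * t ν) = star (t ν) * t ν := by
    rw [ht.star_mul_self, ht.star_id]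
    exact (ht.projection _).isIdempotentElem
  rw [h2, add_eq_left, Finset.sum_eq_zero_iff_of_nonneg
    (fun ρ _ => star_mul_self_nonneg _)] at h1
  have h3 := h1 μ (Finset.mem_erase.mpr ⟨hne, hrf.mem_upToFinset.mpr (hr ▸ hμ)⟩)
  exact (CStarRing.star_mul_self_eq_zero_iff _).mp h3

theorem eq_sum (ht : Λ.IsCuntzKrieger t) (hrf : Λ.RowFinite) (μ : Λ.Path) (n : Fin k → ℕ) :
    t μ = ∑ α ∈ hrf.upToFinset n (Λ.s μ), t (Λ.cat μ α) * star (t α) := by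
  conv_lhs => rw [← ht.mul_source μ, ← ht.sum_upToFinset hrf _ n, Finset.mul_sum]
  refine Finset.sum_congr rfl fun α hα => ?_
  rw [ht.map_cat (mem_upTo_iff.mp (hrf.mem_upToFinset.mp hα)).1.symm, mul_assoc]

/-- Both paths are lengthened by the same α, so d(μ) − d(ν) is unchanged; terms can be brought to a
common level without mixing gauge degrees. -/
theorem mul_star_eq_sum (ht : Λ.IsCuntzKrieger t) (hrf : Λ.RowFinite) {μ ν : Λ.Path} (h : Λ.s μ = Λ.s ν)
    (n : Fin k → ℕ) : t μ * star (t ν) =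
      ∑ α ∈ hrf.upToFinset n (Λ.s μ), t (Λ.cat μ α) * star (t (Λ.cat ν α)) := by
  conv_lhs => rw [ht.eq_sum hrf μ n, Finset.sum_mul]
  refine Finset.sum_congr rfl fun α hα => ?_
  have hα' := (mem_upTo_iff.mp (hrf.mem_upToFinset.mp hα)).1.symm
  rw [ht.map_cat (μ := ν) (h ▸ hα'), star_mul, mul_assoc]

variable (t) in
/-- The linear span of the elements `t_μ t_ν^*`. -/
def pairSpan : Submodule ℂ B :=
  Submodule.span ℂ (Set.range fun p : Λ.Path × Λ.Path => t p.1 * star (t p.2))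

theorem mul_star_mem (μ ν : Λ.Path) : t μ * star (t ν) ∈ pairSpan t :=
  Submodule.subset_span ⟨(μ, ν), rfl⟩

theorem mul_mul_star_mem (ht : Λ.IsCuntzKrieger t) (α μ : Λ.Path) (β ν : Λ.Path) :
    t α * (t μ * star (t ν)) * star (t β) ∈ pairSpan t := by
  have h : t α * (t μ * star (t ν)) * star (t β) = (t α * t μ) * star (t β * t ν) := by
    rw [star_mul]
    simp only [mul_assoc]
  rw [h]
  by_cases h1 : Λ.s α = Λ.r μ
  · by_cases h2 : Λ.s β = Λ.r ν
    · rw [← ht.map_cat h1, ← ht.map_cat h2]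
      exact mul_star_mem _ _
    · rw [ht.mul_eq_zero h2, star_zero, mul_zero]
      exact zero_mem _
  · rw [ht.mul_eq_zero h1, zero_mul]
    exact zero_mem _

/-- Lengthen μ and ν to paths μα and νβ in Λ^{≤N} with N = d(μ) ∨ d(ν). Distinct ones have
orthogonal ranges, and each coincidence μα = νβ contributes t_α t_β^*. -/
theorem star_mul_mem (ht : Λ.IsCuntzKrieger t) (hrf : Λ.RowFinite) (μ ν : Λ.Path) : star (t μ) * t ν ∈ pairSpan t := by
  have hN1 : Λ.d μ ≤ Λ.d μ ⊔ Λ.d ν := le_sup_left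
  have hN2 : Λ.d ν ≤ Λ.d μ ⊔ Λ.d ν := le_sup_right
  generalize Λ.d μ ⊔ Λ.d ν = N at hN1 hN2
  rw [ht.eq_sum hrf μ (N - Λ.d μ), ht.eq_sum hrf ν (N - Λ.d ν), star_sum, Finset.sum_mul]
  refine Submodule.sum_mem _ fun α hα => ?_
  rw [Finset.mul_sum]
  refine Submodule.sum_mem _ fun β hβ => ?_
  have hα' := hrf.mem_upToFinset.mp hα
  have hβ' := hrf.mem_upToFinset.mp hβ
  have h1 := cat_mem_upTo hN1 hα'
  have h2 := cat_mem_upTo hN2 hβ'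
  have hsα := s_cat (mem_upTo_iff.mp hα').1.symm
  have h : star (t (Λ.cat μ α) * star (t α)) * (t (Λ.cat ν β) * star (t β)) =
      t α * (star (t (Λ.cat μ α)) * t (Λ.cat ν β)) * star (t β) := by
    rw [star_mul, star_star]
    simp only [mul_assoc]
  rw [h]
  by_cases heq : Λ.cat μ α = Λ.cat ν β
  · rw [← heq, ht.star_mul_self, hsα, ht.mul_source]
    exact mul_star_mem _ _
  · rw [ht.star_mul_eq_zero hrf (by rwa [(mem_upTo_iff.mp h1).1])
      (by rwa [(mem_upTo_iff.mp h2).1]) heq, mul_zero, zero_mul]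
    exact zero_mem _

theorem star_mem_pairSpan {a : B} (h : a ∈ pairSpan t) : star a ∈ pairSpan t := by
  induction h using Submodule.span_induction with
  | mem x hx =>
    obtain ⟨p, rfl⟩ := hx
    change star (t p.1 * star (t p.2)) ∈ _
    rw [star_mul, star_star]
    exact mul_star_mem _ _
  | zero => rw [star_zero]; exact zero_mem _
  | add x y _ _ hx hy => rw [star_add]; exact add_mem hx hy
  | smul c x _ hx => rw [star_smul]; exact Submodule.smul_mem _ _ hx

theorem mul_mem_pairSpan (ht : Λ.IsCuntzKrieger t) (hrf : Λ.RowFinite) {a b : B} (ha : a ∈ pairSpan t)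
    (hb : b ∈ pairSpan t) : a * b ∈ pairSpan t := by
  have key : ∀ (α β : Λ.Path) {x : B}, x ∈ pairSpan t → t α * x * star (t β) ∈ pairSpan t := by
    intro α β x hx
    induction hx using Submodule.span_induction with
    | mem x hx =>
      obtain ⟨p, rfl⟩ := hx
      exact ht.mul_mul_star_mem _ _ _ _
    | zero => rw [mul_zero, zero_mul]; exact zero_mem _
    | add x y _ _ hx hy => rw [mul_add, add_mul]; exact add_mem hx hy
    | smul c x _ hx =>
      rw [mul_smul_comm, smul_mul_assoc]
      exact Submodule.smul_mem _ _ hx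
  induction ha using Submodule.span_induction with
  | mem x hx =>
    obtain ⟨p, rfl⟩ := hx
    induction hb using Submodule.span_induction with
    | mem y hy =>
      obtain ⟨q, rfl⟩ := hy
      have := key p.1 q.2 (ht.star_mul_mem hrf p.2 q.1)
      simpa only [mul_assoc] using this
    | zero => rw [mul_zero]; exact zero_mem _
    | add x y _ _ hx hy => rw [mul_add]; exact add_mem hx hy
    | smul c x _ hx => rw [mul_smul_comm]; exact Submodule.smul_mem _ _ hx
  | zero => rw [zero_mul]; exact zero_mem _
  | add x y _ _ hx hy => rw [add_mul]; exact add_mem hx hy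
  | smul c x _ hx => rw [smul_mul_assoc]; exact Submodule.smul_mem _ _ hx

theorem mem_pairSpan (ht : Λ.IsCuntzKrieger t) (μ : Λ.Path) : t μ ∈ pairSpan t := by
  rw [← ht.mul_source μ, ← ht.star_id]
  exact mul_star_mem _ _

end IsCuntzKrieger

open IsCuntzKrieger in
/-- The elements `s_μ s_ν^*` span a dense subspace of `C*(Λ)`. -/
theorem CStar.dense_pairSpan (hrf : Λ.RowFinite) :
    Dense (pairSpan (CStar.gen Λ) : Set Λ.CStar) := by
  have hg := CStar.isCuntzKrieger_gen hrf
  let incl : Λ.CStar →⋆ₙₐ[ℂ] lp (fun ρ : Λ.CKRep => ρ.Alg) ∞ :=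
    NonUnitalStarSubalgebraClass.subtype Λ.cstarSubalgebra
  -- The span is closed under products and adjoints and contains the generators, so it contains the
  -- star-algebra they generate, which is dense by construction.
  have hsub : ∀ y ∈ NonUnitalStarAlgebra.adjoin ℂ (Set.range Λ.bigFam),
      ∃ x ∈ pairSpan (CStar.gen Λ), incl x = y := by
    intro y hy
    induction hy using NonUnitalStarAlgebra.adjoin_induction with
    | mem y hy =>
      obtain ⟨μ, rfl⟩ := hy
      exact ⟨CStar.gen Λ μ, hg.mem_pairSpan μ, rfl⟩
    | add y z _ _ h1 h2 =>
      obtain ⟨a, ha, rfl⟩ := h1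
      obtain ⟨b, hb, rfl⟩ := h2
      exact ⟨a + b, add_mem ha hb, map_add _ _ _⟩
    | zero => exact ⟨0, zero_mem _, map_zero _⟩
    | mul y z _ _ h1 h2 =>
      obtain ⟨a, ha, rfl⟩ := h1
      obtain ⟨b, hb, rfl⟩ := h2
      exact ⟨a * b, hg.mul_mem_pairSpan hrf ha hb, map_mul _ _ _⟩
    | smul c y _ h1 =>
      obtain ⟨a, ha, rfl⟩ := h1
      exact ⟨c • a, Submodule.smul_mem _ _ ha, map_smul _ _ _⟩
    | star y _ h1 =>
      obtain ⟨a, ha, rfl⟩ := h1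
      exact ⟨star a, star_mem_pairSpan ha, map_star _ _⟩
  intro x
  have hind : Topology.IsInducing (fun x : Λ.CStar => incl x) :=
    Topology.IsInducing.subtypeVal (t := {y | y ∈ Λ.cstarSubalgebra})
  rw [hind.closure_eq_preimage_closure_image]
  exact closure_mono (fun y hy => hsub y hy) x.2

end CuntzKrieger

end KGraph

/-! ### Quotients of C⋆-algebras by closed ideals -/

section CStarQuotient

variable {A : Type u} [NonUnitalCStarAlgebra A]

open Filter Topology Unitization in
-- In the unitization 0 ≤ c^*c ≤ 1, so 1 − c^*c is a contraction.
theorem norm_sub_mul_star_mul_self_le {c : A} (hc : ‖star c * c‖ ≤ 1) (b : A) :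
    ‖b - b * (star c * c)‖ ≤ ‖b‖ := by
  let : PartialOrder (Unitization ℂ A) := CStarAlgebra.spectralOrder _
  have : StarOrderedRing (Unitization ℂ A) := CStarAlgebra.spectralOrderedRing _
  have h0 : (0 : Unitization ℂ A) ≤ ((star c * c : A) : Unitization ℂ A) := by
    rw [inr_mul, inr_star]
    exact star_mul_self_nonneg _
  have h1 : ((star c * c : A) : Unitization ℂ A) ∈ Set.Icc 0 1 :=
    CStarAlgebra.mem_Icc_iff_norm_le_one.mpr ⟨h0, by rwa [norm_inr (𝕜 := ℂ)]⟩
  have h2 := (CStarAlgebra.mem_Icc_iff_norm_le_one.mp (Set.sub_mem_Icc_zero_iff_right.mpr h1)).2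
  calc ‖b - b * (star c * c)‖
      = ‖(b : Unitization ℂ A) * (1 - ((star c * c : A) : Unitization ℂ A))‖ := by
        rw [mul_sub, mul_one, ← inr_mul, ← inr_sub, norm_inr (𝕜 := ℂ)]
    _ ≤ ‖(b : Unitization ℂ A)‖ * 1 := (norm_mul_le _ _).trans
        (mul_le_mul_of_nonneg_left h2 (norm_nonneg _))
    _ = ‖b‖ := by rw [mul_one, norm_inr (𝕜 := ℂ)]

/-- The elements of a closed ideal whose adjoint is also in the ideal. -/
def ClosedIdeal.selfAdjointPart (I : ClosedIdeal A) : NonUnitalStarSubalgebra ℂ A where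
  carrier := {x | x ∈ I.1 ∧ star x ∈ I.1}
  mul_mem' {x y} hx hy := ⟨(I.2.2 x y hy.1).1, by rw [star_mul]; exact (I.2.2 _ _ hx.2).1⟩
  add_mem' {x y} hx hy := ⟨add_mem hx.1 hy.1, by rw [star_add]; exact add_mem hx.2 hy.2⟩
  zero_mem' := ⟨zero_mem _, by rw [star_zero]; exact zero_mem _⟩
  smul_mem' c x hx := ⟨I.1.smul_mem c hx.1, by rw [star_smul]; exact I.1.smul_mem _ hx.2⟩
  star_mem' {x} hx := ⟨hx.2, by rw [star_star]; exact hx.1⟩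

theorem ClosedIdeal.isClosed_selfAdjointPart (I : ClosedIdeal A) :
    IsClosed (I.selfAdjointPart : Set A) :=
  I.2.1.inter (I.2.1.preimage continuous_star)

open Filter Topology in
-- I ∩ I^* is a C⋆-algebra even before I is known to be self-adjoint, so it has a contractive
-- positive approximate unit. Writing e = c^*c carries positivity from this subalgebra to A.
theorem ClosedIdeal.exists_approximateUnit (I : ClosedIdeal A) {h : A}
    (hh : h ∈ I.selfAdjointPart) {ε : ℝ} (hε : 0 < ε) :
    ∃ e ∈ I.1, star e = e ∧ (∀ b : A, ‖b - b * e‖ ≤ ‖b‖) ∧ ‖h - h * e‖ < ε := by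
  have : IsClosed (I.selfAdjointPart : Set A) := I.isClosed_selfAdjointPart
  let : NonUnitalCStarAlgebra I.selfAdjointPart :=
    NonUnitalStarSubalgebra.nonUnitalCStarAlgebra _
  let : PartialOrder I.selfAdjointPart := CStarAlgebra.spectralOrder _
  have : StarOrderedRing I.selfAdjointPart := CStarAlgebra.spectralOrderedRing _
  have hl := CStarAlgebra.increasingApproximateUnit I.selfAdjointPart
  have h1 := (hl.tendsto_mul_left ⟨h, hh⟩).eventually (Metric.ball_mem_nhds _ hε)
  obtain ⟨e, he, hn, hp⟩ := (h1.and (hl.eventually_norm.and hl.eventually_nonneg)).exists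
  obtain ⟨c, rfl⟩ := CStarAlgebra.nonneg_iff_eq_star_mul_self.mp hp
  refine ⟨star (c : A) * c, (star c * c).2.1, by rw [star_mul, star_star],
    norm_sub_mul_star_mul_self_le hn, ?_⟩
  rw [dist_comm, dist_eq_norm] at he
  exact he

/-- The element x^*e lies in I because e does, and it is close to x^*: the square of ‖x^* − x^*e‖ is
the norm of (1 − e)xx^*(1 − e), where xx^* ∈ I ∩ I^* and e is an approximate unit for it. -/
theorem ClosedIdeal.star_mem (I : ClosedIdeal A) {x : A} (hx : x ∈ I.1) : star x ∈ I.1 := by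
  have hcl : star x ∈ closure (I.1 : Set A) := by
    rw [Metric.mem_closure_iff]
    intro ε hε
    have hh : x * star x ∈ I.selfAdjointPart :=
      ⟨(I.2.2 _ _ hx).2, by rw [star_mul, star_star]; exact (I.2.2 _ _ hx).2⟩
    obtain ⟨e, heI, hes, hb, hn⟩ := I.exists_approximateUnit hh (ε := ε ^ 2) (by positivity)
    refine ⟨star x * e, (I.2.2 _ _ heI).1, ?_⟩
    rw [dist_eq_norm]
    have h1 : ‖star x - star x * e‖ * ‖star x - star x * e‖ < ε ^ 2 := by
      rw [← CStarRing.norm_star_mul_self]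
      have h2 : star (star x - star x * e) * (star x - star x * e) =
          star ((star (x * star x - x * star x * e)) - star (x * star x - x * star x * e) * e) := by
        simp only [star_sub, star_mul, star_star, hes, sub_mul, mul_sub, mul_assoc]
        abel
      rw [h2, norm_star]
      exact (hb _).trans_lt (by rwa [norm_star])
    nlinarith [norm_nonneg (star x - star x * e)]
  exact I.2.1.closure_subset hcl

/-- The quotient of a C⋆-algebra by a closed ideal. -/
def ClosedIdeal.Quot (I : ClosedIdeal A) : Type u := A ⧸ I.1

namespace ClosedIdeal

variable (I : ClosedIdeal A)

noncomputable instance : NormedAddCommGroup I.Quot :=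
  have : IsClosed (I.1 : Set A) := I.2.1
  inferInstanceAs (NormedAddCommGroup (A ⧸ I.1))

noncomputable instance : NormedSpace ℂ I.Quot :=
  have : IsClosed (I.1 : Set A) := I.2.1
  inferInstanceAs (NormedSpace ℂ (A ⧸ I.1))

instance : CompleteSpace I.Quot :=
  have : IsClosed (I.1 : Set A) := I.2.1
  inferInstanceAs (CompleteSpace (A ⧸ I.1))

/-- The quotient map. -/
def mk : A → I.Quot := Submodule.Quotient.mk

theorem mk_surjective : Function.Surjective I.mk := Submodule.Quotient.mk_surjective _

theorem mk_eq {x y : A} : I.mk x = I.mk y ↔ x - y ∈ I.1 := Submodule.Quotient.eq _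

theorem norm_mk_le (x : A) : ‖I.mk x‖ ≤ ‖x‖ := Submodule.Quotient.norm_mk_le _ _

theorem exists_norm_lt (x : A) {ε : ℝ} (hε : 0 < ε) : ∃ y ∈ I.1, ‖x + y‖ < ‖I.mk x‖ + ε := by
  obtain ⟨m, hm, hlt⟩ := Submodule.Quotient.norm_mk_lt (S := I.1) (I.mk x) hε
  refine ⟨m - x, (I.mk_eq).mp hm, ?_⟩
  rwa [add_sub_cancel]

instance : Mul I.Quot :=
  ⟨Quotient.map₂ (· * ·) fun a b hab c d hcd => by
    have hab' := (Submodule.quotientRel_def I.1).mp hab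
    have hcd' := (Submodule.quotientRel_def I.1).mp hcd
    refine (Submodule.quotientRel_def I.1).mpr ?_
    have : a * c - b * d = (a - b) * c + b * (c - d) := by
      rw [sub_mul, mul_sub]
      abel
    rw [this]
    exact add_mem (I.2.2 _ _ hab').2 (I.2.2 _ _ hcd').1⟩

instance : Star I.Quot :=
  ⟨Quotient.map star fun a b hab => by
    have hab' := (Submodule.quotientRel_def I.1).mp hab
    refine (Submodule.quotientRel_def I.1).mpr ?_
    rw [← star_sub]
    exact I.star_mem hab'⟩

theorem mk_mul (x y : A) : I.mk (x * y) = I.mk x * I.mk y := rfl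

theorem mk_star (x : A) : I.mk (star x) = star (I.mk x) := rfl

theorem mk_add (x y : A) : I.mk (x + y) = I.mk x + I.mk y := rfl

theorem mk_smul (c : ℂ) (x : A) : I.mk (c • x) = c • I.mk x := rfl

/-- Choose y ∈ I with ‖x^*x + y‖ nearly the quotient norm of x^*x, and e ∈ I nearly a unit for y.
Then x − xe represents the class of x, and (1 − e)x^*x(1 − e) differs from (1 − e)(x^*x + y)(1 − e)
only by the small term (1 − e)y(1 − e). -/
theorem norm_mul_self_le_norm_star_mul (x : A) :
    ‖I.mk x‖ * ‖I.mk x‖ ≤ ‖I.mk (star x * x)‖ := by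
  refine le_of_forall_pos_le_add fun ε hε => ?_
  obtain ⟨y, hy, hlt⟩ := I.exists_norm_lt (star x * x) (half_pos hε)
  obtain ⟨e, heI, hes, hb, hn⟩ := I.exists_approximateUnit
    (h := y) ⟨hy, I.star_mem hy⟩ (half_pos hε)
  have hb' : ∀ b : A, ‖b - e * b‖ ≤ ‖b‖ := fun b => by
    have := hb (star b)
    rwa [← norm_star, star_sub, star_mul, star_star, hes, norm_star] at this
  have h1 : ‖I.mk x‖ ≤ ‖x - x * e‖ := by
    have : I.mk x = I.mk (x - x * e) := I.mk_eq.mpr (by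
      rw [sub_sub_cancel]
      exact (I.2.2 _ _ heI).1)
    rw [this]
    exact I.norm_mk_le _
  have h2 : ‖x - x * e‖ * ‖x - x * e‖ < ‖I.mk (star x * x)‖ + ε := by
    rw [← CStarRing.norm_star_mul_self]
    have h3 : star (x - x * e) * (x - x * e) =
        ((star x * x + y - (star x * x + y) * e) - e * (star x * x + y - (star x * x + y) * e))
          - ((y - y * e) - e * (y - y * e)) := by
      simp only [star_sub, star_mul, hes, sub_mul, mul_sub, mul_add, add_mul, mul_assoc]
      abel
    rw [h3]
    calc _ ≤ ‖star x * x + y‖ + ‖y - y * e‖ := (norm_sub_le _ _).trans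
          (add_le_add ((hb' _).trans (hb _)) (hb' _))
      _ < _ := by linarith
  have := norm_nonneg (I.mk x)
  nlinarith

noncomputable instance : NonUnitalRing I.Quot :=
  Function.Surjective.nonUnitalRing I.mk I.mk_surjective rfl (fun _ _ => rfl) (fun _ _ => rfl)
    (fun _ => rfl) (fun _ _ => rfl) (fun _ _ => rfl) (fun _ _ => rfl)

noncomputable instance : NonUnitalNormedRing I.Quot where
  dist_eq := NormedAddCommGroup.dist_eq
  norm_mul_le := by
    intro a b
    obtain ⟨x, rfl⟩ := I.mk_surjective a
    obtain ⟨y, rfl⟩ := I.mk_surjective b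
    rw [← I.mk_mul]
    refine le_of_forall_pos_le_add fun ε hε => ?_
    obtain ⟨δ, hδ, hlt⟩ : ∃ δ > 0, (‖I.mk x‖ + δ) * (‖I.mk y‖ + δ) < ‖I.mk x‖ * ‖I.mk y‖ + ε := by
      have hc : Continuous fun δ : ℝ => (‖I.mk x‖ + δ) * (‖I.mk y‖ + δ) := by fun_prop
      have := (hc.tendsto 0).eventually_lt_const (u := ‖I.mk x‖ * ‖I.mk y‖ + ε)
        (by simpa using hε)
      obtain ⟨δ, hδ1, hδ2⟩ := ((this.filter_mono nhdsWithin_le_nhds).and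
        (self_mem_nhdsWithin (s := Set.Ioi (0 : ℝ)))).exists
      exact ⟨δ, hδ2, hδ1⟩
    obtain ⟨x', hx', hx⟩ := I.exists_norm_lt x hδ
    obtain ⟨y', hy', hy⟩ := I.exists_norm_lt y hδ
    have h1 : I.mk (x * y) = I.mk ((x + x') * (y + y')) := by
      rw [I.mk_mul, I.mk_mul]
      congr 1 <;> exact I.mk_eq.mpr (by simpa)
    rw [h1]
    refine (I.norm_mk_le _).trans ((norm_mul_le _ _).trans ((mul_le_mul hx.le hy.le
      (norm_nonneg _) (by positivity)).trans hlt.le))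

noncomputable instance : StarRing I.Quot where
  star_involutive a := by
    obtain ⟨x, rfl⟩ := I.mk_surjective a
    rw [← I.mk_star, ← I.mk_star, star_star]
  star_mul a b := by
    obtain ⟨x, rfl⟩ := I.mk_surjective a
    obtain ⟨y, rfl⟩ := I.mk_surjective b
    rw [← I.mk_mul, ← I.mk_star, star_mul]
    rfl
  star_add a b := by
    obtain ⟨x, rfl⟩ := I.mk_surjective a
    obtain ⟨y, rfl⟩ := I.mk_surjective b
    rw [← I.mk_add, ← I.mk_star, star_add]
    rfl

noncomputable instance : NonUnitalCStarAlgebra I.Quot where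
  __ := (inferInstance : NormedSpace ℂ I.Quot)
  __ := (inferInstance : CompleteSpace I.Quot)
  __ := (inferInstance : StarRing I.Quot)
  norm_mul_self_le a := by
    obtain ⟨x, rfl⟩ := I.mk_surjective a
    exact I.norm_mul_self_le_norm_star_mul x
  smul_assoc c a b := by
    obtain ⟨x, rfl⟩ := I.mk_surjective a
    obtain ⟨y, rfl⟩ := I.mk_surjective b
    simp only [smul_eq_mul, ← I.mk_mul, ← I.mk_smul, smul_mul_assoc]
  smul_comm c a b := by
    obtain ⟨x, rfl⟩ := I.mk_surjective a
    obtain ⟨y, rfl⟩ := I.mk_surjective b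
    simp only [smul_eq_mul, ← I.mk_mul, ← I.mk_smul, mul_smul_comm]
  star_smul c a := by
    obtain ⟨x, rfl⟩ := I.mk_surjective a
    simp only [← I.mk_star, ← I.mk_smul, star_smul]

/-- The quotient map, as a star homomorphism. -/
noncomputable def quotHom : A →⋆ₙₐ[ℂ] I.Quot where
  toFun := I.mk
  map_smul' _ _ := rfl
  map_zero' := rfl
  map_add' _ _ := rfl
  map_mul' _ _ := rfl
  map_star' _ := rfl

theorem quotHom_eq_zero {x : A} : I.quotHom x = 0 ↔ x ∈ I.1 :=
  (I.mk_eq (x := x) (y := 0)).trans (by rw [sub_zero])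

end ClosedIdeal

/-- The kernel of a star homomorphism. -/
def NonUnitalStarAlgHom.kerClosedIdeal {B : Type v} [NonUnitalCStarAlgebra B]
    (φ : A →⋆ₙₐ[ℂ] B) : ClosedIdeal A :=
  ⟨LinearMap.ker (φ : A →ₗ[ℂ] B), by
    have hφ : Continuous φ := AddMonoidHomClass.continuous_of_bound φ 1 fun x => by
      rw [one_mul]; exact NonUnitalStarAlgHom.norm_apply_le φ x
    exact isClosed_eq hφ continuous_const, fun a x hx => by
      have hx' : φ x = 0 := hx
      constructor
      · change φ (a * x) = 0
        rw [map_mul, hx', mul_zero]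
      · change φ (x * a) = 0
        rw [map_mul, hx', zero_mul]⟩

theorem NonUnitalStarAlgHom.mem_kerClosedIdeal {B : Type v} [NonUnitalCStarAlgebra B]
    (φ : A →⋆ₙₐ[ℂ] B) {x : A} : x ∈ φ.kerClosedIdeal.1 ↔ φ x = 0 := Iff.rfl

end CStarQuotient

/-! ### Characters of the torus -/

namespace UnitAddTorus

open MeasureTheory

variable {ι : Type*} [Fintype ι]

theorem star_mFourier_mul_self (n : ι → ℤ) (z : UnitAddTorus ι) :
    star (mFourier n z) * mFourier n z = 1 := by
  change (starRingEnd ℂ) (mFourier n z) * mFourier n z = 1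
  rw [← mFourier_neg, ← mFourier_add, neg_add_cancel, mFourier_zero]
  rfl

theorem mFourier_eval_zero (n : ι → ℤ) : mFourier n (0 : UnitAddTorus ι) = 1 := by
  simp [mFourier]

/-- Translation by half a period in a coordinate i with n_i ≠ 0 changes the sign of the character,
while the measure is translation invariant. -/
theorem integral_mFourier_eq_zero {n : ι → ℤ} (hn : n ≠ 0) :
    ∫ z : UnitAddTorus ι, mFourier n z = 0 := by
  classical
  obtain ⟨i, hi⟩ := Function.ne_iff.mp hn
  let g : UnitAddTorus ι := Pi.single i (((1 : ℝ) / 2 / n i : ℝ) : UnitAddCircle)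
  have hg : ∀ z : UnitAddTorus ι, mFourier n (z + g) = - mFourier n z := fun z => by
    simp only [mFourier, ContinuousMap.coe_mk]
    rw [← Finset.mul_prod_erase _ _ (Finset.mem_univ i),
      ← Finset.mul_prod_erase _ (fun j => fourier (n j) (z j)) (Finset.mem_univ i), ← neg_mul]
    congr 1
    · have : (z + g) i = z i + (((1 : ℝ) / 2 / n i : ℝ) : UnitAddCircle) := by simp [g]
      rw [this]
      exact fourier_add_half_inv_index hi one_pos (z i)
    · refine Finset.prod_congr rfl fun j hj => ?_
      have : (z + g) j = z j := by simp [g, Pi.single_eq_of_ne (Finset.ne_of_mem_erase hj)]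
      rw [this]
  have h1 := integral_add_right_eq_self (μ := (volume : Measure (UnitAddTorus ι)))
    (fun z => mFourier n z) g
  simp only [hg, integral_neg] at h1
  exact self_eq_neg.mp h1.symm

instance : IsProbabilityMeasure (volume : Measure UnitAddCircle) :=
  ⟨UnitAddCircle.measure_univ⟩

end UnitAddTorus

/-! ### Integrals of positive functions with values in a C⋆-algebra -/

section Positive

open MeasureTheory

/-- A continuous function with positive values in a C⋆-algebra vanishes if its integral does. -/
theorem eq_zero_of_integral_star_mul_self {A : Type u} [NonUnitalCStarAlgebra A] {X : Type*}
    [TopologicalSpace X] [CompactSpace X] [MeasurableSpace X] [BorelSpace X]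
    {μ : Measure X} [IsFiniteMeasure μ] [μ.IsOpenPosMeasure]
    {f : X → A} (hf : Continuous f) (hint : Integrable (fun x => star (f x) * f x) μ)
    (h0 : ∫ x, star (f x) * f x ∂μ = 0) (x : X) : f x = 0 := by
  let : PartialOrder A := CStarAlgebra.spectralOrder A
  have : StarOrderedRing A := CStarAlgebra.spectralOrderedRing A
  -- The integrals over s and its complement are positive with sum zero. Vanishing on every s gives
  -- vanishing almost everywhere, and continuity then gives it everywhere.
  have hset : ∀ s, MeasurableSet s → ∫ x in s, star (f x) * f x ∂μ = 0 := by
    intro s hs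
    have h1 : 0 ≤ ∫ x in s, star (f x) * f x ∂μ := integral_nonneg fun x => star_mul_self_nonneg _
    have h2 : 0 ≤ ∫ x in sᶜ, star (f x) * f x ∂μ :=
      integral_nonneg fun x => star_mul_self_nonneg _
    have h3 := integral_add_compl hs hint
    rw [h0] at h3
    exact ((add_eq_zero_iff_of_nonneg h1 h2).mp h3).1
  have hae : (fun x => star (f x) * f x) =ᵐ[μ] 0 :=
    ae_eq_zero_of_forall_setIntegral_eq_of_sigmaFinite (fun _ _ _ => hint.integrableOn)
      (fun s hs _ => hset s hs)
  have := (Continuous.ae_eq_iff_eq μ (hf.star.mul hf) continuous_const).mp hae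
  exact (CStarRing.star_mul_self_eq_zero_iff _).mp (congrFun this x)

end Positive

/-! ### The gauge action and its faithful conditional expectation -/

namespace KGraph

section Gauge

open MeasureTheory UnitAddTorus IsCuntzKrieger

variable {k : ℕ} {Λ : KGraph.{u} k}

/-- The weight is multiplicative along composition and unimodular, so it cancels in each product s_λ
s_λ^* and s_λ^* s_λ. -/
theorem IsCuntzKrieger.twist {B : Type v} [NonUnitalCStarAlgebra B] {t : Λ.Path → B}
    (ht : Λ.IsCuntzKrieger t) {ω : Λ.Path → ℂ} (h1 : ∀ v, ω (Λ.id v) = 1)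
    (hω : ∀ μ ν h, ω (Λ.comp μ ν h) = ω μ * ω ν) (hn : ∀ μ, star (ω μ) * ω μ = 1) :
    Λ.IsCuntzKrieger fun μ => ω μ • t μ := by
  have hn' : ∀ μ, ω μ * star (ω μ) = 1 := fun μ => by rw [mul_comm, hn]
  constructor
  · intro μ
    rw [star_smul, smul_mul_smul_comm, smul_mul_smul_comm, hn', one_mul, ht.partialIsometry]
  · intro v
    rw [h1, one_smul]
    exact ht.projection v
  · intro v w h
    rw [h1, h1, one_smul, one_smul]
    exact ht.orthogonal v w h
  · intro μ ν h
    rw [hω, ht.map_comp, smul_mul_smul_comm]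
  · intro μ
    rw [star_smul, smul_mul_smul_comm, hn, ht.star_mul_self, h1]
  · intro v m
    simp only [star_smul, smul_mul_smul_comm, hn', h1, one_smul]
    exact ht.sum_upTo v m

/-- The degree of a path, as an element of `ℤ^k`. -/
def intDeg (Λ : KGraph.{u} k) (μ : Λ.Path) : Fin k → ℤ := fun i => Λ.d μ i

theorem gauge_isCuntzKrieger (hrf : Λ.RowFinite) (z : UnitAddTorus (Fin k)) :
    Λ.IsCuntzKrieger fun μ => mFourier (Λ.intDeg μ) z • CStar.gen Λ μ := by
  refine (CStar.isCuntzKrieger_gen hrf).twist (fun v => ?_) (fun μ ν h => ?_)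
    fun μ => star_mFourier_mul_self _ _
  · have : Λ.intDeg (Λ.id v) = 0 := by
      funext i
      simp [intDeg, Λ.d_id]
    rw [this, mFourier_zero]
    rfl
  · rw [← mFourier_add]
    congr 2
    funext i
    simp [intDeg, Λ.d_comp]

/-- The gauge action. -/
noncomputable def gauge (hrf : Λ.RowFinite) (z : UnitAddTorus (Fin k)) : Λ.CStar →⋆ₙₐ[ℂ] Λ.CStar :=
  (CStar.existsUnique_lift hrf (gauge_isCuntzKrieger hrf z)).choose

theorem gauge_gen (hrf : Λ.RowFinite) (z : UnitAddTorus (Fin k)) (μ : Λ.Path) :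
    gauge hrf z (CStar.gen Λ μ) = mFourier (Λ.intDeg μ) z • CStar.gen Λ μ :=
  (CStar.existsUnique_lift hrf (gauge_isCuntzKrieger hrf z)).choose_spec.1 μ

theorem gauge_pair (hrf : Λ.RowFinite) (z : UnitAddTorus (Fin k)) (μ ν : Λ.Path) :
    gauge hrf z (CStar.gen Λ μ * star (CStar.gen Λ ν)) =
      mFourier (Λ.intDeg μ - Λ.intDeg ν) z • (CStar.gen Λ μ * star (CStar.gen Λ ν)) := by
  rw [map_mul, map_star, gauge_gen, gauge_gen, star_smul, smul_mul_smul_comm, sub_eq_add_neg,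
    mFourier_add, mFourier_neg]
  rfl

theorem gauge_zero (hrf : Λ.RowFinite) (a : Λ.CStar) : gauge hrf 0 a = a := by
  obtain ⟨π, -, hu⟩ := CStar.existsUnique_lift hrf (CStar.isCuntzKrieger_gen hrf)
  have h1 := hu (gauge hrf 0) fun μ => by rw [gauge_gen, mFourier_eval_zero, one_smul]
  have h2 := hu (NonUnitalStarAlgHom.id ℂ _) fun μ => rfl
  rw [h1, ← h2]
  rfl

/-- On the dense span the action is by characters. All gauge maps are contractions, so approximation
by elements of the span is uniform in z. -/
theorem continuous_gauge (hrf : Λ.RowFinite) (a : Λ.CStar) :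
    Continuous fun z => gauge hrf z a := by
  have hspan : ∀ b ∈ pairSpan (CStar.gen Λ), Continuous fun z => gauge hrf z b := by
    intro b hb
    induction hb using Submodule.span_induction with
    | mem x hx =>
      obtain ⟨p, rfl⟩ := hx
      simp only [gauge_pair]
      fun_prop
    | zero => simpa only [map_zero] using continuous_const
    | add x y _ _ hx hy => simp only [map_add]; exact hx.add hy
    | smul c x _ hx => simp only [map_smul]; exact hx.const_smul c
  rw [← continuousOn_univ]
  refine continuousOn_of_uniform_approx_of_continuousOn fun U hU => ?_
  obtain ⟨ε, hε, hεU⟩ := Metric.mem_uniformity_dist.mp hU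
  obtain ⟨b, hb, hab⟩ := Metric.dense_iff.mp (CStar.dense_pairSpan hrf) a ε hε
  refine ⟨fun z => gauge hrf z b, (hspan b hab).continuousOn, fun z _ => hεU ?_⟩
  rw [dist_eq_norm, ← map_sub]
  refine (NonUnitalStarAlgHom.norm_apply_le _ _).trans_lt ?_
  rwa [← dist_eq_norm, dist_comm]

theorem integrable_gauge (hrf : Λ.RowFinite) (a : Λ.CStar) :
    Integrable (fun z => gauge hrf z a) volume :=
  (continuous_gauge hrf a).integrable_of_hasCompactSupport (HasCompactSupport.of_compactSpace _)

/-- The conditional expectation onto the fixed-point algebra of the gauge action. -/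
noncomputable def expectation (hrf : Λ.RowFinite) : Λ.CStar →ₗ[ℂ] Λ.CStar where
  toFun a := ∫ z, gauge hrf z a
  map_add' a b := by
    simp only [map_add]
    exact integral_add (integrable_gauge hrf a) (integrable_gauge hrf b)
  map_smul' c a := by
    simp only [map_smul]
    exact integral_smul c _

theorem norm_expectation_le (hrf : Λ.RowFinite) (a : Λ.CStar) : ‖expectation hrf a‖ ≤ ‖a‖ := by
  have := norm_integral_le_of_norm_le_const (μ := (volume : Measure (UnitAddTorus (Fin k))))
    (Filter.Eventually.of_forall fun z => NonUnitalStarAlgHom.norm_apply_le (gauge hrf z) a)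
  rwa [probReal_univ, mul_one] at this

open Classical in
theorem expectation_pair (hrf : Λ.RowFinite) (μ ν : Λ.Path) :
    expectation hrf (CStar.gen Λ μ * star (CStar.gen Λ ν)) =
      if Λ.d μ = Λ.d ν then CStar.gen Λ μ * star (CStar.gen Λ ν) else 0 := by
  change ∫ z, gauge hrf z _ = _
  simp only [gauge_pair]
  rw [integral_smul_const]
  split_ifs with h
  · have : Λ.intDeg μ - Λ.intDeg ν = 0 := by
      funext i
      simp [intDeg, h]
    rw [this, mFourier_zero]
    simp
  · rw [integral_mFourier_eq_zero, zero_smul]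
    intro h'
    refine h (funext fun i => ?_)
    have := congrFun h' i
    simp only [intDeg, Pi.sub_apply, Pi.zero_apply] at this
    omega

/-- Faithfulness of the expectation: the integrand is continuous and positive with zero integral,
and at the identity z = 0 of the torus it is a^*a. -/
theorem eq_zero_of_expectation_star_mul_self (hrf : Λ.RowFinite) {a : Λ.CStar}
    (h : expectation hrf (star a * a) = 0) : a = 0 := by
  have h1 : ∀ z, gauge hrf z (star a * a) = star (gauge hrf z a) * gauge hrf z a := fun z => by
    rw [map_mul, map_star]
  have h2 := eq_zero_of_integral_star_mul_self (f := fun z => gauge hrf z a) (μ := volume)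
    (continuous_gauge hrf a)
    (by simpa only [h1] using integrable_gauge hrf (star a * a))
    (by simpa only [h1] using (show ∫ z, gauge hrf z (star a * a) = 0 from h)) 0
  rwa [gauge_zero] at h2

end Gauge

end KGraph

/-! ### Boundary paths as compatible families of finite segments -/

namespace KGraph

section Threads

variable {k : ℕ} {Λ : KGraph.{u} k}

/-- A boundary path, presented by the compatible family of its initial segments: `seg M` is the
initial segment of degree `M ⊓ d(x)`. -/
structure BoundaryThread (Λ : KGraph.{u} k) where
  seg : (Fin k → ℕ) → Λ.Path
  head_seg : ∀ {M N : Fin k → ℕ}, M ≤ N → Λ.head (seg N) M = seg M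
  seg_mem : ∀ M, seg M ∈ Λ.upTo M (Λ.r (seg M))

namespace BoundaryThread

/-- The range of a boundary path. -/
def root (x : Λ.BoundaryThread) : Λ.Vertex := Λ.r (x.seg 0)

theorem ext' {x y : Λ.BoundaryThread} (h : ∀ M, x.seg M = y.seg M) : x = y := by
  cases x
  cases y
  congr
  exact funext h

theorem r_seg (x : Λ.BoundaryThread) (M : Fin k → ℕ) : Λ.r (x.seg M) = x.root := by
  rw [root, ← x.head_seg (M := 0) (N := M) (fun _ => Nat.zero_le _), Λ.r_head]

theorem seg_mem' (x : Λ.BoundaryThread) (M : Fin k → ℕ) : x.seg M ∈ Λ.upTo M x.root :=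
  x.r_seg M ▸ x.seg_mem M

end BoundaryThread

theorem head_cat_head {μ ν : Λ.Path} (h : Λ.s μ = Λ.r ν) {m n : Fin k → ℕ}
    (hm : m ≤ Λ.d μ + n) : Λ.head (Λ.cat μ (Λ.head ν n)) m = Λ.head (Λ.cat μ ν) m := by
  rw [cat_eq h, cat_eq (h.trans (Λ.r_head _ _).symm), head_comp_head h hm]

theorem head_cat_head_self {μ ν : Λ.Path} (h : Λ.s μ = Λ.r ν) (m : Fin k → ℕ) :
    Λ.head (Λ.cat μ (Λ.head ν m)) m = Λ.head (Λ.cat μ ν) m :=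
  head_cat_head h (le_add_of_nonneg_left fun _ => Nat.zero_le _)

theorem LocallyConvex.head_cat_mem_upTo (hlc : Λ.LocallyConvex) {μ ν : Λ.Path}
    {m : Fin k → ℕ} (hν : ν ∈ Λ.upTo m (Λ.s μ)) :
    Λ.head (Λ.cat μ ν) m ∈ Λ.upTo m (Λ.r μ) := by
  have h := (mem_upTo_iff.mp hν).1.symm
  rw [cat_eq h]
  exact hlc.head_mem_upTo (le_add_of_nonneg_left fun _ => Nat.zero_le _)
    (comp_mem_upTo h (self_mem_upTo μ) hν)

theorem BoundaryThread.head_cat_seg {α : Λ.Path} {x : Λ.BoundaryThread} (h : Λ.s α = x.root)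
    {M N : Fin k → ℕ} (hMN : M ≤ N) :
    Λ.head (Λ.cat α (x.seg N)) M = Λ.head (Λ.cat α (x.seg M)) M := by
  rw [← x.head_seg hMN, head_cat_head_self (h.trans (x.r_seg N).symm)]

/-- The boundary path `αx`. -/
noncomputable def BoundaryThread.concat (hlc : Λ.LocallyConvex) (α : Λ.Path)
    (x : Λ.BoundaryThread) (h : Λ.s α = x.root) : Λ.BoundaryThread where
  seg M := Λ.head (Λ.cat α (x.seg M)) M
  head_seg {M N} hMN := by rw [head_head _ hMN, head_cat_seg h hMN]
  seg_mem M := by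
    have := hlc.head_cat_mem_upTo (μ := α) (m := M) (h ▸ x.seg_mem' M)
    rwa [(mem_upTo_iff.mp this).1]

/-! ### Graph morphisms from `Ω_{k,m}` -/

/-- The truncation of `M ∈ ℕ^k` at `m ∈ (ℕ ∪ {∞})^k`. -/
noncomputable def cut (m : Fin k → ℕ∞) (M : Fin k → ℕ) : Fin k → ℕ :=
  fun i => (min (M i : ℕ∞) (m i)).toNat

theorem coe_cut (m : Fin k → ℕ∞) (M : Fin k → ℕ) (i : Fin k) :
    (cut m M i : ℕ∞) = min (M i : ℕ∞) (m i) :=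
  ENat.natCast_toNat (ne_top_of_le_ne_top (ENat.natCast_ne_top (M i)) (min_le_left _ _))

theorem cut_le (m : Fin k → ℕ∞) (M : Fin k → ℕ) : cut m M ≤ M := fun i => by
  have := coe_cut m M i
  have h2 : (cut m M i : ℕ∞) ≤ M i := this ▸ min_le_left _ _
  exact_mod_cast h2

theorem coe_cut_le (m : Fin k → ℕ∞) (M : Fin k → ℕ) (i : Fin k) : (cut m M i : ℕ∞) ≤ m i :=
  (coe_cut m M i).le.trans (min_le_right _ _)

theorem cut_mono (m : Fin k → ℕ∞) {M N : Fin k → ℕ} (h : M ≤ N) : cut m M ≤ cut m N :=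
  fun i => by
    have : (cut m M i : ℕ∞) ≤ cut m N i := by
      rw [coe_cut, coe_cut]
      exact min_le_min_right _ (Nat.cast_le.mpr (h i))
    exact_mod_cast this

theorem cut_of_le {m : Fin k → ℕ∞} {M : Fin k → ℕ} (h : ∀ i, (M i : ℕ∞) ≤ m i) :
    cut m M = M := funext fun i => by
  have := coe_cut m M i
  rw [min_eq_left (h i)] at this
  exact_mod_cast this

theorem min_cut (m : Fin k → ℕ∞) {M N : Fin k → ℕ} (h : M ≤ N) : M ⊓ cut m N = cut m M :=
  funext fun i => by
    have : ((M ⊓ cut m N) i : ℕ∞) = (cut m M i : ℕ∞) := by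
      rw [Pi.inf_apply, Nat.mono_cast.map_min, coe_cut, coe_cut, ← min_assoc,
        min_eq_left (Nat.cast_le.mpr (h i))]
    exact_mod_cast this

namespace GPath

variable (x : Λ.GPath)

theorem d_seg {p q : Fin k → ℕ} (hpq : p ≤ q) (hq : ∀ i, (q i : ℕ∞) ≤ x.deg i) :
    Λ.d (x.seg p q hpq hq) = q - p := x.hom.d_map _

theorem s_seg {p q : Fin k → ℕ} (hpq : p ≤ q) (hq : ∀ i, (q i : ℕ∞) ≤ x.deg i) :
    Λ.s (x.seg p q hpq hq) = x.hom.obj ⟨q, hq⟩ := x.hom.s_map _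

/-- The initial segment of degree `M ⊓ d(x)`. -/
noncomputable def initial (M : Fin k → ℕ) : Λ.Path :=
  x.seg 0 (cut x.deg M) (fun _ => Nat.zero_le _) (coe_cut_le _ _)

theorem d_initial (M : Fin k → ℕ) : Λ.d (x.initial M) = cut x.deg M := by
  rw [initial, d_seg, tsub_zero]

theorem r_initial (M : Fin k → ℕ) : Λ.r (x.initial M) = x.range := x.hom.r_map _

theorem seg_comp_seg {p q l : Fin k → ℕ} (hpq : p ≤ q) (hql : q ≤ l)
    (hl : ∀ i, (l i : ℕ∞) ≤ x.deg i) :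
    ∃ h, Λ.comp (x.seg p q hpq fun i => (Nat.cast_le.mpr (hql i)).trans (hl i))
      (x.seg q l hql hl) h = x.seg p l (hpq.trans hql) hl :=
  ⟨_, (x.hom.map_comp ⟨(⟨p, _⟩, ⟨q, _⟩), hpq⟩ ⟨(⟨q, _⟩, ⟨l, hl⟩), hql⟩ rfl).symm⟩

theorem tail_seg {p q : Fin k → ℕ} (hpq : p ≤ q) (hq : ∀ i, (q i : ℕ∞) ≤ x.deg i) :
    Λ.tail (x.seg 0 q (fun _ => Nat.zero_le _) hq) p = x.seg p q hpq hq := by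
  obtain ⟨h, hc⟩ := x.seg_comp_seg (p := 0) (fun _ => Nat.zero_le _) hpq hq
  refine tail_eq h hc ?_
  rw [d_seg, d_seg, tsub_zero, tsub_zero, inf_eq_left.mpr hpq]

theorem head_initial {M N : Fin k → ℕ} (h : M ≤ N) : Λ.head (x.initial N) M = x.initial M := by
  obtain ⟨h', hc⟩ := x.seg_comp_seg (p := 0) (fun _ => Nat.zero_le _) (cut_mono x.deg h)
    (coe_cut_le x.deg N)
  refine head_eq h' hc ?_
  rw [d_initial, d_initial, min_cut _ h]

theorem initial_of_le {q : Fin k → ℕ} (hq : ∀ i, (q i : ℕ∞) ≤ x.deg i) :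
    x.initial q = x.seg 0 q (fun _ => Nat.zero_le _) hq := by
  have : cut x.deg q = q := cut_of_le hq
  unfold initial
  congr

end GPath

/-- This turns the definition of boundary paths into absence of edges, the form in which Λ^{≤M}(v)
is tested. -/
theorem upTo_e_eq_singleton_iff {i : Fin k} {v : Λ.Vertex} :
    Λ.upTo (e i) v = {Λ.id v} ↔ Λ.pathsAt (e i) v = ∅ := by
  constructor
  · intro h
    by_contra hne
    obtain ⟨μ, h1, h2⟩ := Set.nonempty_iff_ne_empty.mpr hne
    have : μ ∈ Λ.upTo (e i) v := h1 ▸ h2 ▸ self_mem_upTo μ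
    rw [h, Set.mem_singleton_iff] at this
    rw [this, Λ.d_id] at h1
    have := congrFun h1 i
    rw [e_same] at this
    exact absurd this zero_ne_one
  · intro h
    ext μ
    rw [mem_upTo_iff, Set.mem_singleton_iff]
    constructor
    · rintro ⟨h1, h2, -⟩
      have h0 : Λ.d μ = 0 := by
        by_contra hne
        obtain ⟨j, hj⟩ := Function.ne_iff.mp hne
        have hj' : Λ.d μ j ≠ 0 := hj
        have h3 : Λ.d μ j ≤ e i j := h2 j
        have hji : j = i := by
          by_contra hji
          rw [e_of_ne hji] at h3
          omega
        subst hji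
        have := pathsAt_nonempty_of_pos (Λ := Λ) (μ := μ) (i := j) (Nat.pos_of_ne_zero hj')
        rw [h1, h] at this
        exact Set.not_nonempty_empty this
      rw [← h1]
      exact eq_id_of_d_eq_zero h0
    · rintro rfl
      refine ⟨Λ.r_id _, by rw [Λ.d_id]; exact fun _ => Nat.zero_le _, fun j hj => ?_⟩
      have hji : j = i := by
        by_contra hji
        rw [e_of_ne hji] at hj
        omega
      rw [hji, Λ.s_id, h]

/-- A segment shorter than M in direction i has exhausted d(x) in that direction. There Ω has no
i-edge, so the boundary condition excludes one in Λ. -/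
theorem GPath.IsBoundary.initial_mem {x : Λ.GPath} (hx : x.IsBoundary) (M : Fin k → ℕ) :
    x.initial M ∈ Λ.upTo M x.range := by
  rw [mem_upTo_iff, x.d_initial]
  refine ⟨x.r_initial M, cut_le _ _, fun i hi => ?_⟩
  have h1 := hx i ⟨cut x.deg M, coe_cut_le _ _⟩ (upTo_e_eq_singleton_iff.mpr ?_)
  · rw [GPath.initial, GPath.s_seg]
    exact upTo_e_eq_singleton_iff.mp h1
  · rw [Set.eq_empty_iff_forall_notMem]
    rintro ⟨⟨⟨p, hp⟩, ⟨q, hq⟩⟩, hpq⟩ ⟨h2, h3⟩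
    have h4 : p = cut x.deg M := congrArg Subtype.val h3
    subst h4
    have h5 : q i - cut x.deg M i = e i i := congrFun h2 i
    rw [e_same] at h5
    have h6 := hq i
    have h7 := coe_cut x.deg M i
    have h8 : ((cut x.deg M i : ℕ) : ℕ∞) < M i := Nat.cast_lt.mpr hi
    have h9 : ((cut x.deg M i : ℕ) : ℕ∞) < q i := Nat.cast_lt.mpr (by omega)
    exact absurd h7 (lt_min h8 (h9.trans_le h6)).ne

/-- The boundary thread of a boundary path. -/
noncomputable def GPath.toThread (x : Λ.GPath) (hx : x.IsBoundary) : Λ.BoundaryThread where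
  seg := x.initial
  head_seg h := x.head_initial h
  seg_mem M := (x.r_initial M) ▸ hx.initial_mem M

/-- The graph morphism with given initial segments. -/
noncomputable def GPath.ofInitial (deg : Fin k → ℕ∞) (f : (Fin k → ℕ) → Λ.Path)
    (hf : ∀ {M N}, M ≤ N → Λ.head (f N) M = f M)
    (hd : ∀ p : Fin k → ℕ, (∀ i, (p i : ℕ∞) ≤ deg i) → Λ.d (f p) = p) : Λ.GPath where
  deg := deg
  hom :=
    { obj := fun p => Λ.s (f p.1)
      map := fun a => Λ.tail (f a.1.2.1) a.1.1.1
      r_map := fun a => by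
        rw [← Λ.s_head, hf a.2]
        rfl
      s_map := fun a => Λ.s_tail _ _
      map_id := fun p => by
        have h0 : Λ.d (Λ.tail (f p.1) p.1) = 0 := by
          rw [Λ.d_tail, hd _ p.2, tsub_self]
        have := eq_id_of_d_eq_zero h0
        rw [← Λ.s_head, hf le_rfl] at this
        exact this
      map_comp := by
        rintro ⟨⟨⟨p, hp⟩, ⟨q, hq⟩⟩, hpq⟩ ⟨⟨⟨q', hq'⟩, ⟨l, hl⟩⟩, hql⟩ h
        obtain rfl : q = q' := congrArg Subtype.val h
        change Λ.tail (f l) p = _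
        refine ((Λ.head_tail (Λ.tail (f l) p) (q - p)).symm.trans (comp_congr ?_ ?_))
        · rw [← comp_head_tail_head _ hpq, hf hql]
        · rw [tail_tail, add_tsub_cancel_of_le hpq]
      d_map := fun a => by
        rw [Λ.d_tail, hd _ a.1.2.2]
        rfl }

/-- Condition (B) speaks of every path that is a concatenation, so applying it needs explicit ones.
The final clause recovers the degree of αx from its finite segments. -/
theorem GPath.exists_isConcat (x : Λ.GPath) {α : Λ.Path} (h : Λ.s α = x.range) :
    ∃ (deg : Fin k → ℕ∞)
      (hf : ∀ {M N}, M ≤ N → Λ.head (Λ.head (Λ.cat α (x.initial N)) N) M =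
        Λ.head (Λ.cat α (x.initial M)) M)
      (hd : ∀ p : Fin k → ℕ, (∀ i, (p i : ℕ∞) ≤ deg i) →
        Λ.d (Λ.head (Λ.cat α (x.initial p)) p) = p),
      IsConcat α x (GPath.ofInitial deg (fun M => Λ.head (Λ.cat α (x.initial M)) M) hf hd) ∧
      ∀ M i, (Λ.d (Λ.head (Λ.cat α (x.initial M)) M) i : ℕ∞) = min (M i : ℕ∞) (deg i) := by
  have hr : ∀ M, Λ.s α = Λ.r (x.initial M) := fun M => h.trans (x.r_initial M).symm
  have hdeg : ∀ (M : Fin k → ℕ) i, (Λ.d (Λ.head (Λ.cat α (x.initial M)) M) i : ℕ∞) =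
      min (M i : ℕ∞) (Λ.d α i + x.deg i) := fun M i => by
    rw [Λ.d_head, d_cat (hr M), x.d_initial, Pi.inf_apply, Pi.add_apply, Nat.mono_cast.map_min,
      Nat.cast_add, coe_cut, ← min_add_add_left, ← min_assoc, min_eq_left (a := (M i : ℕ∞))]
    exact le_add_self
  have hd : ∀ p : Fin k → ℕ, (∀ i, (p i : ℕ∞) ≤ Λ.d α i + x.deg i) →
      Λ.d (Λ.head (Λ.cat α (x.initial p)) p) = p := fun p hp => funext fun i => by
    have := hdeg p i
    rw [min_eq_left (hp i)] at this
    exact_mod_cast this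
  refine ⟨fun i => Λ.d α i + x.deg i, fun {M N} hMN => ?_, hd, ⟨fun i => rfl, ?_, ?_⟩, hdeg⟩
  · rw [head_head _ hMN, ← x.head_initial hMN, head_cat_head_self (hr N)]
  · change Λ.tail (Λ.head (Λ.cat α (x.initial (Λ.d α))) (Λ.d α)) 0 = α
    rw [cat_eq (hr _), head_comp]
    exact tail_eq (Λ.s_id _) (Λ.id_comp α)
      (by rw [Λ.d_id]; exact (inf_eq_left.mpr fun _ => Nat.zero_le _).symm)
  · intro p q hpq hq
    change Λ.tail (Λ.head (Λ.cat α (x.initial (Λ.d α + q))) (Λ.d α + q)) (Λ.d α + p) = _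
    rw [← head_cat_head (hr _) le_rfl,
      x.head_initial (le_add_of_nonneg_left fun _ => Nat.zero_le _), head_of_le, ← tail_tail,
      cat_eq (hr _), tail_comp, x.initial_of_le hq, x.tail_seg hpq]
    rw [d_cat (hr _), x.d_initial]
    exact add_le_add_right (cut_le _ _) _

/-- Condition (B) in terms of initial segments. -/
theorem ConditionB.exists_thread (hB : Λ.ConditionB) (v : Λ.Vertex) :
    ∃ x : Λ.BoundaryThread, x.root = v ∧ ∀ α β, Λ.s α = v → Λ.s β = v → α ≠ β →
      ∃ M, Λ.head (Λ.cat α (x.seg M)) M ≠ Λ.head (Λ.cat β (x.seg M)) M := by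
  obtain ⟨x, hx, rfl, hsep⟩ := hB v
  refine ⟨x.toThread hx, x.r_initial 0, fun α β hα hβ hne => ?_⟩
  obtain ⟨da, hfa, hda, hca, hia⟩ := x.exists_isConcat hα
  obtain ⟨db, hfb, hdb, hcb, hib⟩ := x.exists_isConcat hβ
  by_contra! hcon
  change ∀ M, Λ.head (Λ.cat α (x.initial M)) M = Λ.head (Λ.cat β (x.initial M)) M at hcon
  refine hsep α β hα hβ hne _ _ hca hcb ?_
  -- Equal segments have equal degrees. Comparing min(n, ·) for all constant tuples n determines
  -- each coordinate, infinite ones included; then both concatenations are the same morphism.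
  have hdeg : da = db := by
    have : ∀ (M : Fin k → ℕ) i, min (M i : ℕ∞) (da i) = min (M i : ℕ∞) (db i) := fun M i => by
      rw [← hia, ← hib, hcon]
    funext i
    refine le_antisymm ?_ ?_ <;> rw [← ENat.forall_natCast_le_iff_le] <;> intro n hn
    · have h1 := this (fun _ => n) i
      rw [min_eq_left hn] at h1
      exact min_eq_left_iff.mp h1.symm
    · have h1 := this (fun _ => n) i
      rw [min_eq_left hn] at h1
      exact min_eq_left_iff.mp h1
  subst hdeg
  congr 1
  exact funext hcon

/-- Condition (B) provides a path after which finitely many paths are separated. -/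
theorem ConditionB.exists_separating (hlc : Λ.LocallyConvex) (hB : Λ.ConditionB) (v : Λ.Vertex)
    (S : Finset Λ.Path) (hS : ∀ α ∈ S, Λ.s α = v) :
    ∃ τ, Λ.r τ = v ∧ ∀ α ∈ S, ∀ β ∈ S, α ≠ β → ∃ N,
      Λ.head (Λ.cat α τ) N ∈ Λ.upTo N (Λ.r α) ∧ Λ.head (Λ.cat β τ) N ∈ Λ.upTo N (Λ.r β) ∧
      Λ.head (Λ.cat α τ) N ≠ Λ.head (Λ.cat β τ) N := by
  classical
  obtain ⟨x, hx, hsep⟩ := hB.exists_thread v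
  have : ∀ α β : Λ.Path, ∃ M, α ∈ S → β ∈ S → α ≠ β →
      Λ.head (Λ.cat α (x.seg M)) M ≠ Λ.head (Λ.cat β (x.seg M)) M := fun α β => by
    by_cases h : α ∈ S ∧ β ∈ S ∧ α ≠ β
    · obtain ⟨M, hM⟩ := hsep α β (hS α h.1) (hS β h.2.1) h.2.2
      exact ⟨M, fun _ _ _ => hM⟩
    -- The value 0 for irrelevant pairs only serves to make M a total function.
    · exact ⟨0, fun h1 h2 h3 => absurd ⟨h1, h2, h3⟩ h⟩
  choose M hM using this
  -- The sum is just a convenient upper bound for all the M(α, β): a longer segment of x still shows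
  -- the difference at degree M(α, β).
  refine ⟨x.seg (∑ p ∈ S ×ˢ S, M p.1 p.2), (x.r_seg _).trans hx, fun α hα β hβ hne => ?_⟩
  have hle : M α β ≤ ∑ p ∈ S ×ˢ S, M p.1 p.2 :=
    Finset.single_le_sum (f := fun p : Λ.Path × Λ.Path => M p.1 p.2)
      (fun _ _ _ => Nat.zero_le _) (Finset.mk_mem_product hα hβ)
  have hα' : Λ.s α = x.root := (hS α hα).trans hx.symm
  have hβ' : Λ.s β = x.root := (hS β hβ).trans hx.symm
  refine ⟨M α β, ?_⟩
  rw [BoundaryThread.head_cat_seg hα' hle, BoundaryThread.head_cat_seg hβ' hle]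
  exact ⟨hlc.head_cat_mem_upTo (hα' ▸ x.seg_mem' _), hlc.head_cat_mem_upTo (hβ' ▸ x.seg_mem' _),
    hM α β hα hβ hne⟩

end Threads

end KGraph

/-! ### Orthogonal sums and matrix units -/

section MatrixUnits

variable {A : Type u} [NonUnitalCStarAlgebra A]

/-- Left orthogonality removes the cross terms from f^*f. Right orthogonality makes the remaining
summands mutually orthogonal self-adjoint elements, whose sum has the maximal norm among them. -/
theorem norm_sum_le_of_orthogonal {ι : Type*} (s : Finset ι) {f : ι → A} {C : ℝ} (hC : 0 ≤ C)
    (h1 : ∀ i j, i ≠ j → star (f i) * f j = 0) (h2 : ∀ i j, i ≠ j → f i * star (f j) = 0)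
    (hf : ∀ i ∈ s, ‖f i‖ ≤ C) : ‖∑ i ∈ s, f i‖ ≤ C := by
  classical
  have h3 : star (∑ i ∈ s, f i) * ∑ i ∈ s, f i = ∑ i ∈ s, star (f i) * f i := by
    rw [star_sum, Finset.sum_mul]
    refine Finset.sum_congr rfl fun i hi => ?_
    rw [Finset.mul_sum]
    exact Finset.sum_eq_single_of_mem i hi fun j _ hj => h1 i j hj.symm
  have h4 := IsSelfAdjoint.nnnorm_sum_eq_sup (f := fun i => star (f i) * f i) s
    (fun i _ => IsSelfAdjoint.star_mul_self (f i)) (fun i j hij => by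
      change star (f i) * f i * (star (f j) * f j) = 0
      rw [mul_assoc, ← mul_assoc (f i), h2 i j hij, zero_mul, mul_zero])
  have h5 : ‖∑ i ∈ s, star (f i) * f i‖₊ ≤ ⟨C, hC⟩ * ⟨C, hC⟩ := by
    rw [h4]
    refine Finset.sup_le fun i hi => ?_
    rw [CStarRing.nnnorm_star_mul_self]
    exact mul_le_mul' (hf i hi) (hf i hi)
  have h6 : ‖∑ i ∈ s, f i‖ * ‖∑ i ∈ s, f i‖ ≤ C * C := by
    rw [← CStarRing.norm_star_mul_self, h3]
    exact h5
  exact abs_le_of_sq_le_sq' (by simpa only [sq] using h6) hC |>.2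

open scoped Matrix.Norms.L2Operator

variable {ι : Type*} [Fintype ι] [DecidableEq ι]

/-- The homomorphism determined by a system of matrix units. -/
def matrixUnitsHom (e : ι → ι → A)
    (hmul : ∀ i j j' l, e i j * e j' l = if j = j' then e i l else 0)
    (hstar : ∀ i j, star (e i j) = e j i) : Matrix ι ι ℂ →⋆ₙₐ[ℂ] A where
  toFun M := ∑ i, ∑ j, M i j • e i j
  map_smul' c M := by
    simp only [Matrix.smul_apply, smul_assoc, Finset.smul_sum, MonoidHom.id_apply]
  map_zero' := by simp
  map_add' M N := by simp only [Matrix.add_apply, add_smul, Finset.sum_add_distrib]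
  map_mul' M N := by
    have h : ∀ i j, (M i j • e i j) * ∑ j', ∑ l, N j' l • e j' l =
        ∑ l, (M i j * N j l) • e i l := fun i j => by
      rw [Finset.mul_sum, Finset.sum_eq_single_of_mem j (Finset.mem_univ _)]
      · rw [Finset.mul_sum]
        refine Finset.sum_congr rfl fun l _ => ?_
        rw [smul_mul_smul_comm, hmul, if_pos rfl]
      · intro j' _ hj'
        rw [Finset.mul_sum]
        refine Finset.sum_eq_zero fun l _ => ?_
        rw [smul_mul_smul_comm, hmul, if_neg hj'.symm, smul_zero]
    simp only [Finset.sum_mul, h]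
    refine Finset.sum_congr rfl fun i _ => ?_
    rw [Finset.sum_comm]
    refine Finset.sum_congr rfl fun l _ => ?_
    rw [Matrix.mul_apply, Finset.sum_smul]
  map_star' M := by
    rw [star_sum, Finset.sum_comm]
    refine Finset.sum_congr rfl fun j _ => ?_
    rw [star_sum]
    refine Finset.sum_congr rfl fun i _ => ?_
    rw [star_smul, hstar]
    rfl

variable {e : ι → ι → A} {hmul : ∀ i j j' l, e i j * e j' l = if j = j' then e i l else 0}
    {hstar : ∀ i j, star (e i j) = e j i}

theorem matrixUnitsHom_single (i j : ι) :
    matrixUnitsHom e hmul hstar (Matrix.single i j 1) = e i j := by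
  change ∑ i', ∑ j', Matrix.single i j (1 : ℂ) i' j' • e i' j' = e i j
  rw [Finset.sum_eq_single_of_mem i (Finset.mem_univ _),
    Finset.sum_eq_single_of_mem j (Finset.mem_univ _)]
  · rw [Matrix.single_apply_same, one_smul]
  · intro j' _ hj
    rw [Matrix.single_apply_of_ne _ _ _ _ _ (by tauto), zero_smul]
  · intro i' _ hi
    refine Finset.sum_eq_zero fun j' _ => ?_
    rw [Matrix.single_apply_of_ne _ _ _ _ _ (by tauto), zero_smul]

theorem matrixUnitsHom_one : matrixUnitsHom e hmul hstar 1 = ∑ i, e i i := by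
  change ∑ i', ∑ j', (1 : Matrix ι ι ℂ) i' j' • e i' j' = _
  refine Finset.sum_congr rfl fun i _ => ?_
  rw [Finset.sum_eq_single_of_mem i (Finset.mem_univ _), Matrix.one_apply_eq, one_smul]
  intro j _ hj
  rw [Matrix.one_apply_ne hj.symm, zero_smul]

/-- Compression by e_ii and e_jj isolates one matrix entry times e_ij, and e_ij ≠ 0 because e_ij
e_ji = e_ii. -/
theorem matrixUnitsHom_injective (hne : ∀ i, e i i ≠ 0) :
    Function.Injective (matrixUnitsHom e hmul hstar) := by
  rw [injective_iff_map_eq_zero]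
  intro M hM
  have key : ∀ i j, e i i * matrixUnitsHom e hmul hstar M * e j j = M i j • e i j := fun i j => by
    rw [← matrixUnitsHom_single (e := e) (hmul := hmul) (hstar := hstar) i i,
      ← matrixUnitsHom_single (e := e) (hmul := hmul) (hstar := hstar) j j, ← map_mul, ← map_mul,
      Matrix.single_mul_mul_single, one_mul, mul_one,
      ← matrixUnitsHom_single (e := e) (hmul := hmul) (hstar := hstar) i j, ← map_smul,
      Matrix.smul_single, smul_eq_mul, mul_one]
  ext i j
  have h := key i j
  rw [hM, mul_zero, zero_mul] at h
  refine (smul_eq_zero.mp h.symm).resolve_right fun h0 => hne i ?_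
  have := hmul i j j i
  rw [h0, zero_mul, if_pos rfl] at this
  exact this.symm

theorem norm_matrixUnitsHom_one_le : ‖matrixUnitsHom e hmul hstar 1‖ ≤ 1 := by
  have h : IsStarProjection (1 : Matrix ι ι ℂ) := IsStarProjection.one _
  exact IsStarProjection.norm_le _ (h.map (matrixUnitsHom e hmul hstar))

end MatrixUnits

/-! ### The Cuntz–Krieger uniqueness theorem -/

namespace KGraph

section Uniqueness

open IsCuntzKrieger
open scoped Matrix.Norms.L2Operator

variable {k : ℕ} {Λ : KGraph.{u} k}

namespace IsCuntzKrieger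

variable {B : Type v} [NonUnitalCStarAlgebra B] {t : Λ.Path → B}

theorem ne_zero (ht : Λ.IsCuntzKrieger t) (h0 : ∀ v, t (Λ.id v) ≠ 0) (μ : Λ.Path) :
    t μ * star (t μ) ≠ 0 := fun h => by
  have h1 : t μ = 0 := by rw [← ht.partialIsometry μ, h, zero_mul]
  refine h0 (Λ.s μ) ?_
  rw [← ht.star_mul_self, h1, mul_zero]

/-- Paths with non-comparable initial segments have orthogonal ranges. -/
theorem star_mul_eq_zero_of_head_ne (ht : Λ.IsCuntzKrieger t) (hrf : Λ.RowFinite)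
    {μ ν : Λ.Path} {N : Fin k → ℕ} (hμ : Λ.head μ N ∈ Λ.upTo N (Λ.r μ))
    (hν : Λ.head ν N ∈ Λ.upTo N (Λ.r ν)) (hne : Λ.head μ N ≠ Λ.head ν N) :
    star (t μ) * t ν = 0 := by
  have h := ht.star_mul_eq_zero hrf ((Λ.r_head μ N).symm ▸ hμ) ((Λ.r_head ν N).symm ▸ hν) hne
  rw [← Λ.head_tail μ N, ← Λ.head_tail ν N, ht.map_comp, ht.map_comp, star_mul, mul_assoc,
    ← mul_assoc (star (t (Λ.head μ N))), h, zero_mul, mul_zero]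

theorem matrixUnits (ht : Λ.IsCuntzKrieger t) {G : Finset Λ.Path} {v : Λ.Vertex}
    (hs : ∀ μ ∈ G, Λ.s μ = v) (ho : ∀ μ ∈ G, ∀ ν ∈ G, μ ≠ ν → star (t μ) * t ν = 0)
    [DecidableEq G] (i j j' l : G) :
    t i * star (t j) * (t j' * star (t l)) = if j = j' then t i * star (t l) else 0 := by
  have h : t i * star (t j) * (t j' * star (t l)) = t i * (star (t j) * t j') * star (t l) := by
    simp only [mul_assoc]
  rw [h]
  split_ifs with hj
  · rw [← hj, ht.star_mul_self, hs j j.2, ← hs i i.2, ht.mul_source]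
  · rw [ho j j.2 j' j'.2 fun h => hj (Subtype.ext h), mul_zero, zero_mul]

end IsCuntzKrieger

variable {A : Type w} [NonUnitalCStarAlgebra A] {g : Λ.Path → A}
  {B : Type v} [NonUnitalCStarAlgebra B] {t : Λ.Path → B}

open Classical in
-- The block of source v and degree n is the image of a matrix M under the matrix units g_μ g_ν^*.
-- In B, the matrix units f_μ f_ν^* with f_μ = t_{μτ} represent the same M isometrically, and for a
-- suitable τ this copy is a compression of the whole sum. Thus the block has norm at most ‖M‖, and
-- ‖M‖ is at most the norm of the whole sum.
theorem IsCuntzKrieger.norm_block_le (hg : Λ.IsCuntzKrieger g) (ht : Λ.IsCuntzKrieger t)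
    (hrf : Λ.RowFinite) (hlc : Λ.LocallyConvex) (hB : Λ.ConditionB) (h0 : ∀ v, t (Λ.id v) ≠ 0)
    {J : Type*} (F : Finset J) (a b : J → Λ.Path) (c : J → ℂ) (N : Fin k → ℕ)
    (ha : ∀ j ∈ F, a j ∈ Λ.upTo N (Λ.r (a j)))
    (hb : ∀ j ∈ F, Λ.d (a j) = Λ.d (b j) → b j ∈ Λ.upTo N (Λ.r (b j)))
    (hs : ∀ j ∈ F, Λ.s (a j) = Λ.s (b j)) (v : Λ.Vertex) (n : Fin k → ℕ) :
    ‖∑ j ∈ F.filter fun j => Λ.s (a j) = v ∧ Λ.d (a j) = n ∧ Λ.d (b j) = n,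
        c j • (g (a j) * star (g (b j)))‖ ≤ ‖∑ j ∈ F, c j • (t (a j) * star (t (b j)))‖ := by
  set F' := F.filter fun j => Λ.s (a j) = v ∧ Λ.d (a j) = n ∧ Λ.d (b j) = n with hF'
  set G : Finset Λ.Path := F'.image a ∪ F'.image b with hG
  -- Besides the paths of the block, τ must separate from them the second paths of terms whose
  -- degrees differ; this is how those terms are annihilated.
  set S : Finset Λ.Path := G ∪ (F.filter fun j => Λ.s (a j) = v).image b with hS
  have hGprop : ∀ μ ∈ G, μ ∈ Λ.upTo N (Λ.r μ) ∧ Λ.s μ = v ∧ Λ.d μ = n := by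
    intro μ hμ
    rcases Finset.mem_union.mp hμ with hμ | hμ <;>
      obtain ⟨j, hj, rfl⟩ := Finset.mem_image.mp hμ <;>
      obtain ⟨hjF, h1, h2, h3⟩ := Finset.mem_filter.mp hj
    · exact ⟨ha j hjF, h1, h2⟩
    · exact ⟨hb j hjF (h2.trans h3.symm), (hs j hjF).symm.trans h1, h3⟩
  have hSs : ∀ μ ∈ S, Λ.s μ = v := by
    intro μ hμ
    rcases Finset.mem_union.mp hμ with hμ | hμ
    · exact (hGprop μ hμ).2.1
    · obtain ⟨j, hj, rfl⟩ := Finset.mem_image.mp hμ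
      obtain ⟨hjF, h1⟩ := Finset.mem_filter.mp hj
      exact (hs j hjF).symm.trans h1
  obtain ⟨τ, hτ, hsep⟩ := hB.exists_separating hlc v S hSs
  have hcomp : ∀ μ ∈ S, Λ.s μ = Λ.r τ := fun μ hμ => (hSs μ hμ).trans hτ.symm
  have hGS : ∀ μ ∈ G, μ ∈ S := fun μ hμ => Finset.mem_union_left _ hμ
  set f : Λ.Path → B := fun μ => t (Λ.cat μ τ) with hf
  have hforth : ∀ μ ∈ S, ∀ ν ∈ S, μ ≠ ν → star (f μ) * f ν = 0 := by
    intro μ hμ ν hν hne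
    obtain ⟨M, h1, h2, h3⟩ := hsep μ hμ ν hν hne
    refine ht.star_mul_eq_zero_of_head_ne hrf (N := M) ?_ ?_ h3
    · rwa [r_cat (hcomp μ hμ)]
    · rwa [r_cat (hcomp ν hν)]
  have hfself : ∀ μ ∈ S, star (f μ) * f μ = t (Λ.id (Λ.s τ)) := fun μ hμ => by
    rw [hf, ht.star_mul_self, s_cat (hcomp μ hμ)]
  have hfsource : ∀ μ ∈ S, f μ * t (Λ.id (Λ.s τ)) = f μ := fun μ hμ => by
    have := ht.mul_source (Λ.cat μ τ)
    rwa [s_cat (hcomp μ hμ)] at this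
  have hfstar : ∀ μ ∈ S, star (f μ) = star (t τ) * star (t μ) := fun μ hμ => by
    change star (t (Λ.cat μ τ)) = _
    rw [ht.map_cat (hcomp μ hμ), star_mul]
  have hgorth : ∀ μ ∈ G, ∀ ν ∈ G, μ ≠ ν → star (g μ) * g ν = 0 := fun μ hμ ν hν hne =>
    hg.star_mul_eq_zero hrf (hGprop μ hμ).1 (hGprop ν hν).1 hne
  let φ := matrixUnitsHom (fun i j : G => g i * star (g j))
    (hg.matrixUnits (fun μ hμ => (hGprop μ hμ).2.1) hgorth)
    (fun i j => by rw [star_mul, star_star])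
  let ψ := matrixUnitsHom (fun i j : G => f i * star (f j))
    (fun i j j' l => by
      have h : f i * star (f j) * (f j' * star (f l)) = f i * (star (f j) * f j') * star (f l) := by
        simp only [mul_assoc]
      rw [h]
      split_ifs with hj
      · rw [← hj, hfself j (hGS _ j.2), hfsource i (hGS _ i.2)]
      · rw [hforth j (hGS _ j.2) j' (hGS _ j'.2) fun h => hj (Subtype.ext h), mul_zero, zero_mul])
    (fun i j => by rw [star_mul, star_star])
  -- Nonvanishing of the vertex projections enters here; it makes `ψ` isometric.
  have hψ : Function.Injective ψ := matrixUnitsHom_injective fun i => ht.ne_zero h0 _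
  have haG : ∀ j ∈ F', a j ∈ G := fun j hj =>
    Finset.mem_union_left _ (Finset.mem_image_of_mem _ hj)
  have hbG : ∀ j ∈ F', b j ∈ G := fun j hj =>
    Finset.mem_union_right _ (Finset.mem_image_of_mem _ hj)
  let M : Matrix G G ℂ := ∑ j ∈ F'.attach,
    c j • Matrix.single (⟨a j, haG j j.2⟩ : G) (⟨b j, hbG j j.2⟩ : G) (1 : ℂ)
  have hφM : φ M = ∑ j ∈ F', c j • (g (a j) * star (g (b j))) := by
    rw [map_sum, ← Finset.sum_attach F']
    refine Finset.sum_congr rfl fun j _ => ?_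
    rw [map_smul, matrixUnitsHom_single]
  have hψM : ψ M = ∑ j ∈ F', c j • (f (a j) * star (f (b j))) := by
    rw [map_sum, ← Finset.sum_attach F']
    refine Finset.sum_congr rfl fun j _ => ?_
    rw [map_smul, matrixUnitsHom_single]
  set Q : B := ψ 1 with hQ
  have hQsum : Q = ∑ μ ∈ G, f μ * star (f μ) := by
    rw [hQ, matrixUnitsHom_one, ← Finset.sum_coe_sort G]
  -- Both α and the paths of G lie in Λ^{≤N}, so orthogonality holds before τ is appended and
  -- condition (B) plays no role on this side.
  have hleft : ∀ α, α ∈ Λ.upTo N (Λ.r α) →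
      Q * t α = if α ∈ G then f α * star (t τ) else 0 := by
    intro α hα
    have hterm : ∀ μ ∈ G, f μ * star (f μ) * t α = f μ * (star (t τ) * (star (t μ) * t α)) := by
      intro μ hμ
      rw [hfstar μ (hGS μ hμ)]
      simp only [mul_assoc]
    rw [hQsum, Finset.sum_mul, Finset.sum_congr rfl hterm]
    split_ifs with hαG
    · rw [Finset.sum_eq_single_of_mem α hαG]
      · rw [ht.star_mul_self, hcomp α (hGS α hαG), ← ht.star_id, ← star_mul, ht.range_mul]
      · intro μ hμ hne
        rw [ht.star_mul_eq_zero hrf (hGprop μ hμ).1 hα hne, mul_zero, mul_zero]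
    · refine Finset.sum_eq_zero fun μ hμ => ?_
      rw [ht.star_mul_eq_zero hrf (hGprop μ hμ).1 hα fun h => hαG (h ▸ hμ), mul_zero, mul_zero]
  -- Here β need not lie in Λ^{≤N}; its orthogonality to G comes from the separating path τ.
  have hright : ∀ β ∈ S, star (f β) * Q = if β ∈ G then star (f β) else 0 := by
    intro β hβ
    rw [hQsum, Finset.mul_sum]
    split_ifs with hβG
    · rw [Finset.sum_eq_single_of_mem β hβG]
      · rw [← mul_assoc, hfself β hβ, ← ht.star_id, ← star_mul, hfsource β hβ]
      · intro μ hμ hne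
        rw [← mul_assoc, hforth β hβ μ (hGS μ hμ) hne.symm, zero_mul]
    · refine Finset.sum_eq_zero fun μ hμ => ?_
      rw [← mul_assoc, hforth β hβ μ (hGS μ hμ) fun h => hβG (h ▸ hμ), zero_mul]
  have hcompress : Q * (∑ j ∈ F, c j • (t (a j) * star (t (b j)))) * Q = ψ M := by
    rw [hψM, hF', Finset.sum_filter, Finset.mul_sum, Finset.sum_mul]
    refine Finset.sum_congr rfl fun j hj => ?_
    rw [mul_smul_comm, smul_mul_assoc, ← mul_assoc, hleft _ (ha j hj)]
    by_cases haG' : a j ∈ G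
    · have hsa := (hGprop _ haG').2.1
      have hbS : b j ∈ S := Finset.mem_union_right _ (Finset.mem_image_of_mem _
        (Finset.mem_filter.mpr ⟨hj, hsa⟩))
      have h1 : f (a j) * star (t τ) * star (t (b j)) * Q = f (a j) * (star (f (b j)) * Q) := by
        rw [hfstar _ hbS]
        simp only [mul_assoc]
      rw [if_pos haG', h1, hright _ hbS]
      by_cases hbG' : b j ∈ G
      · rw [if_pos hbG', if_pos ⟨hsa, (hGprop _ haG').2.2, (hGprop _ hbG').2.2⟩]
      · rw [if_neg hbG', if_neg, mul_zero, smul_zero]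
        intro h
        exact hbG' (hbG j (Finset.mem_filter.mpr ⟨hj, h⟩))
    · rw [if_neg haG', if_neg, zero_mul, zero_mul, smul_zero]
      intro h
      exact haG' (haG j (Finset.mem_filter.mpr ⟨hj, h⟩))
  have hQ1 : ‖Q‖ ≤ 1 := norm_matrixUnitsHom_one_le
  calc ‖∑ j ∈ F', c j • (g (a j) * star (g (b j)))‖ = ‖φ M‖ := by rw [hφM]
    _ ≤ ‖M‖ := NonUnitalStarAlgHom.norm_apply_le φ M
    _ = ‖ψ M‖ := (NonUnitalStarAlgHom.norm_map ψ hψ M).symm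
    _ = ‖Q * (∑ j ∈ F, c j • (t (a j) * star (t (b j)))) * Q‖ := by rw [hcompress]
    _ ≤ 1 * ‖∑ j ∈ F, c j • (t (a j) * star (t (b j)))‖ * 1 := by
      refine (norm_mul_le _ _).trans (mul_le_mul ((norm_mul_le _ _).trans ?_) hQ1
        (norm_nonneg _) (by positivity))
      exact mul_le_mul_of_nonneg_right hQ1 (norm_nonneg _)
    _ = _ := by rw [one_mul, mul_one]

open Classical in
/-- The norm of the degree-zero part of a linear combination of the `s_μ s_ν^*` is at most the norm
of the image of the combination in any algebra in which all vertex projections are nonzero. -/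
theorem IsCuntzKrieger.norm_degree_zero_part_le (hg : Λ.IsCuntzKrieger g)
    (ht : Λ.IsCuntzKrieger t)
    (hrf : Λ.RowFinite) (hlc : Λ.LocallyConvex) (hB : Λ.ConditionB) (h0 : ∀ v, t (Λ.id v) ≠ 0)
    {J : Type*} (F : Finset J) (a b : J → Λ.Path) (c : J → ℂ) (N : Fin k → ℕ)
    (ha : ∀ j ∈ F, a j ∈ Λ.upTo N (Λ.r (a j)))
    (hb : ∀ j ∈ F, Λ.d (a j) = Λ.d (b j) → b j ∈ Λ.upTo N (Λ.r (b j)))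
    (hs : ∀ j ∈ F, Λ.s (a j) = Λ.s (b j)) :
    ‖∑ j ∈ F with Λ.d (a j) = Λ.d (b j), c j • (g (a j) * star (g (b j)))‖ ≤
      ‖∑ j ∈ F, c j • (t (a j) * star (t (b j)))‖ := by
  set F₀ := F.filter fun j => Λ.d (a j) = Λ.d (b j) with hF₀
  have hfib : ∀ p : Λ.Vertex × (Fin k → ℕ),
      F₀.filter (fun j => (Λ.s (a j), Λ.d (a j)) = p) =
        F.filter fun j => Λ.s (a j) = p.1 ∧ Λ.d (a j) = p.2 ∧ Λ.d (b j) = p.2 := by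
    rintro ⟨v, n⟩
    ext j
    simp only [hF₀, Finset.mem_filter, Prod.mk.injEq]
    constructor
    · rintro ⟨⟨h1, h2⟩, h3, h4⟩
      exact ⟨h1, h3, h4, h2 ▸ h4⟩
    · rintro ⟨h1, h3, h4, h5⟩
      exact ⟨⟨h1, h4.trans h5.symm⟩, h3, h4⟩
  rw [← Finset.sum_fiberwise_of_maps_to (t := F₀.image fun j => (Λ.s (a j), Λ.d (a j)))
    (g := fun j => (Λ.s (a j), Λ.d (a j))) fun j hj => Finset.mem_image_of_mem _ hj]
  -- In different blocks the first paths differ, and so do the second ones. In the degree-zero part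
  -- all of them lie in Λ^{≤N}, so the blocks are orthogonal on both sides and it suffices to bound
  -- each block.
  refine norm_sum_le_of_orthogonal _ (norm_nonneg _) ?_ ?_ fun p _ => ?_
  · intro p q hpq
    rw [star_sum, Finset.sum_mul]
    refine Finset.sum_eq_zero fun i hi => ?_
    rw [Finset.mul_sum]
    refine Finset.sum_eq_zero fun j hj => ?_
    obtain ⟨hi1, rfl⟩ := Finset.mem_filter.mp hi
    obtain ⟨hj1, rfl⟩ := Finset.mem_filter.mp hj
    have hne : a i ≠ a j := fun h => hpq (by rw [h])
    have h := hg.star_mul_eq_zero hrf (ha i (Finset.mem_filter.mp hi1).1)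
      (ha j (Finset.mem_filter.mp hj1).1) hne
    rw [star_smul, smul_mul_smul_comm, star_mul, star_star, mul_assoc,
      ← mul_assoc (star (g (a i))), h, zero_mul, mul_zero, smul_zero]
  · intro p q hpq
    rw [star_sum, Finset.sum_mul]
    refine Finset.sum_eq_zero fun i hi => ?_
    rw [Finset.mul_sum]
    refine Finset.sum_eq_zero fun j hj => ?_
    obtain ⟨hi1, rfl⟩ := Finset.mem_filter.mp hi
    obtain ⟨hj1, rfl⟩ := Finset.mem_filter.mp hj
    obtain ⟨hiF, hid⟩ := Finset.mem_filter.mp hi1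
    obtain ⟨hjF, hjd⟩ := Finset.mem_filter.mp hj1
    have hne : b i ≠ b j := fun h => hpq (by rw [hs i hiF, hs j hjF, hid, hjd, h])
    have h := hg.star_mul_eq_zero hrf (hb i hiF hid) (hb j hjF hjd) hne
    rw [star_smul, smul_mul_smul_comm, star_mul, star_star, mul_assoc,
      ← mul_assoc (star (g (b i))), h, zero_mul, mul_zero, smul_zero]
  · rw [hfib]
    exact hg.norm_block_le ht hrf hlc hB h0 F a b c N ha hb hs p.1 p.2

/-- Every element of the span of the `s_μ s_ν^*` is a linear combination in which every `μ` lies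
in a set `Λ^{≤N}(v)`, and so does `ν` if it has the same degree as `μ`. -/
theorem IsCuntzKrieger.exists_normal_form (hg : Λ.IsCuntzKrieger g) (hrf : Λ.RowFinite) {x : A}
    (hx : x ∈ pairSpan g) : ∃ (N : Fin k → ℕ) (F : Finset (Λ.Path × Λ.Path))
      (c : Λ.Path × Λ.Path → ℂ), (∀ p ∈ F, p.1 ∈ Λ.upTo N (Λ.r p.1)) ∧
      (∀ p ∈ F, Λ.d p.1 = Λ.d p.2 → p.2 ∈ Λ.upTo N (Λ.r p.2)) ∧
      (∀ p ∈ F, Λ.s p.1 = Λ.s p.2) ∧ x = ∑ p ∈ F, c p • (g p.1 * star (g p.2)) := by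
  classical
  obtain ⟨c, rfl⟩ := Finsupp.mem_span_range_iff_exists_finsupp.mp hx
  set N : Fin k → ℕ := ∑ p ∈ c.support, Λ.d p.1 with hN
  let P : Set (Λ.Path × Λ.Path) := {p | p.1 ∈ Λ.upTo N (Λ.r p.1) ∧
    (Λ.d p.1 = Λ.d p.2 → p.2 ∈ Λ.upTo N (Λ.r p.2)) ∧ Λ.s p.1 = Λ.s p.2}
  have hmem : (c.sum fun p z => z • (g p.1 * star (g p.2))) ∈
      Submodule.span ℂ ((fun p : Λ.Path × Λ.Path => g p.1 * star (g p.2)) '' P) := by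
    refine Submodule.sum_mem _ fun p hp => Submodule.smul_mem _ _ ?_
    have hle : Λ.d p.1 ≤ N := Finset.single_le_sum (f := fun p : Λ.Path × Λ.Path => Λ.d p.1)
      (fun _ _ _ => Nat.zero_le _) hp
    by_cases hs : Λ.s p.1 = Λ.s p.2
    -- Appending α ∈ Λ^{≤N−d(μ)} takes μ to level N, and takes ν there too when d(μ) = d(ν). When
    -- the degrees differ nothing is claimed about ν.
    · rw [hg.mul_star_eq_sum hrf hs (N - Λ.d p.1)]
      refine Submodule.sum_mem _ fun α hα => Submodule.subset_span
        ⟨(Λ.cat p.1 α, Λ.cat p.2 α), ⟨?_, fun hd => ?_, ?_⟩, rfl⟩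
      all_goals
        have hα' := hrf.mem_upToFinset.mp hα
        have hr := (mem_upTo_iff.mp hα').1.symm
      · rw [r_cat hr]
        exact cat_mem_upTo hle hα'
      · have hr2 := hs.symm.trans hr
        simp only [d_cat hr, d_cat hr2, add_left_inj] at hd
        rw [r_cat hr2]
        exact cat_mem_upTo (hd ▸ hle) (hd ▸ hs ▸ hα')
      · exact (s_cat hr).trans (s_cat (hs.symm.trans hr)).symm
    · rw [hg.mul_star_eq_zero hs]
      exact zero_mem _
  obtain ⟨l, hl, hlx⟩ := (Finsupp.mem_span_image_iff_linearCombination ℂ).mp hmem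
  have hl' : ∀ p ∈ l.support, p ∈ P := fun p hp => hl hp
  exact ⟨N, l.support, l, fun p hp => (hl' p hp).1, fun p hp => (hl' p hp).2.1,
    fun p hp => (hl' p hp).2.2, hlx.symm⟩

/-- The Cuntz-Krieger uniqueness theorem. -/
theorem CStar.injective_of_conditionB (hrf : Λ.RowFinite) (hlc : Λ.LocallyConvex)
    (hB : Λ.ConditionB) (π : Λ.CStar →⋆ₙₐ[ℂ] B)
    (h0 : ∀ v, π (CStar.gen Λ (Λ.id v)) ≠ 0) : Function.Injective π := by
  classical
  have hg := CStar.isCuntzKrieger_gen hrf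
  have ht := hg.map hrf π
  have hspan : ∀ x ∈ pairSpan (CStar.gen Λ), ‖expectation hrf x‖ ≤ ‖π x‖ := by
    intro x hx
    obtain ⟨N, F, c, ha, hb, hs, rfl⟩ := hg.exists_normal_form hrf hx
    have h := hg.norm_degree_zero_part_le ht hrf hlc hB h0 F Prod.fst Prod.snd c N ha hb hs
    simp only [map_sum, map_smul, expectation_pair, map_mul, map_star]
    rw [Finset.sum_filter] at h
    simpa only [smul_ite, smul_zero] using h
  have hall : ∀ x, ‖expectation hrf x‖ ≤ ‖π x‖ := by
    have h1 : Continuous (expectation hrf) :=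
      AddMonoidHomClass.continuous_of_bound _ 1 fun x => by
        rw [one_mul]; exact norm_expectation_le hrf x
    have h2 : Continuous π := AddMonoidHomClass.continuous_of_bound π 1 fun x => by
      rw [one_mul]; exact NonUnitalStarAlgHom.norm_apply_le π x
    exact fun x => (isClosed_le h1.norm h2.norm).closure_subset_iff.mpr hspan
      (CStar.dense_pairSpan hrf x)
  rw [injective_iff_map_eq_zero]
  intro x hx
  -- The estimate, extended from the dense span by continuity, is applied to x^*x.
  refine eq_zero_of_expectation_star_mul_self hrf (norm_le_zero_iff.mp ?_)
  refine (hall _).trans ?_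
  rw [map_mul, hx, mul_zero, norm_zero]

end Uniqueness

end KGraph

/-! ### Partial isometries of ℓ² from partial bijections -/

namespace PEquiv

section Operator

variable {X : Type u}

/-- Points without a preimage contribute zero and the others have distinct preimages. Hence pulling
back along p keeps a vector in ℓ² and does not increase its norm. -/
theorem sum_elim_le (p : X ≃. X) {h : X → ℝ} (s : Finset X) :
    ∃ s' : Finset X, ∑ y ∈ s, (p.symm y).elim 0 h = ∑ x ∈ s', h x := by
  classical
  refine ⟨s.filterMap p.symm fun a a' b h1 h2 => p.symm.inj h1 h2, ?_⟩
  refine Finset.sum_bij_ne_zero (fun y _ hne => (p.symm y).get ?_) ?_ ?_ ?_ ?_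
  · by_contra hcon
    rw [Option.not_isSome_iff_eq_none] at hcon
    rw [hcon] at hne
    exact hne rfl
  · intro y hy hne
    exact Finset.mem_filterMap _ |>.mpr ⟨y, hy, by simp⟩
  · intro y hy hne y' hy' hne' heq
    exact p.symm.inj (b := (p.symm y).get _) (Option.get_mem _) (by rw [heq]; exact Option.get_mem _)
  · intro x hx hne
    obtain ⟨y, hy, hyx⟩ := (Finset.mem_filterMap _).mp hx
    exact ⟨y, hy, by rw [hyx]; exact hne, by simp [hyx]⟩
  · intro y hy hne
    have hget : ∀ (o : Option X) (ho : o.isSome), o.elim 0 h = h (o.get ho) := by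
      rintro (_ | x) ho
      · cases ho
      · rfl
    exact hget _ _

theorem norm_elim_rpow (o : Option X) (ξ : X → ℂ) :
    ‖o.elim 0 ξ‖ ^ (2 : ℝ≥0∞).toReal = o.elim 0 fun x => ‖ξ x‖ ^ (2 : ℝ≥0∞).toReal := by
  cases o <;> simp

theorem sum_norm_elim_le (p : X ≃. X) (ξ : lp (fun _ : X => ℂ) 2) (s : Finset X) :
    ∑ y ∈ s, ‖(p.symm y).elim 0 ξ‖ ^ (2 : ℝ≥0∞).toReal ≤ ‖ξ‖ ^ (2 : ℝ≥0∞).toReal := by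
  simp only [norm_elim_rpow]
  obtain ⟨s', hs'⟩ := p.sum_elim_le (h := fun x => ‖ξ x‖ ^ (2 : ℝ≥0∞).toReal) s
  rw [hs']
  exact lp.sum_rpow_le_norm_rpow (by simp) ξ s'

/-- The partial isometry of `ℓ²(X)` determined by a partial bijection of `X`. -/
noncomputable def op (p : X ≃. X) :
    lp (fun _ : X => ℂ) 2 →L[ℂ] lp (fun _ : X => ℂ) 2 :=
  LinearMap.mkContinuous
    { toFun := fun ξ => ⟨fun y => (p.symm y).elim 0 ξ, memℓp_gen' (p.sum_norm_elim_le ξ)⟩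
      map_add' := fun ξ η => lp.ext (funext fun y => by
        change (p.symm y).elim 0 ⇑(ξ + η) = (p.symm y).elim 0 ξ + (p.symm y).elim 0 η
        cases p.symm y
        · exact (add_zero _).symm
        · rfl)
      map_smul' := fun c ξ => lp.ext (funext fun y => by
        change (p.symm y).elim 0 ⇑(c • ξ) = c • (p.symm y).elim 0 ξ
        cases p.symm y <;> simp) } 1 fun ξ => by
    rw [one_mul]
    exact lp.norm_le_of_forall_sum_le (by simp) (norm_nonneg _) (p.sum_norm_elim_le ξ)

theorem op_apply (p : X ≃. X) (ξ : lp (fun _ : X => ℂ) 2) (y : X) :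
    p.op ξ y = (p.symm y).elim 0 ξ := rfl

theorem op_trans (p q : X ≃. X) : (p.trans q).op = q.op * p.op := by
  ext ξ y
  change ((p.trans q).symm y).elim 0 ξ = (q.symm y).elim 0 (p.op ξ)
  rw [symm_trans_rev]
  change ((q.symm y).bind p.symm).elim 0 ξ = _
  cases q.symm y <;> simp [op_apply]

/-- Coordinates are inner products with basis vectors, and the operator sends δ_x to δ_{p(x)}, or to
0 where p is undefined. -/
theorem star_op (p : X ≃. X) : star p.op = p.symm.op := by
  classical
  ext η x
  have h1 : (star p.op) η x = inner ℂ (lp.single (E := fun _ : X => ℂ) 2 x 1) ((star p.op) η) := by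
    rw [lp.inner_single_left]
    simp
  rw [h1, ContinuousLinearMap.star_eq_adjoint, ContinuousLinearMap.adjoint_inner_right, op_apply,
    symm_symm]
  have h2 : p.op (lp.single 2 x 1) = (p x).elim 0 fun y => lp.single 2 y 1 := by
    ext y
    rw [op_apply]
    cases hx : p x with
    | none =>
      cases hy : p.symm y with
      | none => rfl
      | some x' =>
        have : x' ≠ x := by
          rintro rfl
          rw [p.eq_some_iff, hx] at hy
          exact absurd hy (by simp)
        simp [lp.single_apply, this]
    | some y' =>
      cases hy : p.symm y with
      | none =>
        have : y ≠ y' := by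
          rintro rfl
          rw [← p.eq_some_iff, hy] at hx
          exact absurd hx (by simp)
        simp [lp.single_apply, this]
      | some x' =>
        rw [p.eq_some_iff] at hy
        by_cases hxx : x' = x
        · subst hxx
          obtain rfl : y' = y := by simpa [hx] using hy
          simp [lp.single_apply]
        · have : y ≠ y' := by
            rintro rfl
            exact hxx (p.inj (Option.mem_def.mpr hy) (Option.mem_def.mpr hx))
          simp [lp.single_apply, this, hxx]
  rw [h2]
  cases p x with
  | none => simp
  | some y => simp [lp.inner_single_left]

theorem op_ofSet_apply (s : Set X) [DecidablePred (· ∈ s)] (ξ : lp (fun _ : X => ℂ) 2) (y : X) :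
    (ofSet s).op ξ y = if y ∈ s then ξ y else 0 := by
  rw [op_apply, ofSet_symm]
  change (if y ∈ s then some y else none).elim 0 ξ = _
  split_ifs <;> rfl

end Operator

end PEquiv

/-! ### The boundary path representation -/

namespace KGraph

section Representation

variable {k : ℕ} {Λ : KGraph.{u} k}

namespace BoundaryThread

theorem root_concat (hlc : Λ.LocallyConvex) {α : Λ.Path} {x : Λ.BoundaryThread}
    (h : Λ.s α = x.root) : (x.concat hlc α h).root = Λ.r α :=
  (Λ.r_head _ _).trans (r_cat (h.trans (x.r_seg 0).symm))

theorem concat_seg (hlc : Λ.LocallyConvex) {α : Λ.Path} {x : Λ.BoundaryThread}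
    (h : Λ.s α = x.root) (M : Fin k → ℕ) :
    (x.concat hlc α h).seg (Λ.d α + M) = Λ.cat α (x.seg M) := by
  have hr := fun N => h.trans (x.r_seg N).symm
  change Λ.head (Λ.cat α (x.seg (Λ.d α + M))) (Λ.d α + M) = _
  rw [← head_cat_head (hr _) (le_refl (Λ.d α + M)),
    x.head_seg (le_add_of_nonneg_left fun _ => Nat.zero_le _), head_of_le]
  rw [d_cat (hr _)]
  exact add_le_add_right (mem_upTo_iff.mp (x.seg_mem M)).2.1 _

theorem concat_injective (hlc : Λ.LocallyConvex) {α : Λ.Path} {x y : Λ.BoundaryThread}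
    (hx : Λ.s α = x.root) (hy : Λ.s α = y.root)
    (h : x.concat hlc α hx = y.concat hlc α hy) : x = y := by
  refine ext' fun M => ?_
  have h1 := concat_seg hlc hx M
  rw [h, concat_seg, cat_eq (hx.trans (x.r_seg M).symm), cat_eq (hy.trans (y.r_seg M).symm)] at h1
  exact (comp_left_cancel h1).symm

theorem concat_id (hlc : Λ.LocallyConvex) (x : Λ.BoundaryThread)
    (h : Λ.s (Λ.id x.root) = x.root) : x.concat hlc (Λ.id x.root) h = x := by
  refine ext' fun M => ?_
  have h1 : Λ.cat (Λ.id x.root) (x.seg M) = x.seg M := by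
    have := Λ.id_comp (x.seg M)
    rw [cat_eq (h.trans (x.r_seg M).symm)]
    convert this using 2
    rw [x.r_seg M]
  change Λ.head (Λ.cat (Λ.id x.root) (x.seg M)) M = _
  rw [h1, x.head_seg le_rfl]

theorem concat_comp (hlc : Λ.LocallyConvex) {α β : Λ.Path} (x : Λ.BoundaryThread)
    (h : Λ.s α = Λ.r β) (hx : Λ.s β = x.root) :
    (x.concat hlc β hx).concat hlc α (h.trans (root_concat hlc hx).symm) =
      x.concat hlc (Λ.comp α β h) ((Λ.s_comp _ _ _).trans hx) := by
  refine ext' fun M => ?_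
  have hr := hx.trans (x.r_seg M).symm
  change Λ.head (Λ.cat α (Λ.head (Λ.cat β (x.seg M)) M)) M =
    Λ.head (Λ.cat (Λ.comp α β h) (x.seg M)) M
  rw [head_cat_head_self (h.trans (r_cat hr).symm), cat_eq (h.trans (r_cat hr).symm),
    cat_eq ((Λ.s_comp _ _ _).trans hr), Λ.assoc _ _ _ _ hr]
  congr 1
  exact comp_congr rfl (cat_eq hr)

/-- The segment indexed by m may have degree smaller than m; removing an initial segment must use
this actual degree. -/
theorem seg_eq_seg (x : Λ.BoundaryThread) (m : Fin k → ℕ) :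
    x.seg (Λ.d (x.seg m)) = x.seg m := by
  rw [← x.head_seg (mem_upTo_iff.mp (x.seg_mem m)).2.1, head_of_le le_rfl]

theorem head_seg_add (x : Λ.BoundaryThread) (m M : Fin k → ℕ) :
    Λ.head (x.seg (Λ.d (x.seg m) + M)) (Λ.d (x.seg m)) = x.seg m := by
  rw [x.head_seg le_self_add, seg_eq_seg]

/-- The boundary path which remains after removing the initial segment `x.seg m`. -/
noncomputable def shift (x : Λ.BoundaryThread) (m : Fin k → ℕ) : Λ.BoundaryThread where
  seg M := Λ.tail (x.seg (Λ.d (x.seg m) + M)) (Λ.d (x.seg m))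
  head_seg {M N} h := by
    have := comp_head_tail_head (x.seg (Λ.d (x.seg m) + N))
      (m := Λ.d (x.seg m)) (n := Λ.d (x.seg m) + M) le_self_add
    rw [x.head_seg (add_le_add_right h _), add_tsub_cancel_left] at this
    exact this.symm
  seg_mem M := by
    have h := mem_upTo_iff.mp (x.seg_mem (Λ.d (x.seg m) + M))
    rw [mem_upTo_iff, Λ.d_tail, Λ.s_tail]
    refine ⟨rfl, tsub_le_iff_left.mpr h.2.1, fun i hi => h.2.2 i ?_⟩
    simp only [Pi.sub_apply] at hi
    simp only [Pi.add_apply]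
    omega

theorem root_shift (x : Λ.BoundaryThread) (m : Fin k → ℕ) :
    Λ.s (x.seg m) = (x.shift m).root := by
  conv_lhs => rw [← x.head_seg_add m 0]
  exact Λ.s_head _ _

theorem concat_shift (hlc : Λ.LocallyConvex) (x : Λ.BoundaryThread) (m : Fin k → ℕ) :
    (x.shift m).concat hlc (x.seg m) (x.root_shift m) = x := by
  refine ext' fun M => ?_
  change Λ.head (Λ.cat (x.seg m) (Λ.tail (x.seg (Λ.d (x.seg m) + M)) (Λ.d (x.seg m)))) M = _
  have h := x.head_seg_add m M
  have h1 : Λ.cat (x.seg m) (Λ.tail (x.seg (Λ.d (x.seg m) + M)) (Λ.d (x.seg m))) =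
      x.seg (Λ.d (x.seg m) + M) := by
    have hr : Λ.s (x.seg m) = Λ.r (Λ.tail (x.seg (Λ.d (x.seg m) + M)) (Λ.d (x.seg m))) := by
      rw [← Λ.s_head, h]
    rw [cat_eq hr]
    conv_rhs => rw [← Λ.head_tail (x.seg (Λ.d (x.seg m) + M)) (Λ.d (x.seg m))]
    exact comp_congr h.symm rfl
  rw [h1, x.head_seg (le_add_of_nonneg_left fun _ => Nat.zero_le _)]

/-- A path in Λ^{≤m} is maximal within degree m, so no part of x can extend it there. -/
theorem seg_concat_eq (hlc : Λ.LocallyConvex) {α : Λ.Path} {x : Λ.BoundaryThread}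
    (h : Λ.s α = x.root) {m : Fin k → ℕ} (hα : α ∈ Λ.upTo m (Λ.r α)) :
    (x.concat hlc α h).seg m = α := by
  set y := x.concat hlc α h with hy
  have hr := h.trans (x.r_seg (Λ.d α)).symm
  have h1 : Λ.head (y.seg m) (Λ.d α) = α := by
    rw [y.head_seg (mem_upTo_iff.mp hα).2.1]
    change Λ.head (Λ.cat α (x.seg (Λ.d α))) (Λ.d α) = α
    rw [cat_eq hr, head_comp]
  have hroot : Λ.r α = y.root := (root_concat hlc h).symm
  have h2 := hlc.eq_head_of_mem_upTo le_rfl (hroot ▸ hα) (y.seg_mem' m) h1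
  rwa [y.head_seg le_rfl] at h2

end BoundaryThread

open Classical in
/-- The partial bijection `x ↦ αx` of the set of boundary paths. -/
noncomputable def concatPEquiv (hlc : Λ.LocallyConvex) (α : Λ.Path) :
    Λ.BoundaryThread ≃. Λ.BoundaryThread where
  toFun x := if h : Λ.s α = x.root then some (x.concat hlc α h) else none
  invFun y := if h : ∃ x : Λ.BoundaryThread, ∃ h : Λ.s α = x.root, x.concat hlc α h = y then
    some h.choose else none
  inv x y := by
    constructor
    · intro hx
      rw [Option.dite_none_right_eq_some] at hx
      obtain ⟨h, hx⟩ := hx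
      obtain ⟨h1, h2⟩ := h.choose_spec
      obtain rfl : h.choose = x := Option.some_injective _ hx
      rw [dif_pos h1, h2]
    · intro hy
      rw [Option.dite_none_right_eq_some] at hy
      obtain ⟨h, hy⟩ := hy
      have hy' : x.concat hlc α h = y := Option.some_injective _ hy
      have hex : ∃ x : Λ.BoundaryThread, ∃ h : Λ.s α = x.root, x.concat hlc α h = y := ⟨x, h, hy'⟩
      rw [dif_pos hex]
      obtain ⟨h1, h2⟩ := hex.choose_spec
      exact congrArg some (BoundaryThread.concat_injective hlc h1 h (h2.trans hy'.symm))

theorem mem_concatPEquiv (hlc : Λ.LocallyConvex) {α : Λ.Path} {x y : Λ.BoundaryThread} :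
    concatPEquiv hlc α x = some y ↔ ∃ h : Λ.s α = x.root, x.concat hlc α h = y := by
  classical
  change (dite (Λ.s α = x.root) _ _ = some y) ↔ _
  rw [Option.dite_none_right_eq_some]
  simp

theorem concatPEquiv_isSome (hlc : Λ.LocallyConvex) {α : Λ.Path} {x : Λ.BoundaryThread} :
    (concatPEquiv hlc α x).isSome ↔ Λ.s α = x.root := by
  rw [Option.isSome_iff_exists]
  simp only [mem_concatPEquiv]
  exact ⟨fun ⟨_, h, _⟩ => h, fun h => ⟨_, h, rfl⟩⟩

/-- The range of x ↦ αx is a cylinder set, and each boundary path lies in exactly one cylinder of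
level m. The Cuntz–Krieger sum relation follows from this. -/
theorem concatPEquiv_symm_isSome (hlc : Λ.LocallyConvex) {α : Λ.Path} {y : Λ.BoundaryThread}
    {m : Fin k → ℕ} (hα : α ∈ Λ.upTo m (Λ.r α)) :
    ((concatPEquiv hlc α).symm y).isSome ↔ α = y.seg m := by
  rw [Option.isSome_iff_exists]
  simp only [PEquiv.eq_some_iff, mem_concatPEquiv]
  constructor
  · rintro ⟨x, h, rfl⟩
    exact (BoundaryThread.seg_concat_eq hlc h hα).symm
  · rintro rfl
    exact ⟨_, _, y.concat_shift hlc m⟩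

open Classical in
theorem concatPEquiv_id (hlc : Λ.LocallyConvex) (v : Λ.Vertex) :
    concatPEquiv hlc (Λ.id v) = PEquiv.ofSet {x | x.root = v} := by
  ext x y
  rw [mem_concatPEquiv, PEquiv.ofSet_eq_some_iff]
  constructor
  · rintro ⟨h, rfl⟩
    rw [Λ.s_id] at h
    subst h
    exact ⟨x.concat_id hlc _, by simpa using (x.root_concat hlc (Λ.s_id _)).trans (Λ.r_id _)⟩
  · rintro ⟨rfl, hx⟩
    obtain rfl : y.root = v := hx
    exact ⟨Λ.s_id _, y.concat_id hlc _⟩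

theorem concatPEquiv_comp (hlc : Λ.LocallyConvex) {α β : Λ.Path} (h : Λ.s α = Λ.r β) :
    concatPEquiv hlc (Λ.comp α β h) = (concatPEquiv hlc β).trans (concatPEquiv hlc α) := by
  ext x y
  rw [mem_concatPEquiv, PEquiv.trans_eq_some]
  simp only [mem_concatPEquiv]
  constructor
  · rintro ⟨hx, rfl⟩
    rw [Λ.s_comp] at hx
    exact ⟨_, ⟨hx, rfl⟩, h.trans (x.root_concat hlc hx).symm, x.concat_comp hlc h hx⟩
  · rintro ⟨_, ⟨hx, rfl⟩, h', rfl⟩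
    exact ⟨(Λ.s_comp _ _ _).trans hx, (x.concat_comp hlc h hx).symm⟩

/-- The boundary path representation. -/
noncomputable def boundaryFam (hlc : Λ.LocallyConvex) (α : Λ.Path) :
    lp (fun _ : Λ.BoundaryThread => ℂ) 2 →L[ℂ] lp (fun _ : Λ.BoundaryThread => ℂ) 2 :=
  (concatPEquiv hlc α).op

theorem boundaryFam_comp (hlc : Λ.LocallyConvex) {α β : Λ.Path} (h : Λ.s α = Λ.r β) :
    boundaryFam hlc (Λ.comp α β h) = boundaryFam hlc α * boundaryFam hlc β := by
  rw [boundaryFam, concatPEquiv_comp hlc h, PEquiv.op_trans]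
  rfl

theorem boundaryFam_star_mul_self (hlc : Λ.LocallyConvex) (α : Λ.Path) :
    star (boundaryFam hlc α) * boundaryFam hlc α = boundaryFam hlc (Λ.id (Λ.s α)) := by
  classical
  rw [boundaryFam, boundaryFam, PEquiv.star_op, ← PEquiv.op_trans, PEquiv.self_trans_symm,
    concatPEquiv_id]
  congr 2
  ext x
  exact (concatPEquiv_isSome hlc).trans eq_comm

open Classical in
theorem boundaryFam_id_apply (hlc : Λ.LocallyConvex) (v : Λ.Vertex)
    (ξ : lp (fun _ : Λ.BoundaryThread => ℂ) 2) (y : Λ.BoundaryThread) :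
    boundaryFam hlc (Λ.id v) ξ y = if y.root = v then ξ y else 0 := by
  rw [boundaryFam, concatPEquiv_id, PEquiv.op_ofSet_apply]
  rfl

open Classical in
theorem boundaryFam_mul_star_apply (hlc : Λ.LocallyConvex) {α : Λ.Path} {m : Fin k → ℕ}
    (hα : α ∈ Λ.upTo m (Λ.r α)) (ξ : lp (fun _ : Λ.BoundaryThread => ℂ) 2)
    (y : Λ.BoundaryThread) :
    (boundaryFam hlc α * star (boundaryFam hlc α)) ξ y = if α = y.seg m then ξ y else 0 := by
  rw [boundaryFam, PEquiv.star_op, ← PEquiv.op_trans, PEquiv.symm_trans_self,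
    PEquiv.op_ofSet_apply]
  exact if_congr (concatPEquiv_symm_isSome hlc hα) rfl rfl

theorem boundaryFam_isCuntzKrieger (hlc : Λ.LocallyConvex) (hrf : Λ.RowFinite) :
    Λ.IsCuntzKrieger (boundaryFam hlc) where
  partialIsometry α := by
    rw [mul_assoc, boundaryFam_star_mul_self, ← boundaryFam_comp hlc (Λ.r_id _).symm, Λ.comp_id]
  projection v := by
    have h := boundaryFam_star_mul_self hlc (Λ.id v)
    rw [Λ.s_id] at h
    have h1 : star (boundaryFam hlc (Λ.id v)) = boundaryFam hlc (Λ.id v) := by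
      rw [← h, star_mul, star_star]
    rw [h1] at h
    exact ⟨h, h1⟩
  orthogonal v w hvw := by
    classical
    ext ξ y
    change boundaryFam hlc (Λ.id v) (boundaryFam hlc (Λ.id w) ξ) y = 0
    rw [boundaryFam_id_apply, boundaryFam_id_apply]
    split_ifs with h1 h2
    · exact absurd (h1.symm.trans h2) hvw
    all_goals rfl
  map_comp α β h := boundaryFam_comp hlc h
  star_mul_self := boundaryFam_star_mul_self hlc
  sum_upTo v m := by
    classical
    rw [finsum_mem_eq_finite_toFinset_sum _ (hrf.finite_upTo m v)]
    ext ξ y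
    rw [boundaryFam_id_apply, sum_apply, lp.coeFn_sum, Finset.sum_apply]
    have hterm : ∀ α ∈ (hrf.finite_upTo m v).toFinset,
        (boundaryFam hlc α * star (boundaryFam hlc α)) ξ y =
          if α = y.seg m then ξ y else 0 := fun α hα => by
      have hα' := (hrf.finite_upTo m v).mem_toFinset.mp hα
      exact boundaryFam_mul_star_apply hlc ((mem_upTo_iff.mp hα').1.symm ▸ hα') ξ y
    -- At a given y only α = `y.seg m` contributes, and it belongs to Λ^{≤m}(v) exactly when y
    -- starts at v.
    rw [Finset.sum_congr rfl hterm, Finset.sum_ite_eq']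
    refine if_congr ?_ rfl rfl
    rw [Set.Finite.mem_toFinset]
    constructor
    · rintro rfl
      exact y.seg_mem' m
    · intro h
      rw [← y.r_seg m]
      exact (mem_upTo_iff.mp h).1

/-- Only the existence of a boundary path x at v is taken from condition (B); the projection fixes
δ_x. -/
theorem boundaryFam_id_ne_zero (hlc : Λ.LocallyConvex) (hB : Λ.ConditionB) (v : Λ.Vertex) :
    boundaryFam hlc (Λ.id v) ≠ 0 := by
  classical
  obtain ⟨x, hx, -⟩ := hB.exists_thread v
  intro h
  have h1 := boundaryFam_id_apply hlc v (lp.single 2 x 1) x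
  rw [h, if_pos hx] at h1
  simp at h1

end Representation

end KGraph

/-! ### The graph Γ(Λ∖H) and its Cuntz–Krieger families -/

namespace KGraph

section Quotient

variable {k : ℕ} {Λ : KGraph.{u} k}

theorem eq_zero_or_eq_e {n : Fin k → ℕ} {i : Fin k} (h : n ≤ e i) : n = 0 ∨ n = e i := by
  have hj : ∀ j, j ≠ i → n j = 0 := fun j hji => by
    have := h j
    rw [e_of_ne hji] at this
    exact Nat.le_zero.mp this
  have hi : n i ≤ 1 := by
    have := h i
    rwa [e_same] at this
  rcases Nat.le_one_iff_eq_zero_or_eq_one.mp hi with hi | hi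
  · refine Or.inl (funext fun j => ?_)
    by_cases hji : j = i
    · rw [hji, hi]
      rfl
    · exact hj j hji
  · refine Or.inr (funext fun j => ?_)
    by_cases hji : j = i
    · rw [hji, hi, e_same]
    · rw [hj j hji, e_of_ne hji]

/-- If v has an i-edge, then Λ^{≤e_i}(v) consists of i-edges only, so saturation forbids all their
sources to lie in H. Thus passing to Γ(Λ∖H) creates no new dead ends. -/
theorem Saturated.exists_pathsAt {H : Set Λ.Vertex} (hsat : Λ.Saturated H) {v : Λ.Vertex}
    (hv : v ∉ H) {i : Fin k} (hne : (Λ.pathsAt (e i) v).Nonempty) :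
    ∃ μ ∈ Λ.pathsAt (e i) v, Λ.s μ ∉ H := by
  by_contra! hcon
  refine hv (hsat v ⟨i, fun μ hμ => ?_⟩)
  obtain ⟨h1, h2, h3⟩ := mem_upTo_iff.mp hμ
  rcases eq_zero_or_eq_e h2 with h4 | h4
  · have h5 := h3 i (by rw [h4, e_same]; exact one_pos)
    rw [eq_id_of_d_eq_zero h4, Λ.s_id, h1] at h5
    exact absurd h5 hne.ne_empty
  · exact hcon μ ⟨h4, h1⟩

variable {H : Set Λ.Vertex} (hher : Λ.Hereditary H)

theorem quotientGraph_mem_pathsAt {m : Fin k → ℕ} {v : (Λ.quotientGraph H hher).Vertex}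
    {μ : (Λ.quotientGraph H hher).Path} :
    μ ∈ (Λ.quotientGraph H hher).pathsAt m v ↔ μ.1 ∈ Λ.pathsAt m v.1 :=
  and_congr Iff.rfl Subtype.ext_iff

theorem quotientGraph_pathsAt_nonempty (hsat : Λ.Saturated H) {i : Fin k}
    {v : (Λ.quotientGraph H hher).Vertex} :
    ((Λ.quotientGraph H hher).pathsAt (e i) v).Nonempty ↔ (Λ.pathsAt (e i) v.1).Nonempty := by
  constructor
  · rintro ⟨μ, hμ⟩
    exact ⟨μ.1, (quotientGraph_mem_pathsAt hher).mp hμ⟩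
  · intro h
    obtain ⟨μ, hμ, hs⟩ := hsat.exists_pathsAt v.2 h
    exact ⟨⟨μ, hs⟩, (quotientGraph_mem_pathsAt hher).mpr hμ⟩

theorem quotientGraph_mem_upTo (hsat : Λ.Saturated H) {m : Fin k → ℕ}
    {v : (Λ.quotientGraph H hher).Vertex} {μ : (Λ.quotientGraph H hher).Path} :
    μ ∈ (Λ.quotientGraph H hher).upTo m v ↔ μ.1 ∈ Λ.upTo m v.1 := by
  rw [mem_upTo_iff, mem_upTo_iff]
  refine and_congr Subtype.ext_iff (and_congr Iff.rfl (forall_congr' fun i =>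
    forall_congr' fun _ => ?_))
  rw [← Set.not_nonempty_iff_eq_empty, ← Set.not_nonempty_iff_eq_empty,
    quotientGraph_pathsAt_nonempty hher hsat]
  rfl

theorem RowFinite.quotientGraph (hrf : Λ.RowFinite) : (Λ.quotientGraph H hher).RowFinite :=
  fun v m => ((hrf v.1 m).preimage Subtype.val_injective.injOn).subset fun _ hμ =>
    (quotientGraph_mem_pathsAt hher).mp hμ

theorem LocallyConvex.quotientGraph (hlc : Λ.LocallyConvex) (hsat : Λ.Saturated H) :
    (Λ.quotientGraph H hher).LocallyConvex := by
  intro v i j hij μ hμ ν hν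
  have := hlc v.1 i j hij μ.1 ((quotientGraph_mem_pathsAt hher).mp hμ) ν.1
    ((quotientGraph_mem_pathsAt hher).mp hν)
  exact ⟨(quotientGraph_pathsAt_nonempty hher hsat).mpr this.1,
    (quotientGraph_pathsAt_nonempty hher hsat).mpr this.2⟩

variable {B : Type v} [NonUnitalCStarAlgebra B]

open Classical in
/-- The extension by zero of a family indexed by the paths of `Γ(Λ ∖ H)`. -/
noncomputable def extendFam (t : (Λ.quotientGraph H hher).Path → B) (μ : Λ.Path) : B :=
  if h : Λ.s μ ∉ H then t ⟨μ, h⟩ else 0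

variable {t : (Λ.quotientGraph H hher).Path → B}

theorem extendFam_of_notMem {μ : Λ.Path} (h : Λ.s μ ∉ H) : extendFam hher t μ = t ⟨μ, h⟩ :=
  dif_pos h

theorem extendFam_of_mem {μ : Λ.Path} (h : Λ.s μ ∈ H) : extendFam hher t μ = 0 :=
  dif_neg (not_not.mpr h)

theorem extendFam_id {v : Λ.Vertex} (h : v ∉ H) :
    extendFam hher t (Λ.id v) = t ((Λ.quotientGraph H hher).id ⟨v, h⟩) :=
  extendFam_of_notMem hher (by rwa [Λ.s_id])

theorem extendFam_id_of_mem {v : Λ.Vertex} (h : v ∈ H) : extendFam hher t (Λ.id v) = 0 :=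
  extendFam_of_mem hher (by rwa [Λ.s_id])

/-- For v ∈ H heredity makes every term of the sum relation vanish. For v ∉ H the surviving terms
are those with source outside H, and by saturation these are the paths of the corresponding set in
Γ(Λ∖H). -/
theorem IsCuntzKrieger.extend (hrf : Λ.RowFinite) (hsat : Λ.Saturated H)
    (ht : (Λ.quotientGraph H hher).IsCuntzKrieger t) :
    Λ.IsCuntzKrieger (extendFam hher t) where
  partialIsometry μ := by
    by_cases h : Λ.s μ ∈ H
    · rw [extendFam_of_mem hher h, mul_zero]
    · rw [extendFam_of_notMem hher h]
      exact ht.partialIsometry _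
  projection v := by
    by_cases h : v ∈ H
    · rw [extendFam_id_of_mem hher h]
      exact IsStarProjection.zero _
    · rw [extendFam_id hher h]
      exact ht.projection _
  orthogonal v w hne := by
    by_cases hv : v ∈ H
    · rw [extendFam_id_of_mem hher hv, zero_mul]
    · by_cases hw : w ∈ H
      · rw [extendFam_id_of_mem hher hw, mul_zero]
      · rw [extendFam_id hher hv, extendFam_id hher hw]
        exact ht.orthogonal _ _ fun h => hne (congrArg Subtype.val h)
  map_comp μ ν h := by
    by_cases hν : Λ.s ν ∈ H
    · rw [extendFam_of_mem hher hν, mul_zero, extendFam_of_mem hher (by rwa [Λ.s_comp])]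
    · have hμ : Λ.s μ ∉ H := fun hμ => hν (hher _ _ ⟨ν, h.symm, rfl⟩ hμ)
      rw [extendFam_of_notMem hher hν, extendFam_of_notMem hher hμ,
        extendFam_of_notMem hher (by rwa [Λ.s_comp])]
      exact ht.map_comp ⟨μ, hμ⟩ ⟨ν, hν⟩ (Subtype.ext h)
  star_mul_self μ := by
    by_cases h : Λ.s μ ∈ H
    · rw [extendFam_of_mem hher h, mul_zero, extendFam_id_of_mem hher h]
    · rw [extendFam_of_notMem hher h, extendFam_id hher h]
      exact ht.star_mul_self _
  sum_upTo v m := by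
    rw [finsum_mem_eq_finite_toFinset_sum _ (hrf.finite_upTo m v)]
    by_cases h : v ∈ H
    · rw [extendFam_id_of_mem hher h, Finset.sum_eq_zero]
      intro μ hμ
      have hr := (mem_upTo_iff.mp ((hrf.finite_upTo m v).mem_toFinset.mp hμ)).1
      rw [extendFam_of_mem hher (hher _ _ ⟨μ, hr, rfl⟩ h), zero_mul]
    · refine (extendFam_id hher h).trans ((ht.sum_upToFinset (hrf.quotientGraph hher)
        ⟨v, h⟩ m).symm.trans (Finset.sum_of_injOn Subtype.val Subtype.val_injective.injOn ?_ ?_ ?_))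
      · intro μ hμ
        exact (hrf.finite_upTo m v).mem_toFinset.mpr ((quotientGraph_mem_upTo hher hsat).mp
          ((hrf.quotientGraph hher).mem_upToFinset.mp hμ))
      · intro μ hμ hne
        by_cases hs : Λ.s μ ∈ H
        · rw [extendFam_of_mem hher hs, zero_mul]
        · refine absurd ⟨⟨μ, hs⟩, ?_, rfl⟩ hne
          exact (hrf.quotientGraph hher).mem_upToFinset.mpr ((quotientGraph_mem_upTo hher hsat).mpr
            ((hrf.finite_upTo m v).mem_toFinset.mp hμ))
      · intro μ _
        rw [extendFam_of_notMem hher μ.2]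
        rfl

theorem IsCuntzKrieger.eq_zero_of_source_mem {t : Λ.Path → B} (ht : Λ.IsCuntzKrieger t)
    (h0 : ∀ v ∈ H, t (Λ.id v) = 0) {μ : Λ.Path} (h : Λ.s μ ∈ H) : t μ = 0 := by
  rw [← ht.mul_source μ, h0 _ h, mul_zero]

theorem IsCuntzKrieger.restrict (hrf : Λ.RowFinite) (hsat : Λ.Saturated H) {t : Λ.Path → B}
    (ht : Λ.IsCuntzKrieger t) (h0 : ∀ v ∈ H, t (Λ.id v) = 0) :
    (Λ.quotientGraph H hher).IsCuntzKrieger fun μ => t μ.1 where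
  partialIsometry μ := ht.partialIsometry _
  projection v := ht.projection _
  orthogonal v w hne := ht.orthogonal _ _ fun h => hne (Subtype.ext h)
  map_comp μ ν h := ht.map_comp _ _ _
  star_mul_self μ := ht.star_mul_self _
  sum_upTo v m := by
    have hrf' := hrf.quotientGraph hher
    rw [finsum_mem_eq_finite_toFinset_sum _ (hrf'.finite_upTo m v)]
    refine (ht.sum_upToFinset hrf v.1 m).symm.trans (Finset.sum_of_injOn
      Subtype.val Subtype.val_injective.injOn ?_ ?_ ?_).symm
    · intro μ hμ
      exact hrf.mem_upToFinset.mpr ((quotientGraph_mem_upTo hher hsat).mp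
        ((hrf'.finite_upTo m v).mem_toFinset.mp hμ))
    · intro μ hμ hne
      by_cases hs : Λ.s μ ∈ H
      · rw [ht.eq_zero_of_source_mem h0 hs, zero_mul]
      · refine absurd ⟨⟨μ, hs⟩, ?_, rfl⟩ hne
        exact (hrf'.finite_upTo m v).mem_toFinset.mpr ((quotientGraph_mem_upTo hher hsat).mpr
          (hrf.mem_upToFinset.mp hμ))
    · intro μ _
      rfl

end Quotient

/-! ### Ideals and their vertex sets -/

section Ideals

variable {k : ℕ} {Λ : KGraph.{u} k}

/-- The vertices whose projection lies in the ideal `I`. -/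
def vertexSet (I : ClosedIdeal Λ.CStar) : Set Λ.Vertex := {v | CStar.gen Λ (Λ.id v) ∈ I.1}

theorem vertexSet_hereditary (hrf : Λ.RowFinite) (I : ClosedIdeal Λ.CStar) :
    Λ.Hereditary (vertexSet I) := by
  rintro _ _ ⟨μ, rfl, rfl⟩ hv
  have hg := CStar.isCuntzKrieger_gen hrf
  change CStar.gen Λ (Λ.id (Λ.s μ)) ∈ I.1
  rw [← hg.star_mul_self, ← hg.range_mul μ]
  exact (I.2.2 _ _ (I.2.2 _ _ hv).2).1

theorem vertexSet_saturated (hrf : Λ.RowFinite) (I : ClosedIdeal Λ.CStar) :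
    Λ.Saturated (vertexSet I) := by
  rintro v ⟨i, hi⟩
  have hg := CStar.isCuntzKrieger_gen hrf
  change CStar.gen Λ (Λ.id v) ∈ I.1
  rw [← hg.sum_upToFinset hrf v (e i)]
  refine Submodule.sum_mem _ fun μ hμ => ?_
  have := hi μ (hrf.mem_upToFinset.mp hμ)
  rw [← hg.mul_source μ]
  exact (I.2.2 _ _ (I.2.2 _ _ this).1).2

theorem gen_mem_idealOf {H : Set Λ.Vertex} {v : Λ.Vertex} (hv : v ∈ H) :
    CStar.gen Λ (Λ.id v) ∈ (Λ.idealOf H).1 := by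
  change _ ∈ ⨅ I ∈ {I : ClosedIdeal Λ.CStar | ∀ v ∈ H, CStar.gen Λ (Λ.id v) ∈ I.1}, I.1
  simp only [Submodule.mem_iInf]
  exact fun I hI => hI v hv

theorem idealOf_le {H : Set Λ.Vertex} {I : ClosedIdeal Λ.CStar}
    (h : ∀ v ∈ H, CStar.gen Λ (Λ.id v) ∈ I.1) : Λ.idealOf H ≤ I := sInf_le h

theorem vertexSet_idealOf (hrf : Λ.RowFinite) (hlc : Λ.LocallyConvex) {H : Set Λ.Vertex}
    (hsat : Λ.Saturated H) (hher : Λ.Hereditary H)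
    (hB : (Λ.quotientGraph H hher).ConditionB) : vertexSet (Λ.idealOf H) = H := by
  refine Set.Subset.antisymm (fun v hv => ?_) fun v hv => gen_mem_idealOf hv
  by_contra hvH
  have hlc' := hlc.quotientGraph hher hsat
  have ht := boundaryFam_isCuntzKrieger hlc' (hrf.quotientGraph hher)
  obtain ⟨φ, hφ, -⟩ := CStar.existsUnique_lift hrf (ht.extend hher hrf hsat)
  -- The kernel of the extended boundary path representation contains I_H but not s_v.
  have hle : Λ.idealOf H ≤ φ.kerClosedIdeal := idealOf_le fun w hw => by
    rw [φ.mem_kerClosedIdeal, hφ, extendFam_id_of_mem hher hw]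
  have h1 := φ.mem_kerClosedIdeal.mp (hle hv)
  rw [hφ, extendFam_id hher hvH] at h1
  exact boundaryFam_id_ne_zero hlc' hB _ h1

theorem le_idealOf_vertexSet (hrf : Λ.RowFinite) (hlc : Λ.LocallyConvex)
    (I : ClosedIdeal Λ.CStar)
    (hB : (Λ.quotientGraph (vertexSet I) (vertexSet_hereditary hrf I)).ConditionB) :
    I ≤ Λ.idealOf (vertexSet I) := by
  have hher := vertexSet_hereditary hrf I
  have hsat := vertexSet_saturated hrf I
  have hlc' := hlc.quotientGraph hher hsat
  have hrf' := hrf.quotientGraph hher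
  have hg := CStar.isCuntzKrieger_gen hrf
  obtain ⟨Ψ, hΨ, -⟩ := CStar.existsUnique_lift hrf
    ((CStar.isCuntzKrieger_gen hrf').extend hher hrf hsat)
  -- Any quotient that kills the vertex projections of H = `vertexSet I` factors through Ψ. This is
  -- used for J = I, where the factor is injective, and for J = I_H, where only the factorisation
  -- matters.
  have key : ∀ J : ClosedIdeal Λ.CStar, (∀ v ∈ vertexSet I, CStar.gen Λ (Λ.id v) ∈ J.1) →
      ∃ π : (Λ.quotientGraph (vertexSet I) hher).CStar →⋆ₙₐ[ℂ] J.Quot,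
        (∀ μ, π (CStar.gen _ μ) = J.quotHom (CStar.gen Λ μ.1)) ∧ ∀ x, π (Ψ x) = J.quotHom x := by
    intro J hJ
    have hq := hg.map hrf J.quotHom
    have h0 : ∀ v ∈ vertexSet I, J.quotHom (CStar.gen Λ (Λ.id v)) = 0 := fun v hv =>
      J.quotHom_eq_zero.mpr (hJ v hv)
    obtain ⟨π, hπ, -⟩ := CStar.existsUnique_lift hrf' (hq.restrict hher hrf hsat h0)
    refine ⟨π, hπ, fun x => ?_⟩
    have hu := (CStar.existsUnique_lift hrf hq).unique (y₁ := π.comp Ψ) (y₂ := J.quotHom)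
      (fun μ => by
        change π (Ψ (CStar.gen Λ μ)) = _
        rw [hΨ]
        by_cases hs : Λ.s μ ∈ vertexSet I
        · rw [extendFam_of_mem hher hs, map_zero, hq.eq_zero_of_source_mem h0 hs]
        · rw [extendFam_of_notMem hher hs]
          exact hπ ⟨μ, hs⟩) fun μ => rfl
    exact congrArg (fun φ : Λ.CStar →⋆ₙₐ[ℂ] J.Quot => φ x) hu
  obtain ⟨π, hπ, hπΨ⟩ := key I fun v hv => hv
  obtain ⟨χ, -, hχΨ⟩ := key (Λ.idealOf (vertexSet I)) fun v hv => gen_mem_idealOf hv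
  have hinj : Function.Injective π := CStar.injective_of_conditionB hrf' hlc' hB π fun v h =>
    v.2 (I.quotHom_eq_zero.mp ((hπ _).symm.trans h))
  intro x hx
  have h1 : π (Ψ x) = 0 := (hπΨ x).trans (I.quotHom_eq_zero.mpr hx)
  have h2 : Ψ x = 0 := hinj (h1.trans (map_zero π).symm)
  exact (Λ.idealOf (vertexSet I)).quotHom_eq_zero.mp (by rw [← hχΨ, h2, map_zero])

end Ideals

end KGraph

/-! ### The lattice isomorphism -/

theorem theorem5p3 {k : ℕ} (Λ : KGraph.{u} k) (hrf : Λ.RowFinite) (hlc : Λ.LocallyConvex)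
    (hB : ∀ H : Λ.SatHered, (Λ.quotientGraph H.1 H.2.2).ConditionB) :
    ∃ f : Λ.SatHered ≃o ClosedIdeal Λ.CStar, ∀ H : Λ.SatHered, f H = Λ.idealOf H.1 := by
  have hleft : ∀ H : Λ.SatHered, KGraph.vertexSet (Λ.idealOf H.1) = H.1 := fun H =>
    KGraph.vertexSet_idealOf hrf hlc H.2.1 H.2.2 (hB H)
  refine ⟨
    { toFun := fun H => Λ.idealOf H.1
      invFun := fun I => ⟨KGraph.vertexSet I, KGraph.vertexSet_saturated hrf I,
        KGraph.vertexSet_hereditary hrf I⟩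
      left_inv := fun H => Subtype.ext (hleft H)
      right_inv := fun I => le_antisymm (KGraph.idealOf_le fun v hv => hv)
        (KGraph.le_idealOf_vertexSet hrf hlc I (hB ⟨KGraph.vertexSet I,
          KGraph.vertexSet_saturated hrf I, KGraph.vertexSet_hereditary hrf I⟩))
      map_rel_iff' := fun {H K} => ⟨fun h v hv => ?_, fun h => KGraph.idealOf_le fun v hv =>
        KGraph.gen_mem_idealOf (h hv)⟩ }, fun H => rfl⟩
  -- Inclusion of ideals reflects inclusion of vertex sets because K is recovered from I_K.
  have : v ∈ KGraph.vertexSet (Λ.idealOf K.1) := h (KGraph.gen_mem_idealOf hv)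
  rwa [hleft K] at this
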